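/- Call a pair of functions $g,h:\mathbb R\to[0,\infty)$ \emph{admissible} if there are $x_0\in\mathbb R$ and $\delta>0$ such that: (a) $x_0$ is a global minimum of $h$ and, for every integer $n\ge 1$, the function $x\mapsto g(x)e^{-nh(x)}$ is differentiable almost everywhere, attains its maximum at $x_0$ and nowhere else, is nondecreasing on $(-\infty,x_0]$ and nonincreasing on $[x_0,\infty)$; (b) $h$ is twice differentiable on $(x_0-\delta,x_0+\delta)$ with $h''(x_0)>0$, and, writing for $x\in[x_0-\delta,x_0+\delta]$ $$h(x)=h(x_0)+h''(x_0)\Big(\tfrac12(x-x_0)^2+r(x)\Big),\qquad g(x)=g(x_0)\,(1+q(x)),$$ one has $|r(x)|\le \frac1{4\delta}|x-x_0|^3$ and $|q(x)|\le\frac1{4\delta}|x-x_0|$; (c) there are constants $\alpha,c,C'\in(0,\infty)$ such that $h(x)\ge c\log(1+|x-x_0|)$ and $g(x)\le C'(1+|x-x_0|^\alpha)$ for all $x\in\mathbb R\setminus[x_0-\delta,x_0+\delta]$. A pair $G,H:[0,\infty)\to\mathbb R$ is \emph{radially admissible} if $g(s):=G(e^s)$ and $h(s):=H(e^s)-s$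 form an admissible pair. For vectors $y_1,\dots,y_p\in\mathbb R^n$ let $$\Delta(y_1,\dots,y_p)=\Big\{\sum_{i=1}^p s_iy_i : s_1,\dots,s_p\ge 0,\ \sum_{i=1}^p s_i\le 1\Big\}$$ and let $\mathrm{Vol}_p$ denote $p$-dimensional Lebesgue (volume) measure. For a real random variable $X$ and a standard Gaussian $N$ let $\mathrm d_{KS}(X,N)=\sup_{r\in\mathbb R}|\mathbb P[X<r]-\mathbb P[N<r]|$. \textbf{Theorem C.} For each radially admissible pair $(G,H)$ there are a constant $C_{G,H}\in(0,\infty)$ and $n_0\in\mathbb N$ such that for all $n\ge n_0$ the function $s\mapsto G(\|s\|_2)e^{-nH(\|s\|_2)}$ on $\mathbb R^n$ has a finite and positive integral $Z^n$, so that $$\mu^n(\mathrm ds)=\frac1{Z^n}\,G(\|s\|_2)\,e^{-nH(\|s\|_2)}\,\mathrm ds$$ is a probability measure, and the following holds for every integer $p$ with $2\le p\le n$. If $Y_1,\dots,Y_p$ are independent random vectors in $\mathbb R^n$ with law $\mu^n$ and $W:=\log \mathrm{Vol}_p(\Delta(Y_1,\dots,Y_p))$, then $W$ has a finite second moment and positive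 variance, and $$\mathrm d_{KS}\left(\frac{W-\mathbb E[W]}{\sqrt{\mathrm{Var}[W]}},\,N\right)\le C_{G,H}\,\frac{\theta^2}{n(1-\theta)\left[\log\frac1{1-\theta}-\theta\right]^{3/2}},\qquad \theta:=\frac{p-1}n .$$ -/

import Mathlib

open MeasureTheory ProbabilityTheory Set

universe u

noncomputable section

/-- The Kolmogorov(-Smirnov) distance `sup_r |μ(-∞, r) - ν(-∞, r)|` of two probability measures
on the real line. -/
def kolmogorovDist (μ ν : Measure ℝ) : ℝ :=
  ⨆ r : ℝ, |μ.real (Iio r) - ν.real (Iio r)|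

/-- The law of the standardization `(W - E W) / √(Var W)` of a real random variable `W`. -/
def standardizedLaw {Ω : Type*} [MeasurableSpace Ω] (P : Measure Ω) (W : Ω → ℝ) : Measure ℝ :=
  P.map (fun ω => (W ω - ∫ ω', W ω' ∂P) / √(variance W P))

/-- The simplex `Δ(y₁, …, y_p)` with vertices `0, y₁, …, y_p`. -/
def originSimplex {n p : ℕ} (y : Fin p → EuclideanSpace ℝ (Fin n)) :
    Set (EuclideanSpace ℝ (Fin n)) :=
  {x | ∃ s : Fin p → ℝ, (∀ i, 0 ≤ s i) ∧ ∑ i, s i ≤ 1 ∧ x = ∑ i, s i • y i}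

/-- The logarithm of the `p`-dimensional volume of the simplex with vertices `0, y₁, …, y_p`
in `ℝⁿ`. The `p`-dimensional volume is Mathlib's Euclidean Hausdorff measure, normalized so as to
agree with Lebesgue measure on `p`-dimensional Euclidean spaces. -/
def logVolSimplex {n p : ℕ} (y : Fin p → EuclideanSpace ℝ (Fin n)) : ℝ :=
  Real.log ((Measure.euclideanHausdorffMeasure p
    (originSimplex y) : ENNReal).toReal)

/-- Admissibility of a pair of functions `g, h : ℝ → [0, ∞)`. Conditions on the densities
`ρₙ(x) = g(x) exp(-n h(x)) / Zₙ`, `n ≥ 1`, are stated for `g(x) exp(-n h(x))`, as they are not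
affected by the normalizing constant. -/
def Admissible (g h : ℝ → ℝ) : Prop :=
  (∀ x, 0 ≤ g x) ∧ (∀ x, 0 ≤ h x) ∧
  ∃ x₀ δ : ℝ, 0 < δ ∧
    -- (a)
    (∀ x, h x₀ ≤ h x) ∧
    (∀ n : ℕ, 1 ≤ n →
      (∀ᵐ x : ℝ, DifferentiableAt ℝ (fun x => g x * Real.exp (-(n * h x))) x) ∧
      (∀ x, x ≠ x₀ → g x * Real.exp (-(n * h x)) < g x₀ * Real.exp (-(n * h x₀))) ∧
      MonotoneOn (fun x => g x * Real.exp (-(n * h x))) (Iic x₀) ∧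
      AntitoneOn (fun x => g x * Real.exp (-(n * h x))) (Ici x₀)) ∧
    -- (b)
    (∀ x ∈ Ioo (x₀ - δ) (x₀ + δ), DifferentiableAt ℝ h x ∧ DifferentiableAt ℝ (deriv h) x) ∧
    0 < deriv (deriv h) x₀ ∧
    (∃ r q : ℝ → ℝ, ∀ x ∈ Icc (x₀ - δ) (x₀ + δ),
      h x = h x₀ + deriv (deriv h) x₀ * (1 / 2 * (x - x₀) ^ 2 + r x) ∧
      g x = g x₀ * (1 + q x) ∧
      |r x| ≤ 1 / (4 * δ) * |x - x₀| ^ 3 ∧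
      |q x| ≤ 1 / (4 * δ) * |x - x₀|) ∧
    -- (c)
    ∃ α c C : ℝ, 0 < α ∧ 0 < c ∧ 0 < C ∧ ∀ x ∉ Icc (x₀ - δ) (x₀ + δ),
      c * Real.log (1 + |x - x₀|) ≤ h x ∧ g x ≤ C * (1 + |x - x₀| ^ α)

/-- The pair `(G, H)` of functions on `[0, ∞)` is radially admissible if
`g(s) = G(eˢ)` and `h(s) = H(eˢ) - s` form an admissible pair. (Only the values of `G` and `H`
on `(0, ∞)` enter.) -/
def RadiallyAdmissible (G H : ℝ → ℝ) : Prop :=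
  Admissible (fun s => G (Real.exp s)) (fun s => H (Real.exp s) - s)

/-- The unnormalized radial density `G(‖s‖) exp(-n H(‖s‖))` on `ℝⁿ`. -/
def radialWeight (G H : ℝ → ℝ) (n : ℕ) (s : EuclideanSpace ℝ (Fin n)) : ENNReal :=
  ENNReal.ofReal (G ‖s‖ * Real.exp (-(n * H ‖s‖)))

/-- The measure `μₙ` on `ℝⁿ` with Lebesgue density `G(‖s‖) exp(-n H(‖s‖)) / Zₙ`, where
`Zₙ = ∫ G(‖s‖) exp(-n H(‖s‖)) ds`. It is a probability measure as soon as `0 < Zₙ < ∞`. -/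
def radialLaw (G H : ℝ → ℝ) (n : ℕ) : Measure (EuclideanSpace ℝ (Fin n)) :=
  (∫⁻ s, radialWeight G H n s)⁻¹ • (volume.withDensity (radialWeight G H n))

end

/-! The volume of the simplex is the product of the norms of the Gram–Schmidt vectors of `Y₁, …,
Y_p` times the volume of a fixed corner simplex. So, up to a constant, `W` is a sum of logarithms of
distances, the `k`-th being that of a new vector to the span `V` of `k` earlier ones. A radial law
has independent norm and direction, so the characteristic function of `log d(Y, V)` depends on `V`
only through `k = dim V`. It is the product of that of `log ‖Y‖` and a quotient of Gamma functions
at `u / 2`, the transform of half the logarithm of a Beta((n-k)/2, k/2) variable, trivial for `k =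
0` (`integral_distPow_radialLaw`). Integrating out one vector after the other, the characteristic
function of `W` becomes an explicit product (`charFun_map_logVolSimplex`).

Near the origin each factor is a Gaussian characteristic function times `exp ρ` with `|ρ(u)| ≤ K
|u|³` (`HasCumulantExpansion`), and mean, variance `S` and `K` add up under products. The density of
`log ‖Y‖` is proportional to `g e^{-nh}`; Laplace's method gives `S ≥ c/n` and `K = C/n²` for `|u| ≤
c√n`, and decay for all `u` (`Admissible.exists_hasCumulantExpansion`). Euler's product for Gamma
gives variance at least `(1/(n-k) - 1/n)/2` and `K = 5/(n-k)²` for the other factor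
(`exists_hasCumulantExpansion_gammaQuotient`). Put `j = p-1`, `m = n-j = n(1-θ)` and `Λ = log(n/m)`.
Summation yields `S ≥ c₂Λ` and `K ≤ C₁θ/m` for `|u| ≤ c₃ min(m, √n)`; beyond this range the modulus
is exponentially small in `Λ min(m, √n)²`, because the Gamma quotients have decreasing modulus.

A Berry–Esseen inequality obtained by Fejér smoothing
(`exists_kolmogorovDist_le_of_cumulantExpansion`) turns this into three error terms depending on a
cut-off `T`. For `T = mΛ/√θ` each is at most a constant times `√θ/(mΛ^{3/2})`
(`exists_esseen_error_le`). Finally `Λ - θ ≤ θΛ` bounds this by `θ²/(m(Λ-θ)^{3/2})`, which is the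
claim. -/

/-! ### Fejér kernel and the smoothing inequality -/

/-- The Fejér kernel, up to normalization. -/
noncomputable def fejerKernel (x : ℝ) : ℝ := 2 * ∫ t in (0 : ℝ)..1, (1 - t) * Real.cos (t * x)

lemma fejerKernel_eq {x : ℝ} (hx : x ≠ 0) : fejerKernel x = 2 * (1 - Real.cos x) / x ^ 2 := by
  have h : ∫ t in (0 : ℝ)..1, (1 - t) * Real.cos (t * x) =
      ((1 - 1) * Real.sin (1 * x) / x - Real.cos (1 * x) / x ^ 2) -
      ((1 - 0) * Real.sin (0 * x) / x - Real.cos (0 * x) / x ^ 2) := by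
    apply intervalIntegral.integral_eq_sub_of_hasDerivAt
      (f := fun t => (1 - t) * Real.sin (t * x) / x - Real.cos (t * x) / x ^ 2)
    · intro t _
      have h1 : HasDerivAt (fun t : ℝ => t * x) x t := by
        simpa using (hasDerivAt_id t).mul_const x
      have h2 : HasDerivAt (fun t : ℝ => 1 - t) (-1) t := by
        simpa using (hasDerivAt_id t).const_sub 1
      have := ((h2.mul h1.sin).div_const x).sub (h1.cos.div_const (x ^ 2))
      convert! this using 1
      field_simp
      ring
    · apply Continuous.intervalIntegrable
      fun_prop
  rw [fejerKernel, h]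
  simp
  field_simp
  ring

lemma fejerKernel_zero : fejerKernel 0 = 1 := by
  have h : ∫ t in (0 : ℝ)..1, (1 - t) = 1 / 2 := by
    rw [intervalIntegral.integral_sub (by simp) (by simp)]
    simp
    norm_num
  simp [fejerKernel, h]

lemma fejerKernel_nonneg (x : ℝ) : 0 ≤ fejerKernel x := by
  by_cases hx : x = 0
  · simp [hx, fejerKernel_zero]
  · rw [fejerKernel_eq hx]
    have := Real.cos_le_one x
    have : 0 ≤ 1 - Real.cos x := by linarith
    positivity

lemma fejerKernel_le (x : ℝ) : fejerKernel x ≤ 8 * (1 + x ^ 2)⁻¹ := by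
  rw [← div_eq_mul_inv, le_div_iff₀ (by positivity)]
  by_cases hx : x = 0
  · simp [hx, fejerKernel_zero]
  · rw [fejerKernel_eq hx, div_mul_eq_mul_div, div_le_iff₀ (by positivity)]
    have h1 := Real.one_sub_sq_div_two_le_cos (x := x)
    have h2 := Real.neg_one_le_cos x
    nlinarith [sq_nonneg x]

lemma measurable_fejerKernel : Measurable fejerKernel := by
  have : fejerKernel = fun x => if x = 0 then 1 else 2 * (1 - Real.cos x) / x ^ 2 := by
    ext x
    split_ifs with h
    · simp [h, fejerKernel_zero]
    · exact fejerKernel_eq h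
  rw [this]
  apply Measurable.ite (measurableSet_singleton 0) <;> fun_prop

lemma integrable_fejerKernel : Integrable fejerKernel := by
  refine (integrable_inv_one_add_sq.const_mul 8).mono'
    measurable_fejerKernel.aestronglyMeasurable (.of_forall fun x => ?_)
  rw [Real.norm_of_nonneg (fejerKernel_nonneg x)]
  exact fejerKernel_le x

lemma integral_fejerKernel_pos : 0 < ∫ x, fejerKernel x := by
  rw [integral_pos_iff_support_of_nonneg fejerKernel_nonneg integrable_fejerKernel]
  refine lt_of_lt_of_le ?_ (measure_mono (s := Ioo (0 : ℝ) 1) ?_)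
  · simp
  · intro x hx
    have hx0 : x ≠ 0 := hx.1.ne'
    rw [Function.mem_support, fejerKernel_eq hx0]
    have : Real.cos x < 1 := by
      rw [← Real.cos_zero]
      apply Real.cos_lt_cos_of_nonneg_of_le_pi_div_two le_rfl _ hx.1
      linarith [Real.pi_gt_three, hx.2]
    have : 0 < 1 - Real.cos x := by linarith
    positivity

/-- With at most a quarter of the mass outside the window, the error made there in the smoothing
argument is at most half the Kolmogorov distance and can be absorbed. -/
lemma exists_fejerKernel_tail :
    ∃ A : ℝ, 0 < A ∧ ∫ x in (Icc (-A) A)ᶜ, fejerKernel x ≤ (∫ x, fejerKernel x) / 4 := by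
  have h := (aecover_Icc (μ := (volume : Measure ℝ)) (Filter.tendsto_neg_atTop_atBot)
    Filter.tendsto_id).integral_tendsto_of_countably_generated integrable_fejerKernel
  have hlt : (∫ x, fejerKernel x) * (3 / 4) < ∫ x, fejerKernel x := by
    linarith [integral_fejerKernel_pos]
  obtain ⟨A, hA, hA0⟩ := ((h.eventually_const_lt hlt).and (Filter.eventually_gt_atTop 0)).exists
  refine ⟨A, hA0, ?_⟩
  have := integral_add_compl (measurableSet_Icc (a := -A) (b := A)) integrable_fejerKernel
  simp only [id_eq] at hA
  linarith

/-- The kernel is the Fourier transform of the triangle function on `[-1, 1]`, so convolving with it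
only sees frequencies up to 1. -/
lemma integral_fejerKernel_sub (μ : Measure ℝ) [IsProbabilityMeasure μ] (x : ℝ) :
    ∫ y, fejerKernel (x - y) ∂μ =
      2 * ∫ t in Ioc (0 : ℝ) 1, (1 - t) *
        (Complex.exp (t * x * Complex.I) * (starRingEnd ℂ) (charFun μ t)).re := by
  simp only [fejerKernel]
  rw [integral_const_mul]
  congr 1
  simp only [intervalIntegral.integral_of_le zero_le_one]
  rw [integral_integral_swap]
  · refine integral_congr_ae (.of_forall fun t => ?_)
    simp only
    rw [integral_const_mul]
    congr 1
    have hint : Integrable (fun y : ℝ => Complex.exp (t * x * Complex.I) *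
        Complex.exp (-(t * y * Complex.I))) μ := by
      refine Integrable.of_bound (C := 1) (by fun_prop) (.of_forall fun y => ?_)
      rw [← Complex.exp_add, Complex.norm_exp]
      simp
    have h1 : (starRingEnd ℂ) (charFun μ t) = ∫ y : ℝ, Complex.exp (-(t * y * Complex.I)) ∂μ := by
      rw [charFun_apply_real, ← integral_conj]
      congr with y
      rw [← Complex.exp_conj]
      simp
    rw [h1, ← integral_const_mul]
    have h2 := integral_re (𝕜 := ℂ) hint
    simp only [RCLike.re_to_complex] at h2
    rw [← h2]
    congr with y
    rw [← Complex.exp_add]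
    have : (t * x * Complex.I + -(t * y * Complex.I) : ℂ) = ((t * (x - y) : ℝ) : ℂ) * Complex.I := by
      push_cast; ring
    rw [this, Complex.exp_ofReal_mul_I_re]
  · refine Integrable.of_bound (C := 1) (by fun_prop) ?_
    rw [Measure.ae_prod_iff_ae_ae]
    · refine .of_forall fun y => ?_
      filter_upwards [ae_restrict_mem measurableSet_Ioc] with t ht
      simp only [Function.uncurry, norm_mul, Real.norm_eq_abs]
      have h1 : |1 - t| ≤ 1 := by rw [abs_le]; constructor <;> linarith [ht.1, ht.2]
      have h2 := Real.abs_cos_le_one (t * (x - y))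
      calc _ ≤ (1 : ℝ) * 1 := by gcongr
        _ = 1 := by norm_num
    · apply measurableSet_le <;> fun_prop

/-- Fubini and the translation `z = x + y`: averaging the masses of shifted intervals against the
kernel is integrating the smoothed density over the interval. -/
lemma integral_fejerKernel_mul_measureReal_Ico (μ : Measure ℝ) [IsProbabilityMeasure μ] (a b : ℝ) :
    ∫ x, fejerKernel x * μ.real (Ico (a - x) (b - x)) =
      ∫ z in Ico a b, ∫ y, fejerKernel (z - y) ∂μ := by
  have hi : Integrable (Function.uncurry fun (x y : ℝ) =>
      fejerKernel x * (Ico a b).indicator 1 (x + y)) (volume.prod μ) := by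
    have h0 : Integrable (fun z : ℝ × ℝ => fejerKernel z.1) (volume.prod μ) :=
      integrable_fejerKernel.comp_fst μ
    refine h0.mono' ?_ (.of_forall fun z => ?_)
    · apply Measurable.aestronglyMeasurable
      apply (measurable_fejerKernel.comp measurable_fst).mul
      exact (measurable_one.indicator measurableSet_Ico).comp (measurable_fst.add measurable_snd)
    · simp only [Function.uncurry, norm_mul, Real.norm_of_nonneg (fejerKernel_nonneg _)]
      apply mul_le_of_le_one_right (fejerKernel_nonneg _)
      by_cases h : z.1 + z.2 ∈ Ico a b <;> simp [indicator, h]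
  have h1 : ∀ x, fejerKernel x * μ.real (Ico (a - x) (b - x)) =
      ∫ y, fejerKernel x * (Ico a b).indicator 1 (x + y) ∂μ := by
    intro x
    rw [integral_const_mul, ← integral_indicator_one measurableSet_Ico]
    congr 2 with y
    have : x + y ∈ Ico a b ↔ y ∈ Ico (a - x) (b - x) := by
      simp only [mem_Ico, sub_le_iff_le_add', lt_sub_iff_add_lt']
    by_cases h : y ∈ Ico (a - x) (b - x)
    · simp [indicator, this.2 h, h]
    · simp only [indicator, mt this.1 h, h, if_false]
  simp_rw [h1]
  have h2 : ∀ y, ∫ x, fejerKernel x * (Ico a b).indicator 1 (x + y) =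
      ∫ z, fejerKernel (z - y) * (Ico a b).indicator 1 z := by
    intro y
    have := integral_add_right_eq_self (μ := (volume : Measure ℝ))
      (fun z => fejerKernel (z - y) * (Ico a b).indicator 1 z) y
    simpa using this
  rw [integral_integral_swap hi]
  simp_rw [h2]
  rw [integral_integral_swap, ← integral_indicator measurableSet_Ico]
  · congr with z
    rw [integral_mul_const]
    by_cases h : z ∈ Ico a b <;> simp [indicator, h]
  · have h3 := hi.swap
    -- A shear preserves the product measure, which carries the integrability over to the variable
    -- `z`.
    have hm : MeasurePreserving (fun q : ℝ × ℝ => (q.1, q.2 - q.1)) (μ.prod volume) (μ.prod volume) :=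
      MeasurePreserving.skew_product (g := fun y x => x - y) (MeasurePreserving.id μ)
        (by fun_prop) (.of_forall fun y => (measurePreserving_sub_right volume y).map_eq)
    have h4 := hm.integrable_comp_of_integrable h3
    refine h4.congr (.of_forall fun q => ?_)
    simp [Function.uncurry, Function.comp]

/-- The bound does not depend on the interval, which later permits `a → -∞`. The factor `1 / t` is
why characteristic functions are compared in the form `t * B t`. -/
lemma norm_integral_exp_mul_I_le {t : ℝ} (ht : 0 < t) {a b : ℝ} (hab : a ≤ b) :
    ‖∫ z in Ico a b, Complex.exp (t * z * Complex.I)‖ ≤ 2 / t := by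
  rw [integral_Ico_eq_integral_Ioc, ← intervalIntegral.integral_of_le hab]
  have h0 : (t * Complex.I : ℂ) ≠ 0 := by simp [ht.ne']
  have h1 : ∀ z : ℝ, (t * z * Complex.I : ℂ) = t * Complex.I * z := fun z => by ring
  simp_rw [h1]
  rw [integral_exp_mul_complex h0, norm_div, norm_mul, Complex.norm_I, mul_one,
    Complex.norm_real, Real.norm_of_nonneg ht.le]
  gcongr
  refine (norm_sub_le _ _).trans ?_
  have h2 : ∀ z : ℝ, (t * Complex.I * z : ℂ) = ((t * z : ℝ) : ℂ) * Complex.I := fun z => by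
    push_cast; ring
  rw [h2, h2, Complex.norm_exp_ofReal_mul_I, Complex.norm_exp_ofReal_mul_I]
  norm_num

lemma abs_integral_fejerKernel_Ico_le (μ ν : Measure ℝ) [IsProbabilityMeasure μ]
    [IsProbabilityMeasure ν] {B : ℝ → ℝ} (hB : IntegrableOn B (Ioc 0 1))
    (h : ∀ t ∈ Ioc (0 : ℝ) 1, ‖charFun μ t - charFun ν t‖ ≤ t * B t) {a b : ℝ} (hab : a ≤ b) :
    |(∫ x, fejerKernel x * μ.real (Ico (a - x) (b - x))) -
      ∫ x, fejerKernel x * ν.real (Ico (a - x) (b - x))| ≤ 4 * ∫ t in Ioc (0 : ℝ) 1, B t := by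
  rw [integral_fejerKernel_mul_measureReal_Ico, integral_fejerKernel_mul_measureReal_Ico]
  simp_rw [integral_fejerKernel_sub]
  set F : Measure ℝ → ℝ → ℝ → ℝ := fun ρ z t => (1 - t) *
        (Complex.exp (t * z * Complex.I) * (starRingEnd ℂ) (charFun ρ t)).re with hF
  have hFi : ∀ (ρ : Measure ℝ) [IsProbabilityMeasure ρ], Integrable (Function.uncurry (F ρ))
      ((volume.restrict (Ico a b)).prod (volume.restrict (Ioc (0 : ℝ) 1))) := by
    intro ρ _
    refine Integrable.of_bound (C := 1) ?_ ?_
    · apply Measurable.aestronglyMeasurable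
      simp only [hF, Function.uncurry_def]
      have : Measurable fun z : ℝ × ℝ => (starRingEnd ℂ) (charFun ρ z.2) :=
        Complex.continuous_conj.measurable.comp (measurable_charFun.comp measurable_snd)
      fun_prop
    · rw [Measure.ae_prod_iff_ae_ae]
      · refine .of_forall fun y => ?_
        filter_upwards [ae_restrict_mem measurableSet_Ioc] with t ht
        simp only [hF, Function.uncurry, norm_mul, Real.norm_eq_abs]
        have h1 : |1 - t| ≤ 1 := by rw [abs_le]; constructor <;> linarith [ht.1, ht.2]
        have h2 : |(Complex.exp (t * y * Complex.I) * (starRingEnd ℂ) (charFun ρ t)).re| ≤ 1 := by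
          refine (Complex.abs_re_le_norm _).trans ?_
          rw [norm_mul, RCLike.norm_conj]
          have : (t * y * Complex.I : ℂ) = ((t * y : ℝ) : ℂ) * Complex.I := by push_cast; ring
          rw [this, Complex.norm_exp_ofReal_mul_I, one_mul]
          exact norm_charFun_le_one t
        calc _ ≤ (1 : ℝ) * 1 := by gcongr
          _ = 1 := by norm_num
      · apply measurableSet_le
        · simp only [hF, Function.uncurry_def]
          have : Measurable fun z : ℝ × ℝ => (starRingEnd ℂ) (charFun ρ z.2) :=
            Complex.continuous_conj.measurable.comp (measurable_charFun.comp measurable_snd)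
          fun_prop
        · fun_prop
  rw [integral_const_mul, integral_const_mul, integral_integral_swap (hFi μ),
    integral_integral_swap (hFi ν), ← mul_sub, ← integral_sub, abs_mul]
  rotate_left
  · exact (hFi μ).swap.integral_prod_left
  · exact (hFi ν).swap.integral_prod_left
  have hmain : ‖∫ t in Ioc (0 : ℝ) 1, ((∫ z in Ico a b, F μ z t) - ∫ z in Ico a b, F ν z t)‖ ≤
      ∫ t in Ioc (0 : ℝ) 1, 2 * B t := by
    refine norm_integral_le_of_norm_le (hB.const_mul 2) ?_
    filter_upwards [ae_restrict_mem measurableSet_Ioc] with t ht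
    have hI : ∀ ρ : Measure ℝ, ∫ z in Ico a b, F ρ z t = (1 - t) *
        ((∫ z in Ico a b, Complex.exp (t * z * Complex.I)) * (starRingEnd ℂ) (charFun ρ t)).re := by
      intro ρ
      simp only [hF]
      rw [integral_const_mul, ← integral_mul_const]
      congr 1
      have hint : Integrable (fun z : ℝ => Complex.exp (t * z * Complex.I) *
          (starRingEnd ℂ) (charFun ρ t)) (volume.restrict (Ico a b)) := by
        have : Continuous (fun z : ℝ => Complex.exp (t * z * Complex.I) *
          (starRingEnd ℂ) (charFun ρ t)) := by fun_prop
        exact (this.integrableOn_Icc (a := a) (b := b)).mono_set Ico_subset_Icc_self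
      exact integral_re (𝕜 := ℂ) hint
    rw [hI, hI, ← mul_sub, ← Complex.sub_re, ← mul_sub, ← map_sub, norm_mul]
    have h1 : ‖1 - t‖ ≤ 1 := by
      rw [Real.norm_eq_abs, abs_le]; constructor <;> linarith [ht.1, ht.2]
    calc _ ≤ 1 * (2 / t * (t * B t)) := by
          gcongr
          rw [Real.norm_eq_abs]
          refine (Complex.abs_re_le_norm _).trans ?_
          rw [norm_mul, RCLike.norm_conj]
          exact mul_le_mul (norm_integral_exp_mul_I_le ht.1 hab) (h t ht) (norm_nonneg _)
            (by have := ht.1; positivity)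
      _ = 2 * B t := by
          have := ht.1.ne'
          field_simp
  rw [integral_const_mul, Real.norm_eq_abs] at hmain
  rw [abs_of_pos (by norm_num : (0 : ℝ) < 2)]
  linarith

lemma measurable_measureReal_Iio (μ : Measure ℝ) [IsProbabilityMeasure μ] :
    Measurable fun x => μ.real (Iio x) :=
  Monotone.measurable fun _ _ h => measureReal_mono (Iio_subset_Iio h)

lemma integrable_fejerKernel_mul_measureReal_Iio (μ : Measure ℝ) [IsProbabilityMeasure μ] (b : ℝ) :
    Integrable fun x => fejerKernel x * μ.real (Iio (b - x)) := by
  refine integrable_fejerKernel.mono' ?_ (.of_forall fun x => ?_)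
  · exact (measurable_fejerKernel.mul ((measurable_measureReal_Iio μ).comp
      (by fun_prop : Measurable fun x : ℝ => b - x))).aestronglyMeasurable
  · rw [norm_mul, Real.norm_of_nonneg (fejerKernel_nonneg x),
      Real.norm_of_nonneg measureReal_nonneg]
    exact mul_le_of_le_one_right (fejerKernel_nonneg _) measureReal_le_one

lemma tendsto_integral_fejerKernel_Ico (μ : Measure ℝ) [IsProbabilityMeasure μ] (b : ℝ) :
    Filter.Tendsto (fun a => ∫ x, fejerKernel x * μ.real (Ico (a - x) (b - x))) Filter.atBot
      (nhds (∫ x, fejerKernel x * μ.real (Iio (b - x)))) := by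
  have hIco : ∀ x, ∀ a ≤ b, μ.real (Ico (a - x) (b - x)) =
      μ.real (Iio (b - x)) - μ.real (Iio (a - x)) := by
    intro x a ha
    rw [← measureReal_sdiff (Iio_subset_Iio (by linarith)) measurableSet_Iio]
    congr 1
    ext y
    simp only [mem_Ico, Set.mem_sdiff, mem_Iio, not_lt]
    tauto
  refine tendsto_integral_filter_of_dominated_convergence fejerKernel ?_ ?_
    integrable_fejerKernel ?_
  · filter_upwards [Filter.eventually_le_atBot b] with a ha
    simp_rw [fun x => hIco x a ha]
    have h1 : ∀ c : ℝ, Measurable fun x : ℝ => μ.real (Iio (c - x)) := fun c =>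
      (measurable_measureReal_Iio μ).comp (by fun_prop : Measurable fun x : ℝ => c - x)
    exact (measurable_fejerKernel.mul ((h1 b).sub (h1 a))).aestronglyMeasurable
  · refine .of_forall fun a => .of_forall fun x => ?_
    rw [norm_mul, Real.norm_of_nonneg (fejerKernel_nonneg x),
      Real.norm_of_nonneg measureReal_nonneg]
    exact mul_le_of_le_one_right (fejerKernel_nonneg _) measureReal_le_one
  · refine .of_forall fun x => Filter.Tendsto.const_mul _ ?_
    have h0 : Filter.Tendsto (fun a => μ.real (Iio (a - x))) Filter.atBot (nhds 0) := by
      have h1 : Filter.Tendsto (fun a => μ.real (Iic a)) Filter.atBot (nhds 0) := by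
        exact (tendsto_cdf_atBot μ).congr fun x => cdf_eq_real μ x
      have h2 : Filter.Tendsto (fun a : ℝ => a - x) Filter.atBot Filter.atBot :=
        Filter.tendsto_atBot_add_const_right _ (-x) Filter.tendsto_id
      exact squeeze_zero (fun _ => measureReal_nonneg)
        (fun _ => measureReal_mono Iio_subset_Iic_self) (h1.comp h2)
    have h3 := h0.const_sub (μ.real (Iio (b - x)))
    rw [sub_zero] at h3
    refine h3.congr' ?_
    filter_upwards [Filter.eventually_le_atBot b] with a ha
    rw [hIco x a ha]

lemma abs_integral_fejerKernel_Iio_le (μ ν : Measure ℝ) [IsProbabilityMeasure μ]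
    [IsProbabilityMeasure ν] {B : ℝ → ℝ} (hB : IntegrableOn B (Ioc 0 1))
    (h : ∀ t ∈ Ioc (0 : ℝ) 1, ‖charFun μ t - charFun ν t‖ ≤ t * B t) (b : ℝ) :
    |∫ x, fejerKernel x * (μ.real (Iio (b - x)) - ν.real (Iio (b - x)))| ≤
      4 * ∫ t in Ioc (0 : ℝ) 1, B t := by
  simp_rw [mul_sub]
  rw [integral_sub (integrable_fejerKernel_mul_measureReal_Iio μ b)
    (integrable_fejerKernel_mul_measureReal_Iio ν b)]
  refine le_of_tendsto ((tendsto_integral_fejerKernel_Ico μ b).sub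
    (tendsto_integral_fejerKernel_Ico ν b)).abs ?_
  filter_upwards [Filter.eventually_le_atBot b] with a ha
  exact abs_integral_fejerKernel_Ico_le μ ν hB h ha

lemma abs_measureReal_Iio_sub_le_kolmogorovDist (μ ν : Measure ℝ) [IsProbabilityMeasure μ]
    [IsProbabilityMeasure ν] (r : ℝ) :
    |μ.real (Iio r) - ν.real (Iio r)| ≤ kolmogorovDist μ ν := by
  refine le_ciSup (f := fun r => |μ.real (Iio r) - ν.real (Iio r)|) ⟨1, ?_⟩ r
  rintro _ ⟨s, rfl⟩
  have h1 := measureReal_le_one (μ := μ) (s := Iio s)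
  have h2 := measureReal_le_one (μ := ν) (s := Iio s)
  have h3 := measureReal_nonneg (μ := μ) (s := Iio s)
  have h4 := measureReal_nonneg (μ := ν) (s := Iio s)
  rw [abs_le]
  constructor <;> linarith

/-- A smoothing inequality: the Kolmogorov distance is controlled by the characteristic functions
on `[0, 1]` and the Lipschitz constant of one of the distribution functions. -/
theorem exists_kolmogorovDist_le_of_charFun : ∃ C : ℝ, 0 < C ∧
    ∀ (μ ν : Measure ℝ) [IsProbabilityMeasure μ] [IsProbabilityMeasure ν] (B : ℝ → ℝ) (M : ℝ),
      0 ≤ M → IntegrableOn B (Ioc 0 1) →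
      (∀ t ∈ Ioc (0 : ℝ) 1, ‖charFun μ t - charFun ν t‖ ≤ t * B t) →
      (∀ r s, r ≤ s → ν.real (Iio s) - ν.real (Iio r) ≤ M * (s - r)) →
      kolmogorovDist μ ν ≤ C * ((∫ t in Ioc (0 : ℝ) 1, B t) + M) := by
  obtain ⟨A, hA, htail⟩ := exists_fejerKernel_tail
  set I := ∫ x, fejerKernel x with hI
  have hIpos : 0 < I := integral_fejerKernel_pos
  refine ⟨8 / I + 4 * A, by positivity, fun μ ν _ _ B M hM hB hchar hlip => ?_⟩
  set d : ℝ → ℝ := fun r => μ.real (Iio r) - ν.real (Iio r) with hd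
  set η := kolmogorovDist μ ν with hη
  have hdη : ∀ r, |d r| ≤ η := abs_measureReal_Iio_sub_le_kolmogorovDist μ ν
  set E := ∫ t in Ioc (0 : ℝ) 1, B t with hE
  have hsm : ∀ b, |∫ x, fejerKernel x * d (b - x)| ≤ 4 * E :=
    abs_integral_fejerKernel_Iio_le μ ν hB hchar
  have hmono : ∀ r s, r ≤ s → d r - M * (s - r) ≤ d s := by
    intro r s hrs
    have h1 := hlip r s hrs
    have h2 : μ.real (Iio r) ≤ μ.real (Iio s) := measureReal_mono (Iio_subset_Iio hrs)
    simp only [hd]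
    linarith
  have hint : ∀ b, Integrable fun x => fejerKernel x * d (b - x) := by
    intro b
    simp_rw [hd, mul_sub]
    exact (integrable_fejerKernel_mul_measureReal_Iio μ b).sub
      (integrable_fejerKernel_mul_measureReal_Iio ν b)
  -- The sign `σ` treats large positive and large negative deviations at once. As `d` can drop only
  -- at a Lipschitz rate, a deviation at `r` persists on a window of length `2A` to the right of `r`
  -- if positive and to the left if negative; `b = r ± A` centres the kernel there.
  have key : ∀ r b : ℝ, ∀ σ : ℝ, (σ = 1 ∨ σ = -1) →
      (∀ x ∈ Icc (-A) A, σ * d r - 2 * A * M ≤ σ * d (b - x)) →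
      σ * d r ≤ 4 * E / I + 2 * A * M + η / 2 := by
    intro r b σ hσ hx
    have hσd : ∀ s, |σ * d s| ≤ η := by
      intro s
      rcases hσ with rfl | rfl <;> simpa using hdη s
    have hT : IntegrableOn fejerKernel (Icc (-A) A)ᶜ := integrable_fejerKernel.integrableOn
    -- On the window the deviation persists by assumption; outside it the trivial bound `|d| ≤ η`
    -- costs `2η` per unit of kernel mass.
    have h1 : ∫ x, (fejerKernel x * (σ * d r - 2 * A * M) -
        (Icc (-A) A)ᶜ.indicator fejerKernel x * (2 * η)) ≤ ∫ x, σ * (fejerKernel x * d (b - x)) := by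
      apply integral_mono
      · exact (integrable_fejerKernel.mul_const _).sub
          ((integrable_fejerKernel.indicator measurableSet_Icc.compl).mul_const _)
      · exact (hint b).const_mul _
      · intro x
        have hk := fejerKernel_nonneg x
        by_cases hxA : x ∈ Icc (-A) A
        · have := mul_le_mul_of_nonneg_left (hx x hxA) hk
          simp only [indicator, mem_compl_iff, hxA, not_true_eq_false, if_false]
          linarith
        · have h2 := (abs_le.1 (hσd r)).2
          have h3 := (abs_le.1 (hσd (b - x))).1
          have h4 : σ * d r - 2 * A * M - 2 * η ≤ σ * d (b - x) := by
            have : 0 ≤ 2 * A * M := by positivity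
            linarith
          have := mul_le_mul_of_nonneg_left h4 hk
          simp only [indicator, mem_compl_iff, hxA, not_false_eq_true, if_true]
          linarith
    rw [integral_sub (integrable_fejerKernel.mul_const _)
      ((integrable_fejerKernel.indicator measurableSet_Icc.compl).mul_const _), integral_mul_const,
      integral_mul_const, integral_indicator measurableSet_Icc.compl, integral_const_mul, ← hI] at h1
    have h2 : σ * ∫ x, fejerKernel x * d (b - x) ≤ 4 * E := by
      refine (le_abs_self _).trans ?_
      rw [abs_mul]
      rcases hσ with rfl | rfl <;> simpa using hsm b
    have hη0 : 0 ≤ η := (abs_nonneg _).trans (hdη 0)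
    have h3 : (∫ x in (Icc (-A) A)ᶜ, fejerKernel x) * (2 * η) ≤ I / 4 * (2 * η) := by gcongr
    have h4 : I * (σ * d r) ≤ I * (4 * E / I + 2 * A * M + η / 2) := by
      have : I * (4 * E / I + 2 * A * M + η / 2) = 4 * E + I * (2 * A * M) + I / 4 * (2 * η) := by
        field_simp
        ring
      rw [this]
      linarith
    exact le_of_mul_le_mul_left h4 hIpos
  have hbound : ∀ r, |d r| ≤ 4 * E / I + 2 * A * M + η / 2 := by
    intro r
    rw [abs_le']
    constructor
    · have := key r (r + A) 1 (Or.inl rfl) fun x hx => by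
        have h1 := hmono r (r + A - x) (by linarith [hx.2])
        have h2 : M * (r + A - x - r) ≤ M * (2 * A) := by
          gcongr
          linarith [hx.1]
        linarith
      linarith
    · have := key r (r - A) (-1) (Or.inr rfl) fun x hx => by
        have h1 := hmono (r - A - x) r (by linarith [hx.1])
        have h2 : M * (r - (r - A - x)) ≤ M * (2 * A) := by
          gcongr
          linarith [hx.2]
        linarith
      linarith
  -- Absorbing `η / 2` doubles the other terms and produces the constant `8 / I + 4 * A`.
  have hfin : η ≤ 4 * E / I + 2 * A * M + η / 2 := ciSup_le hbound
  have hE0 : 0 ≤ E := by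
    have := (abs_nonneg _).trans (hsm 0)
    linarith
  calc η ≤ 8 / I * E + 4 * A * M := by
        have : 8 / I * E = 2 * (4 * E / I) := by ring
        linarith
    _ ≤ (8 / I + 4 * A) * (E + M) := by
        have h1 : 0 ≤ 8 / I * M := by positivity
        have h2 : 0 ≤ 4 * A * E := by positivity
        linarith

/-! ### Cumulant expansions with cubic remainder -/

/-- On `[-u₀, u₀]` the function `φ` agrees with the characteristic function of the Gaussian law of
mean `M` and variance `S` up to a factor `exp ρ` with `|ρ(u)| ≤ K |u|³`. -/
def HasCumulantExpansion (φ : ℝ → ℂ) (M S K u₀ : ℝ) : Prop :=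
  ∀ u : ℝ, |u| ≤ u₀ → ∃ ρ : ℂ, ‖ρ‖ ≤ K * |u| ^ 3 ∧
    φ u = Complex.exp (u * M * Complex.I - S * u ^ 2 / 2 + ρ)

namespace HasCumulantExpansion

variable {φ ψ : ℝ → ℂ} {M S K M' S' K' u₀ u₁ : ℝ}

lemma mono (h : HasCumulantExpansion φ M S K u₀) (hK : K ≤ K') (hu : u₁ ≤ u₀) :
    HasCumulantExpansion φ M S K' u₁ := fun u hu' => by
  obtain ⟨ρ, hρ, he⟩ := h u (hu'.trans hu)
  exact ⟨ρ, hρ.trans (by gcongr), he⟩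

lemma mul (h : HasCumulantExpansion φ M S K u₀) (h' : HasCumulantExpansion ψ M' S' K' u₀) :
    HasCumulantExpansion (fun u => φ u * ψ u) (M + M') (S + S') (K + K') u₀ := fun u hu => by
  obtain ⟨ρ, hρ, he⟩ := h u hu
  obtain ⟨ρ', hρ', he'⟩ := h' u hu
  refine ⟨ρ + ρ', (norm_add_le _ _).trans (by linarith), ?_⟩
  simp only
  rw [he, he', ← Complex.exp_add]
  push_cast
  ring_nf

lemma prod {ι : Type*} (s : Finset ι) {φ : ι → ℝ → ℂ} {M S K : ι → ℝ}
    (h : ∀ i ∈ s, HasCumulantExpansion (φ i) (M i) (S i) (K i) u₀) :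
    HasCumulantExpansion (fun u => ∏ i ∈ s, φ i u) (∑ i ∈ s, M i) (∑ i ∈ s, S i)
      (∑ i ∈ s, K i) u₀ := by
  classical
  induction s using Finset.induction_on with
  | empty => exact fun u _ => ⟨0, by simp, by simp⟩
  | insert i s hi ih =>
    simp_rw [Finset.prod_insert hi, Finset.sum_insert hi]
    exact (h i (by simp)).mul (ih fun j hj => h j (by simp [hj]))

lemma pow (h : HasCumulantExpansion φ M S K u₀) (p : ℕ) :
    HasCumulantExpansion (fun u => φ u ^ p) (p * M) (p * S) (p * K) u₀ := by
  have := prod (Finset.range p) (fun i _ => h)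
  simpa using this

lemma norm_eq (h : HasCumulantExpansion φ M S K u₀) {u : ℝ} (hu : |u| ≤ u₀) :
    ‖φ u‖ ≤ Real.exp (-(S * u ^ 2 / 2) + K * |u| ^ 3) := by
  obtain ⟨ρ, hρ, he⟩ := h u hu
  rw [he, Complex.norm_exp]
  have h1 : (u * M * Complex.I - S * u ^ 2 / 2 + ρ : ℂ).re = -(S * u ^ 2 / 2) + ρ.re := by
    have : (S * u ^ 2 / 2 : ℂ) = ((S * u ^ 2 / 2 : ℝ) : ℂ) := by push_cast; ring
    rw [this, Complex.add_re, Complex.sub_re, Complex.ofReal_re]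
    simp
  rw [h1]
  gcongr
  exact (Complex.re_le_norm ρ).trans hρ

/-- When `K |u| ≤ S / 4` the remainder uses up at most half of the Gaussian exponent; the other half
survives in the estimate `|e^ρ - 1| ≤ |ρ| e^{|ρ|}`. -/
lemma norm_sub_le (h : HasCumulantExpansion φ 0 S K u₀) {u : ℝ} (hu : |u| ≤ u₀)
    (hK : K * |u| ≤ S / 4) :
    ‖φ u - Complex.exp (-(S * u ^ 2 / 2))‖ ≤ K * |u| ^ 3 * Real.exp (-(S * u ^ 2 / 4)) := by
  obtain ⟨ρ, hρ, he⟩ := h u hu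
  have h1 : φ u - Complex.exp (-(S * u ^ 2 / 2)) =
      Complex.exp ((-(S * u ^ 2 / 2) : ℝ)) * (Complex.exp ρ - 1) := by
    rw [he, mul_sub, ← Complex.exp_add]
    push_cast
    ring_nf
  have h2 : ‖Complex.exp ρ - 1‖ ≤ ‖ρ‖ * Real.exp ‖ρ‖ := by
    simpa using Complex.norm_exp_sub_sum_le_norm_mul_exp ρ 1
  rw [h1, norm_mul, Complex.norm_exp, Complex.ofReal_re]
  have h3 : K * |u| ^ 3 ≤ S * u ^ 2 / 4 := by
    have : K * |u| ^ 3 = K * |u| * u ^ 2 := by rw [← sq_abs u]; ring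
    rw [this]
    nlinarith [sq_nonneg u]
  calc Real.exp (-(S * u ^ 2 / 2)) * ‖Complex.exp ρ - 1‖
      ≤ Real.exp (-(S * u ^ 2 / 2)) * (K * |u| ^ 3 * Real.exp (S * u ^ 2 / 4)) := by
        gcongr
        refine h2.trans (mul_le_mul hρ ?_ (Real.exp_pos _).le ((norm_nonneg _).trans hρ))
        exact Real.exp_le_exp.2 (hρ.trans h3)
    _ = K * |u| ^ 3 * Real.exp (-(S * u ^ 2 / 4)) := by
        rw [mul_left_comm, ← Real.exp_add]
        ring_nf

lemma center {μ : Measure ℝ} (h : HasCumulantExpansion (charFun μ) M S K u₀) :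
    HasCumulantExpansion (charFun (μ.map (fun x => x + -M))) 0 S K u₀ := fun u hu => by
  obtain ⟨ρ, hρ, he⟩ := h u hu
  refine ⟨ρ, hρ, ?_⟩
  rw [charFun_map_add_const, he, ← Complex.exp_add]
  simp only [RCLike.inner_apply, conj_trivial]
  push_cast
  ring_nf

open Filter Topology in
-- The exponent is `-S v² / 2 + O(v³)`, and `exp z - 1 = z + O(|z|²)` adds only `O(v⁴)`.
lemma tendsto_of_seq (h : HasCumulantExpansion φ 0 S K u₀) {v : ℕ → ℝ} (hv0 : ∀ n, 0 < v n)
    (hv1 : ∀ n, v n ≤ u₀) (hv : Tendsto v atTop (𝓝 0)) :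
    Tendsto (fun n => (φ (v n) - 1) / (v n : ℂ) ^ 2) atTop (𝓝 (-((S / 2 : ℝ) : ℂ))) := by
  have hu₀ : 0 < u₀ := (hv0 0).trans_le (hv1 0)
  have hK : 0 ≤ K := by
    obtain ⟨ρ, hρ, -⟩ := h u₀ (abs_of_pos hu₀).le
    have := (norm_nonneg _).trans hρ
    by_contra hK
    have : K * |u₀| ^ 3 < 0 := mul_neg_of_neg_of_pos (not_le.1 hK) (by positivity)
    linarith
  set c := |S| / 2 + K * u₀ with hc
  have hc0 : 0 ≤ c := by positivity
  rw [tendsto_iff_norm_sub_tendsto_zero]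
  have hlim : Tendsto (fun n => K * v n + c ^ 2 * v n ^ 2) atTop (𝓝 0) := by
    have := (hv.const_mul K).add ((hv.pow 2).const_mul (c ^ 2))
    simpa using this
  have hsmall : ∀ᶠ n in atTop, c * v n ^ 2 ≤ 1 := by
    have := (hv.pow 2).const_mul c
    simp only [ne_eq, OfNat.ofNat_ne_zero, not_false_eq_true, zero_pow, mul_zero] at this
    exact (this.eventually_lt_const one_pos).mono fun n hn => hn.le
  refine squeeze_zero' (.of_forall fun n => norm_nonneg _) ?_ hlim
  filter_upwards [hsmall] with n hn
  have hvn := hv0 n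
  have hvn1 := hv1 n
  obtain ⟨ρ, hρ, he⟩ := h (v n) (by rw [abs_of_pos hvn]; exact hvn1)
  rw [abs_of_pos hvn] at hρ
  set z : ℂ := v n * (0 : ℝ) * Complex.I - S * v n ^ 2 / 2 + ρ with hz
  have hz' : z = ((-(S * v n ^ 2 / 2) : ℝ) : ℂ) + ρ := by
    rw [hz]; push_cast; ring
  have hznorm : ‖z‖ ≤ c * v n ^ 2 := by
    rw [hz']
    refine (norm_add_le _ _).trans ?_
    rw [Complex.norm_real, Real.norm_eq_abs, abs_neg, abs_div, abs_mul, abs_of_nonneg (sq_nonneg (v n)),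
      abs_two, hc, add_mul]
    have : K * v n ^ 3 ≤ K * u₀ * v n ^ 2 := by
      have : K * v n ^ 3 = K * v n * v n ^ 2 := by ring
      rw [this]
      gcongr
    linarith
  have h1 := Complex.norm_exp_sub_one_sub_id_le (hznorm.trans hn)
  have hvc : (v n : ℂ) ≠ 0 := by exact_mod_cast hvn.ne'
  have h2 : (φ (v n) - 1) / (v n : ℂ) ^ 2 - (-((S / 2 : ℝ) : ℂ)) =
      (ρ + (Complex.exp z - 1 - z)) / (v n : ℂ) ^ 2 := by
    rw [he, div_sub' (pow_ne_zero 2 hvc)]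
    congr 1
    rw [hz']
    push_cast
    ring
  rw [h2, norm_div, norm_pow, Complex.norm_real, Real.norm_of_nonneg hvn.le,
    div_le_iff₀ (by positivity)]
  refine (norm_add_le _ _).trans ?_
  have h3 : ‖z‖ ^ 2 ≤ (c * v n ^ 2) ^ 2 := by gcongr
  calc _ ≤ K * v n ^ 3 + (c * v n ^ 2) ^ 2 := by gcongr; exact h1.trans h3
    _ = _ := by ring

open Filter Topology in
-- No moment is assumed. The functions `2 (1 - cos (v x)) / v²` increase at most to `x²`, tend to it
-- as `v → 0`, and have integrals tending to `S`; Fatou makes `x²` integrable. It then dominates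
-- them, which identifies the second moment, and `sin (v x) / v`, dominated by `|x|`, identifies the
-- first.
theorem moments {μ : Measure ℝ} [IsProbabilityMeasure μ] (hu₀ : 0 < u₀)
    (h : HasCumulantExpansion (charFun μ) 0 S K u₀) :
    MemLp id 2 μ ∧ ∫ x, x ∂μ = 0 ∧ ∫ x, x ^ 2 ∂μ = S := by
  set v : ℕ → ℝ := fun n => u₀ / (n + 1) with hv
  have hv0 : ∀ n, 0 < v n := fun n => by positivity
  have hv1 : ∀ n, v n ≤ u₀ := fun n => div_le_self hu₀.le (by simp)
  have hvlim : Tendsto v atTop (𝓝 0) := by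
    have := (tendsto_one_div_add_atTop_nhds_zero_nat (𝕜 := ℝ)).const_mul u₀
    simpa [hv, div_eq_mul_inv] using this
  have hlim := h.tendsto_of_seq hv0 hv1 hvlim
  have hintexp : ∀ t : ℝ, Integrable (fun x : ℝ => Complex.exp (t * x * Complex.I)) μ := by
    intro t
    refine Integrable.of_bound (C := 1) (by fun_prop) (.of_forall fun x => ?_)
    have : (t * x * Complex.I : ℂ) = ((t * x : ℝ) : ℂ) * Complex.I := by push_cast; ring
    rw [this, Complex.norm_exp_ofReal_mul_I]
  have hcos : ∀ t : ℝ, ∫ x, Real.cos (t * x) ∂μ = (charFun μ t).re := by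
    intro t
    rw [charFun_apply_real]
    have := integral_re (𝕜 := ℂ) (hintexp t)
    simp only [RCLike.re_to_complex] at this
    rw [← this]
    congr with x
    have : (t * x * Complex.I : ℂ) = ((t * x : ℝ) : ℂ) * Complex.I := by push_cast; ring
    rw [this, Complex.exp_ofReal_mul_I_re]
  have hsin : ∀ t : ℝ, ∫ x, Real.sin (t * x) ∂μ = (charFun μ t).im := by
    intro t
    rw [charFun_apply_real]
    have := integral_im (𝕜 := ℂ) (hintexp t)
    simp only [RCLike.im_to_complex] at this
    rw [← this]
    congr with x
    have : (t * x * Complex.I : ℂ) = ((t * x : ℝ) : ℂ) * Complex.I := by push_cast; ring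
    rw [this, Complex.exp_ofReal_mul_I_im]
  set f : ℕ → ℝ → ℝ := fun n x => 2 * (1 - Real.cos (v n * x)) / v n ^ 2 with hf
  have hf0 : ∀ n x, 0 ≤ f n x := fun n x => by
    have : 0 ≤ 1 - Real.cos (v n * x) := by linarith [Real.cos_le_one (v n * x)]
    positivity
  have hfle : ∀ n x, f n x ≤ x ^ 2 := fun n x => by
    have := Real.one_sub_sq_div_two_le_cos (x := v n * x)
    rw [hf, div_le_iff₀ (pow_pos (hv0 n) 2)]
    nlinarith
  have hslope : ∀ x, Tendsto (fun n => Real.sin (v n * x) / v n) atTop (𝓝 x) := by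
    intro x
    have hd : HasDerivAt (fun t => Real.sin (t * x)) x 0 := by
      have := ((hasDerivAt_id (0 : ℝ)).mul_const x).sin
      simpa using this
    have h2 : Tendsto v atTop (𝓝[≠] 0) :=
      tendsto_nhdsWithin_iff.2 ⟨hvlim, .of_forall fun n => (hv0 n).ne'⟩
    refine (hd.tendsto_slope_zero.comp h2).congr fun n => ?_
    simp
    field_simp
  have hflim : ∀ x, Tendsto (fun n => f n x) atTop (𝓝 (x ^ 2)) := by
    intro x
    have h1 := ((hslope (x / 2)).const_mul 2).pow 2
    have h2 : (2 * (x / 2)) ^ 2 = x ^ 2 := by ring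
    rw [h2] at h1
    refine h1.congr fun n => ?_
    have h3 : Real.cos (v n * x) = 1 - 2 * Real.sin (v n * (x / 2)) ^ 2 := by
      have : v n * x = 2 * (v n * (x / 2)) := by ring
      rw [this, Real.cos_two_mul, Real.cos_sq']
      ring
    simp only [hf]
    rw [h3]
    have := (hv0 n).ne'
    field_simp
    ring
  have hfint : ∀ n, ∫ x, f n x ∂μ = -2 * ((charFun μ (v n) - 1) / (v n : ℂ) ^ 2).re := by
    intro n
    simp only [hf]
    have h1 : ((charFun μ (v n) - 1) / (v n : ℂ) ^ 2).re = ((charFun μ (v n)).re - 1) / v n ^ 2 := by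
      rw [← Complex.ofReal_pow, Complex.div_ofReal_re]
      simp
    have h2 : Integrable (fun x => Real.cos (v n * x)) μ := by
      refine Integrable.of_bound (C := 1) (by fun_prop) (.of_forall fun x => Real.abs_cos_le_one _)
    rw [integral_div, integral_const_mul, integral_sub (integrable_const _) h2, hcos, h1]
    simp
    ring
  have hfi : ∀ n, Integrable (f n) μ := fun n => by
    have h2 : Integrable (fun x => Real.cos (v n * x)) μ :=
      Integrable.of_bound (C := 1) (by fun_prop) (.of_forall fun x => Real.abs_cos_le_one _)
    exact (((integrable_const _).sub h2).const_mul 2).div_const _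
  have hflim2 : Tendsto (fun n => ∫ x, f n x ∂μ) atTop (𝓝 S) := by
    simp_rw [hfint]
    have := ((Complex.continuous_re.tendsto _).comp hlim).const_mul (-2)
    convert! this using 2
    simp
    ring
  have hmem : MemLp id 2 μ := by
    refine (memLp_two_iff_integrable_sq aestronglyMeasurable_id).2 ⟨by fun_prop, ?_⟩
    rw [hasFiniteIntegral_iff_enorm]
    have hfat := lintegral_liminf_le (μ := μ) (f := fun n x => ENNReal.ofReal (f n x)) (u := atTop)
      (fun n => by simp only [hf]; fun_prop)
    have h1 : ∀ x : ℝ, liminf (fun n => ENNReal.ofReal (f n x)) atTop = ‖id x ^ 2‖ₑ := by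
      intro x
      rw [(ENNReal.tendsto_ofReal (hflim x)).liminf_eq, Real.enorm_of_nonneg (sq_nonneg _)]
      rfl
    simp_rw [h1] at hfat
    refine hfat.trans_lt ?_
    have h2 : ∀ n, ∫⁻ x, ENNReal.ofReal (f n x) ∂μ = ENNReal.ofReal (∫ x, f n x ∂μ) := fun n =>
      (ofReal_integral_eq_lintegral_ofReal (hfi n) (.of_forall (hf0 n))).symm
    simp_rw [h2]
    rw [(ENNReal.tendsto_ofReal hflim2).liminf_eq]
    exact ENNReal.ofReal_lt_top
  have hsq : Integrable (fun x : ℝ => x ^ 2) μ :=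
    (memLp_two_iff_integrable_sq aestronglyMeasurable_id).1 hmem
  have hid : Integrable (fun x : ℝ => x) μ := hmem.integrable one_le_two
  refine ⟨hmem, ?_, ?_⟩
  · have hdct : Tendsto (fun n => ∫ x, Real.sin (v n * x) / v n ∂μ) atTop (𝓝 (∫ x, x ∂μ)) := by
      refine tendsto_integral_of_dominated_convergence (fun x => |x|) (fun n => by fun_prop) hid.abs
        (fun n => .of_forall fun x => ?_) (.of_forall fun x => ?_)
      · rw [norm_div, Real.norm_of_nonneg (hv0 n).le, div_le_iff₀ (hv0 n), Real.norm_eq_abs]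
        refine Real.abs_sin_le_abs.trans ?_
        rw [abs_mul, abs_of_pos (hv0 n), mul_comm]
      · exact hslope x
    have h0 : Tendsto (fun n => ∫ x, Real.sin (v n * x) / v n ∂μ) atTop (𝓝 0) := by
      have h1 : ∀ n, ∫ x, Real.sin (v n * x) / v n ∂μ =
          v n * ((charFun μ (v n) - 1) / (v n : ℂ) ^ 2).im := by
        intro n
        rw [integral_div, hsin, ← Complex.ofReal_pow, Complex.div_ofReal_im]
        have := (hv0 n).ne'
        simp
        field_simp
      simp_rw [h1]
      have := hvlim.mul ((Complex.continuous_im.tendsto _).comp hlim)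
      simpa using this
    exact tendsto_nhds_unique hdct h0
  · refine tendsto_nhds_unique (tendsto_integral_of_dominated_convergence (fun x => x ^ 2)
      (fun n => (hfi n).aestronglyMeasurable) hsq (fun n => .of_forall fun x => ?_)
      (.of_forall hflim)) hflim2
    rw [Real.norm_of_nonneg (hf0 n x)]
    exact hfle n x

end HasCumulantExpansion

/-! ### A Berry–Esseen bound -/

lemma setIntegral_sq_mul_exp_le {T : ℝ} (hT : 0 < T) :
    IntegrableOn (fun t => T * (32 * (1 + (T * t) ^ 2)⁻¹)) (Ioc 0 1) ∧
    ∫ t in Ioc (0 : ℝ) 1, T * (32 * (1 + (T * t) ^ 2)⁻¹) ≤ 32 * Real.pi := by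
  have hi : Integrable fun t : ℝ => T * (32 * (1 + (T * t) ^ 2)⁻¹) :=
    ((integrable_inv_one_add_sq.comp_mul_left' hT.ne').const_mul 32).const_mul T
  refine ⟨hi.integrableOn, ?_⟩
  refine (setIntegral_le_integral hi (.of_forall fun t => by positivity)).trans ?_
  rw [integral_const_mul, integral_const_mul,
    Measure.integral_comp_mul_left (fun t : ℝ => (1 + t ^ 2)⁻¹), integral_univ_inv_one_add_sq,
    abs_of_pos (by positivity), smul_eq_mul]
  apply le_of_eq
  field_simp

lemma sq_mul_exp_le (s : ℝ) : s ^ 2 * Real.exp (-(s ^ 2 / 4)) ≤ 32 * (1 + s ^ 2)⁻¹ := by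
  have h := Real.quadratic_le_exp_of_nonneg (x := s ^ 2 / 4) (by positivity)
  rw [Real.exp_neg, ← div_eq_mul_inv, ← div_eq_mul_inv, div_le_div_iff₀ (by positivity) (by positivity)]
  nlinarith [sq_nonneg s]

lemma gaussianReal_Iio_sub_le {T : ℝ} (hT : 0 < T) (v : NNReal) (hv : (v : ℝ) = T ^ 2) {r s : ℝ}
    (hrs : r ≤ s) :
    (gaussianReal 0 v).real (Iio s) - (gaussianReal 0 v).real (Iio r) ≤ 1 / T * (s - r) := by
  have hv0 : v ≠ 0 := by
    rintro rfl
    exact (pow_pos hT 2).ne' hv.symm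
  rw [← measureReal_sdiff (Iio_subset_Iio hrs) measurableSet_Iio, measureReal_def]
  have hsub : Iio s \ Iio r ⊆ Ico r s := by
    intro x
    simp only [Set.mem_sdiff, mem_Iio, mem_Ico, not_lt]
    tauto
  have h1 : gaussianReal 0 v (Iio s \ Iio r) ≤ ENNReal.ofReal (1 / T * (s - r)) := by
    refine (measure_mono hsub).trans ?_
    rw [gaussianReal_apply 0 hv0]
    have h2 : ∀ x, gaussianPDF 0 v x ≤ ENNReal.ofReal (1 / T) := by
      intro x
      apply ENNReal.ofReal_le_ofReal
      rw [gaussianPDFReal]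
      calc _ ≤ (√(2 * Real.pi * v))⁻¹ * 1 := by
            gcongr
            rw [Real.exp_le_one_iff]
            apply div_nonpos_of_nonpos_of_nonneg
            · simp [sq_nonneg]
            · positivity
        _ ≤ 1 / T := by
            rw [mul_one, one_div]
            gcongr
            apply Real.le_sqrt_of_sq_le
            rw [hv]
            nlinarith [Real.pi_gt_three, sq_nonneg T]
    calc _ ≤ ∫⁻ x in Ico r s, ENNReal.ofReal (1 / T) := lintegral_mono h2
      _ = _ := by
        rw [setLIntegral_const, Real.volume_Ico, ← ENNReal.ofReal_mul (by positivity)]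
  refine ENNReal.toReal_le_of_le_ofReal ?_ h1
  have : 0 ≤ s - r := by linarith
  positivity

/-- Smoothing only uses frequencies in `[0, 1]`; stretching both laws moves any prescribed cut-off
frequency to 1. -/
lemma kolmogorovDist_le_map_const_mul (μ ν : Measure ℝ) [IsProbabilityMeasure μ]
    [IsProbabilityMeasure ν] {T : ℝ} (hT : 0 < T) :
    kolmogorovDist μ ν ≤ kolmogorovDist (μ.map (T * ·)) (ν.map (T * ·)) := by
  have hm : Measurable fun x : ℝ => T * x := by fun_prop
  have : IsProbabilityMeasure (μ.map (T * ·)) := Measure.isProbabilityMeasure_map hm.aemeasurable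
  have : IsProbabilityMeasure (ν.map (T * ·)) := Measure.isProbabilityMeasure_map hm.aemeasurable
  refine ciSup_le fun r => ?_
  refine le_trans (le_of_eq ?_) (abs_measureReal_Iio_sub_le_kolmogorovDist _ _ (T * r))
  have hpre : (fun x => T * x) ⁻¹' Iio (T * r) = Iio r := by
    ext x
    simp only [mem_preimage, mem_Iio]
    exact mul_lt_mul_iff_right₀ hT
  rw [map_measureReal_apply hm measurableSet_Iio, map_measureReal_apply hm measurableSet_Iio, hpre]

/-- Berry–Esseen bound for a random variable whose characteristic function has a cumulant
expansion near the origin and is small away from it. -/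
theorem exists_kolmogorovDist_le_of_cumulantExpansion : ∃ C : ℝ, 0 < C ∧
    ∀ (Ω : Type u) [MeasurableSpace Ω] (P : Measure Ω) [IsProbabilityMeasure P] (W : Ω → ℝ)
      (M S K u₀ A : ℝ), AEMeasurable W P → 0 < S → 0 ≤ K → 0 < u₀ → 0 ≤ A → K * u₀ ≤ S / 4 →
      HasCumulantExpansion (charFun (P.map W)) M S K u₀ →
      (∀ u, u₀ ≤ u → ‖charFun (P.map W) u‖ ≤ A) →
      MemLp W 2 P ∧ 0 < variance W P ∧ ∀ T, 0 < T →
        kolmogorovDist (standardizedLaw P W) (gaussianReal 0 1) ≤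
          C * (K / √S ^ 3 + (A + Real.exp (-(S * u₀ ^ 2 / 2))) * T / u₀ + 1 / (√S * T)) := by
  obtain ⟨C, hC, hsmooth⟩ := exists_kolmogorovDist_le_of_charFun
  refine ⟨C * (32 * Real.pi), by positivity, ?_⟩
  intro Ω _ P _ W M S K u₀ A hW hS hK hu₀ hA hKu hexp hdecay
  have : IsProbabilityMeasure (P.map W) := Measure.isProbabilityMeasure_map hW
  set μ : Measure ℝ := (P.map W).map (fun x => x + -M) with hμ
  have hμW : μ = P.map (fun ω => W ω + -M) := by
    rw [hμ, AEMeasurable.map_map_of_aemeasurable (by fun_prop) hW]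
    rfl
  have hμprob : IsProbabilityMeasure μ := Measure.isProbabilityMeasure_map (by fun_prop)
  have hcen : HasCumulantExpansion (charFun μ) 0 S K u₀ := hexp.center
  have hdecay' : ∀ u, u₀ ≤ u → ‖charFun μ u‖ ≤ A := by
    intro u hu
    rw [hμ, charFun_map_add_const, norm_mul]
    simp only [RCLike.inner_apply, conj_trivial]
    rw [Complex.norm_exp_ofReal_mul_I, mul_one]
    exact hdecay u hu
  obtain ⟨hmem, hmean, hvar⟩ := hcen.moments hu₀
  have hWM : AEMeasurable (fun ω => W ω + -M) P := hW.add_const _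
  have hmemWM : MemLp (fun ω => W ω + -M) 2 P := by
    rw [hμW] at hmem
    exact (memLp_map_measure_iff aestronglyMeasurable_id hWM).1 hmem
  have hmemW : MemLp W 2 P := by
    have := hmemWM.add (memLp_const M)
    refine this.ae_eq (.of_forall fun ω => ?_)
    simp
  have hEW : ∫ ω, W ω ∂P = M := by
    rw [hμW, integral_map hWM (by fun_prop)] at hmean
    rw [integral_add (hmemW.integrable one_le_two) (integrable_const _)] at hmean
    simp at hmean
    linarith
  have hVar : variance W P = S := by
    rw [variance_eq_integral hW, hEW]
    rw [hμW, integral_map hWM (by fun_prop)] at hvar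
    simpa [sub_eq_add_neg] using hvar
  refine ⟨hmemW, by rw [hVar]; exact hS, fun T hT => ?_⟩
  set σ := √S with hσ
  have hσ0 : 0 < σ := Real.sqrt_pos.2 hS
  have hσS : σ ^ 2 = S := Real.sq_sqrt hS.le
  have hstd : standardizedLaw P W = μ.map (σ⁻¹ * ·) := by
    rw [hμW, AEMeasurable.map_map_of_aemeasurable (by fun_prop) hWM, standardizedLaw, hEW, hVar]
    congr with ω
    simp [hσ, Function.comp, div_eq_inv_mul, sub_eq_add_neg]
  -- After standardization and stretching by `R`, the variable is `T * (W - M)`: the unit frequency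
  -- corresponds to frequency `T` of `W`, and the comparison Gaussian has standard deviation `R`.
  set R := σ * T with hR
  have hR0 : 0 < R := by positivity
  have hprob1 : IsProbabilityMeasure (μ.map (σ⁻¹ * ·)) :=
    Measure.isProbabilityMeasure_map (by fun_prop)
  rw [hstd]
  refine (kolmogorovDist_le_map_const_mul _ _ hR0).trans ?_
  have hgm : (gaussianReal 0 1).map (R * ·) = gaussianReal 0 (NNReal.mk (R ^ 2) (sq_nonneg R)) := by
    rw [gaussianReal_map_const_mul]
    simp
  rw [hgm, Measure.map_map (by fun_prop) (by fun_prop)]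
  have hcomp : ((fun x => R * x) ∘ fun x => σ⁻¹ * x) = fun x : ℝ => T * x := by
    ext x
    simp [hR]
    field_simp
  rw [hcomp]
  have hprob2 : IsProbabilityMeasure (μ.map (T * ·)) :=
    Measure.isProbabilityMeasure_map (by fun_prop)
  set A' := A + Real.exp (-(S * u₀ ^ 2 / 2)) with hA'
  have hA'0 : 0 ≤ A' := by positivity
  -- The first summand handles `T t ≤ u₀`, where the expansion holds; its integral gives the factor
  -- `32 π`. The second handles `T t > u₀`, where both characteristic functions together are at most
  -- `A'` and `1 ≤ T t / u₀`.
  set B : ℝ → ℝ := fun t => K / σ ^ 3 * (R * (32 * (1 + (R * t) ^ 2)⁻¹)) + A' * T / u₀ with hB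
  obtain ⟨hBi, hBle⟩ := setIntegral_sq_mul_exp_le hR0
  have hcf : ∀ t : ℝ, charFun (μ.map (T * ·)) t = charFun μ (T * t) := fun t => charFun_map_mul T t
  have hcg : ∀ t : ℝ, charFun (gaussianReal 0 (NNReal.mk (R ^ 2) (sq_nonneg R))) t =
      Complex.exp (-(S * (T * t : ℝ) ^ 2 / 2)) := by
    intro t
    rw [charFun_gaussianReal]
    congr 1
    have : ((NNReal.mk (R ^ 2) (sq_nonneg R) : ℝ) : ℂ) = S * T ^ 2 := by
      have : (NNReal.mk (R ^ 2) (sq_nonneg R) : ℝ) = S * T ^ 2 := by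
        rw [NNReal.coe_mk, hR, mul_pow, hσS]
      rw [this]; push_cast; ring
    rw [this]
    push_cast
    ring
  have hmain := hsmooth (μ.map (T * ·)) (gaussianReal 0 (NNReal.mk (R ^ 2) (sq_nonneg R))) B (1 / R)
    (by positivity) ((hBi.const_mul _).add (integrable_const _)) ?_ ?_
  · refine hmain.trans ?_
    have hBint : ∫ t in Ioc (0 : ℝ) 1, B t ≤ K / σ ^ 3 * (32 * Real.pi) + A' * T / u₀ := by
      simp only [hB]
      rw [integral_add (hBi.const_mul _) (integrable_const _), integral_const_mul]
      simp only [integral_const]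
      rw [measureReal_restrict_apply_univ, Real.volume_real_Ioc]
      simp only [sub_zero, zero_le_one, sup_of_le_left, one_smul]
      gcongr
    rw [mul_assoc]
    gcongr
    have hpi := Real.pi_gt_three
    have h1 : 0 ≤ A' * T / u₀ := by positivity
    have h2 : 0 ≤ 1 / R := by positivity
    calc _ ≤ K / σ ^ 3 * (32 * Real.pi) + A' * T / u₀ + 1 / R := by gcongr
      _ ≤ _ := by nlinarith
  · intro t ht
    rw [hcf, hcg]
    have ht0 := ht.1
    have hTt : 0 < T * t := by positivity
    by_cases hle : T * t ≤ u₀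
    · have hKle : K * |T * t| ≤ S / 4 := by
        rw [abs_of_pos hTt]
        exact (mul_le_mul_of_nonneg_left hle hK).trans hKu
      refine (hcen.norm_sub_le (by rwa [abs_of_pos hTt]) hKle).trans ?_
      rw [abs_of_pos hTt]
      have h1 := sq_mul_exp_le (R * t)
      have h2 : S * (T * t) ^ 2 / 4 = (R * t) ^ 2 / 4 := by rw [← hσS, hR]; ring
      rw [h2]
      calc K * (T * t) ^ 3 * Real.exp (-((R * t) ^ 2 / 4))
          = t * (K / σ ^ 3 * (R * ((R * t) ^ 2 * Real.exp (-((R * t) ^ 2 / 4))))) := by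
            rw [hR]; field_simp
        _ ≤ t * (K / σ ^ 3 * (R * (32 * (1 + (R * t) ^ 2)⁻¹))) := by gcongr
        _ ≤ t * B t := by
            simp only [hB]
            gcongr
            have : 0 ≤ A' * T / u₀ := by positivity
            linarith
    · push Not at hle
      have h1 : ‖charFun μ (T * t) - Complex.exp (-(S * (T * t : ℝ) ^ 2 / 2))‖ ≤ A' := by
        rw [hA']
        refine (_root_.norm_sub_le _ _).trans ?_
        gcongr
        · exact hdecay' _ hle.le
        · rw [Complex.norm_exp]
          have : (-(S * (T * t : ℝ) ^ 2 / 2) : ℂ).re = -(S * (T * t) ^ 2 / 2) := by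
            rw [← Complex.ofReal_re (-(S * (T * t) ^ 2 / 2))]
            push_cast
            rfl
          rw [this]
          gcongr
      refine h1.trans ?_
      have h2 : 1 ≤ T * t / u₀ := (one_le_div hu₀).2 hle.le
      calc A' ≤ A' * (T * t / u₀) := le_mul_of_one_le_right hA'0 h2
        _ = t * (A' * T / u₀) := by ring
        _ ≤ t * B t := by
            simp only [hB]
            gcongr
            have : 0 ≤ K / σ ^ 3 * (R * (32 * (1 + (R * t) ^ 2)⁻¹)) := by positivity
            linarith
  · exact fun r s hrs => gaussianReal_Iio_sub_le hR0 _ rfl hrs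

/-! ### Quotients of Gamma functions -/

/-- The characteristic function of the logarithm of a Beta-distributed random variable. -/
noncomputable def gammaQuotient (a b v : ℝ) : ℂ :=
  Complex.Gamma (a + v * Complex.I) * Complex.Gamma b /
    (Complex.Gamma a * Complex.Gamma (b + v * Complex.I))

section GammaQuotient

variable {a b : ℝ}

lemma ofReal_add_mul_I_ne_zero (ha : 0 < a) (v : ℝ) : (a + v * Complex.I : ℂ) ≠ 0 := by
  intro h
  have := congrArg Complex.re h
  simp at this
  exact ha.ne' this

lemma one_add_div_mul_I_ne_zero (v : ℝ) : (1 + (v : ℂ) * Complex.I) ≠ 0 := by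
  simpa using ofReal_add_mul_I_ne_zero one_pos v

open Filter Topology in
-- Euler's limit formula for each of the four Gamma values: the factorials cancel, and so do the
-- powers of `N`, since both sides of the quotient have the same sum of arguments.
lemma tendsto_prod_gammaQuotient (ha : 0 < a) (hb : 0 < b) (v : ℝ) :
    Tendsto (fun N => ∏ j ∈ Finset.range (N + 1),
      ((1 + ((v / (b + j) : ℝ) : ℂ) * Complex.I) / (1 + ((v / (a + j) : ℝ) : ℂ) * Complex.I)))
      atTop (𝓝 (gammaQuotient a b v)) := by
  have hG : ∀ s : ℂ, Tendsto (fun N => Complex.GammaSeq s N) atTop (𝓝 (Complex.Gamma s)) :=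
    Complex.GammaSeq_tendsto_Gamma
  have hne : Complex.Gamma a * Complex.Gamma (b + v * Complex.I) ≠ 0 := by
    apply mul_ne_zero <;> apply Complex.Gamma_ne_zero_of_re_pos <;> simpa
  have hlim := ((hG (a + v * Complex.I)).mul (hG b)).div ((hG a).mul (hG (b + v * Complex.I))) hne
  refine hlim.congr' ?_
  filter_upwards [eventually_ge_atTop 1] with N hN
  have hN0 : (N : ℂ) ≠ 0 := by exact_mod_cast (by omega : N ≠ 0)
  have hfac : (N.factorial : ℂ) ≠ 0 := by exact_mod_cast N.factorial_ne_zero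
  have hp : ∀ s : ℂ, (∀ j : ℕ, s + j ≠ 0) → ∏ j ∈ Finset.range (N + 1), (s + j) ≠ 0 := fun s hs =>
    Finset.prod_ne_zero_iff.2 fun j _ => hs j
  have hs1 : ∀ (c : ℝ), 0 < c → ∀ w : ℝ, ∀ j : ℕ, (c + w * Complex.I : ℂ) + j ≠ 0 := by
    intro c hc w j
    have := ofReal_add_mul_I_ne_zero (a := c + j) (by positivity) w
    intro h
    apply this
    rw [← h]
    push_cast
    ring
  have hs0 : ∀ (c : ℝ), 0 < c → ∀ j : ℕ, (c : ℂ) + j ≠ 0 := by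
    intro c hc j
    simpa using hs1 c hc 0 j
  have hfrac : ∀ j : ℕ, (1 + ((v / (b + j) : ℝ) : ℂ) * Complex.I) /
      (1 + ((v / (a + j) : ℝ) : ℂ) * Complex.I) =
      ((a : ℂ) + j) * ((b + v * Complex.I : ℂ) + j) /
        (((a + v * Complex.I : ℂ) + j) * ((b : ℂ) + j)) := by
    intro j
    have h1 := hs0 a ha j
    have h2 := hs0 b hb j
    have h3 := hs1 a ha v j
    have h4 : (1 + ((v / (a + j) : ℝ) : ℂ) * Complex.I) = ((a + v * Complex.I : ℂ) + j) / (a + j) := by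
      push_cast
      field_simp
      ring
    have h5 : (1 + ((v / (b + j) : ℝ) : ℂ) * Complex.I) = ((b + v * Complex.I : ℂ) + j) / (b + j) := by
      push_cast
      field_simp
      ring
    rw [h4, h5]
    field_simp
  simp_rw [hfrac]
  rw [Finset.prod_div_distrib, Finset.prod_mul_distrib, Finset.prod_mul_distrib]
  simp only [Complex.GammaSeq, Pi.div_apply]
  have h1 := hp _ (hs0 a ha)
  have h2 := hp _ (hs0 b hb)
  have h3 := hp _ (hs1 a ha v)
  have h4 := hp _ (hs1 b hb v)
  have hpow : (N : ℂ) ^ (a + v * Complex.I : ℂ) * (N : ℂ) ^ (b : ℂ) =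
      (N : ℂ) ^ (a : ℂ) * (N : ℂ) ^ (b + v * Complex.I : ℂ) := by
    rw [← Complex.cpow_add _ _ hN0, ← Complex.cpow_add _ _ hN0]
    ring_nf
  have hc1 : (N : ℂ) ^ (a : ℂ) ≠ 0 := by simp [Complex.cpow_eq_zero_iff, hN0]
  have hc2 : (N : ℂ) ^ (b + v * Complex.I : ℂ) ≠ 0 := by simp [Complex.cpow_eq_zero_iff, hN0]
  have hgoal : ∀ x1 x2 x3 x4 f p1 p2 p3 p4 : ℂ, x1 * x2 = x3 * x4 → x3 ≠ 0 → x4 ≠ 0 → f ≠ 0 →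
      p1 ≠ 0 → p2 ≠ 0 → p3 ≠ 0 → p4 ≠ 0 →
      x1 * f / p1 * (x2 * f / p2) / (x3 * f / p3 * (x4 * f / p4)) = p3 * p4 / (p1 * p2) := by
    intro x1 x2 x3 x4 f p1 p2 p3 p4 h h3 h4 hf hp1 hp2 hp3 hp4
    field_simp
    linear_combination h
  exact hgoal _ _ _ _ _ _ _ _ _ hpow hc1 hc2 hfac h3 h2 h1 h4

/-- Each factor of Euler's product has squared modulus `(1 + v²/q²) / (1 + v²/p²)` with `p ≤ q`,
which decreases in `v`. Thus a bound at one frequency holds at all larger ones. -/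
lemma norm_gammaQuotient_antitone (ha : 0 < a) (hab : a ≤ b) {v w : ℝ} (hv : 0 ≤ v) (hvw : v ≤ w) :
    ‖gammaQuotient a b w‖ ≤ ‖gammaQuotient a b v‖ := by
  have hb : 0 < b := ha.trans_le hab
  refine le_of_tendsto_of_tendsto' (tendsto_prod_gammaQuotient ha hb w).norm
    (tendsto_prod_gammaQuotient ha hb v).norm fun N => ?_
  rw [norm_prod, norm_prod]
  refine Finset.prod_le_prod (fun _ _ => norm_nonneg _) fun j _ => ?_
  have hn : ∀ x : ℝ, ‖(1 + (x : ℂ) * Complex.I)‖ = √(1 + x ^ 2) := fun x => by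
    have := Complex.norm_add_mul_I 1 x
    simpa using this
  have haj : 0 < a + j := by positivity
  have hbj : 0 < b + j := by positivity
  rw [norm_div, norm_div, hn, hn, hn, hn, ← Real.sqrt_div (by positivity), ← Real.sqrt_div (by positivity)]
  apply Real.sqrt_le_sqrt
  rw [div_le_div_iff₀ (by positivity) (by positivity)]
  set p := (a + j : ℝ) with hp
  set q := (b + j : ℝ) with hq
  have hpq : p ≤ q := by simp only [hp, hq]; linarith
  have h1 : (1 / q) ^ 2 ≤ (1 / p) ^ 2 := by gcongr
  have h2 : v ^ 2 ≤ w ^ 2 := by gcongr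
  have e : ∀ x y : ℝ, x / y = x * (1 / y) := fun x y => by ring
  rw [e w q, e v p, e v q, e w p]
  simp only [mul_pow]
  nlinarith [mul_nonneg (sub_nonneg.2 h1) (sub_nonneg.2 h2)]

lemma summable_and_tsum_inv_sq (ha : 1 / 2 ≤ a) :
    Summable fun j : ℕ => 1 / (a + j) ^ 2 := by
  refine summable_of_sum_range_le (c := 3 * (1 / a)) (fun j => by positivity) fun N => ?_
  calc ∑ j ∈ Finset.range N, 1 / (a + j) ^ 2
      -- The 3 comes from `x + 1 ≤ 3 x` for `x ≥ 1/2`.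
      ≤ ∑ j ∈ Finset.range N, 3 * (1 / (a + j) - 1 / (a + (j + 1 : ℕ))) := by
        refine Finset.sum_le_sum fun j _ => ?_
        set x := a + j with hx
        have hx2 : 1 / 2 ≤ x := by
          have : (0 : ℝ) ≤ j := by positivity
          linarith
        have hx1 : a + (j + 1 : ℕ) = x + 1 := by push_cast; ring
        rw [hx1, div_sub_div _ _ (by positivity) (by positivity), mul_div_assoc',
          div_le_div_iff₀ (by positivity) (by positivity)]
        nlinarith
    _ = 3 * (1 / a - 1 / (a + N)) := by
        rw [← Finset.mul_sum, Finset.sum_range_sub' (fun j : ℕ => 1 / (a + j))]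
        simp
    _ ≤ _ := by
        have : 0 ≤ 1 / (a + N) := by positivity
        linarith

lemma summable_and_tsum_inv_cube (ha : 1 / 2 ≤ a) :
    Summable (fun j : ℕ => 1 / (a + j) ^ 3) ∧ ∑' j : ℕ, 1 / (a + j) ^ 3 ≤ 15 / 2 / a ^ 2 := by
  have hle : ∀ N, ∑ j ∈ Finset.range N, 1 / (a + j) ^ 3 ≤ 15 / 2 / a ^ 2 := by
    intro N
    have ha0 : 0 < a := by linarith
    calc ∑ j ∈ Finset.range N, 1 / (a + j) ^ 3
        -- Telescoping majorant: `(x + 1) (x + 2) ≤ 15 x²` for `x ≥ 1/2`, with equality at `1/2`.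
        ≤ ∑ j ∈ Finset.range N, 15 / 2 * (1 / ((a + j) * (a + j + 1)) -
            1 / ((a + (j + 1 : ℕ)) * (a + (j + 1 : ℕ) + 1))) := by
          refine Finset.sum_le_sum fun j _ => ?_
          set x := a + j with hx
          have hx2 : 1 / 2 ≤ x := by
            have : (0 : ℝ) ≤ j := by positivity
            linarith
          have hx0 : 0 < x := by linarith
          have hx1 : a + (j + 1 : ℕ) = x + 1 := by push_cast; ring
          rw [hx1]
          have : 15 / 2 * (1 / (x * (x + 1)) - 1 / ((x + 1) * (x + 1 + 1))) =
              15 / (x * (x + 1) * (x + 2)) := by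
            field_simp
            ring
          rw [this, div_le_div_iff₀ (by positivity) (by positivity)]
          nlinarith [mul_nonneg hx0.le (sub_nonneg.2 hx2), mul_nonneg (mul_nonneg hx0.le hx0.le) (sub_nonneg.2 hx2)]
      _ = 15 / 2 * (1 / (a * (a + 1)) - 1 / ((a + N) * (a + N + 1))) := by
          rw [← Finset.mul_sum, Finset.sum_range_sub' (fun j : ℕ => 1 / ((a + j) * (a + j + 1)))]
          simp
      _ ≤ 15 / 2 * (1 / a ^ 2) := by
          have h1 : 0 ≤ 1 / ((a + N) * (a + N + 1)) := by positivity
          have h2 : 1 / (a * (a + 1)) ≤ 1 / a ^ 2 := by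
            apply one_div_le_one_div_of_le (by positivity)
            nlinarith
          linarith
      _ = _ := by ring
  exact ⟨summable_of_sum_range_le (fun j => by positivity) hle,
    Real.tsum_le_of_sum_range_le (fun j => by positivity) hle⟩

lemma exists_one_add_mul_I_eq_exp {z : ℝ} (hz : |z| ≤ 1 / 2) :
    ∃ r : ℂ, ‖r‖ ≤ 2 / 3 * |z| ^ 3 ∧
      1 + (z : ℂ) * Complex.I = Complex.exp (z * Complex.I + z ^ 2 / 2 + r) := by
  refine ⟨Complex.log (1 + z * Complex.I) - (z * Complex.I + z ^ 2 / 2), ?_, ?_⟩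
  · have hn : ‖(z * Complex.I : ℂ)‖ = |z| := by simp
    have h := Complex.norm_log_sub_logTaylor_le 2 (z := z * Complex.I) (by rw [hn]; linarith)
    have h1 : Complex.logTaylor (2 + 1) (z * Complex.I) = z * Complex.I + z ^ 2 / 2 := by
      simp [Complex.logTaylor, Finset.sum_range_succ, mul_pow]
      ring
    rw [h1, hn] at h
    refine h.trans ?_
    have h2 : (1 - |z|)⁻¹ ≤ 2 := by
      rw [inv_le_comm₀ (by linarith) (by norm_num)]
      linarith
    calc |z| ^ (2 + 1) * (1 - |z|)⁻¹ / ((2 : ℕ) + 1) ≤ |z| ^ (2 + 1) * 2 / ((2 : ℕ) + 1) := by gcongr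
      _ = _ := by push_cast; ring
  · rw [add_sub_cancel, Complex.exp_log (one_add_div_mul_I_ne_zero z)]

open Filter Topology in
/-- The cumulant expansion of the logarithm of a Beta variable, with a lower bound on its
variance. -/
theorem exists_hasCumulantExpansion_gammaQuotient (ha : 1 / 2 ≤ a) (hab : a ≤ b) :
    ∃ M S : ℝ, 1 / a - 1 / b ≤ S ∧
      HasCumulantExpansion (gammaQuotient a b) M S (10 / a ^ 2) (a / 2) := by
  have ha0 : 0 < a := by linarith
  have hb0 : 0 < b := by linarith
  have hsa := summable_and_tsum_inv_sq ha
  have hsb := summable_and_tsum_inv_sq (ha.trans hab)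
  have hS := hsa.sub hsb
  have hM : Summable fun j : ℕ => 1 / (b + j) - 1 / (a + j) := by
    refine Summable.of_norm_bounded (hsa.mul_left (b - a)) fun j => ?_
    have haj : 0 < a + j := by positivity
    have hbj : 0 < b + j := by positivity
    rw [div_sub_div _ _ hbj.ne' haj.ne', norm_div, Real.norm_eq_abs, mul_one_div,
      Real.norm_of_nonneg (by positivity)]
    have h1 : |1 * (a + j) - (b + j) * 1| = b - a := by
      rw [abs_sub_comm, abs_of_nonneg] <;> linarith
    rw [h1]
    have : 0 ≤ b - a := by linarith
    gcongr
    rw [sq]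
    gcongr
  -- Mean and variance as series, read off from the logarithms of the factors of Euler's product.
  refine ⟨∑' j : ℕ, (1 / (b + j) - 1 / (a + j)), ∑' j : ℕ, (1 / (a + j) ^ 2 - 1 / (b + j) ^ 2),
    ?_, ?_⟩
  · have hlow : ∀ N : ℕ, (1 / a - 1 / (a + N)) - (1 / b - 1 / (b + N)) ≤
        ∑ j ∈ Finset.range N, (1 / (a + j) ^ 2 - 1 / (b + j) ^ 2) := by
      intro N
      have htel : ∀ c : ℝ, 1 / c - 1 / (c + N) =
          ∑ j ∈ Finset.range N, (1 / (c + j) - 1 / (c + (j + 1 : ℕ))) := by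
        intro c
        rw [Finset.sum_range_sub' (fun j : ℕ => 1 / (c + j))]
        simp
      rw [htel, htel, ← Finset.sum_sub_distrib]
      refine Finset.sum_le_sum fun j _ => ?_
      set x := a + j with hx
      set y := b + j with hy
      have hx0 : 0 < x := by positivity
      have hxy : x ≤ y := by simp only [hx, hy]; linarith
      have hy0 : 0 < y := by linarith
      have hx1 : a + (j + 1 : ℕ) = x + 1 := by push_cast; ring
      have hy1 : b + (j + 1 : ℕ) = y + 1 := by push_cast; ring
      rw [hx1, hy1]
      -- The excess of `1 / w²` over its telescoping minorant decreases in `w`, so the difference of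
      -- the minorants at `x ≤ y` bounds the difference of the inverse squares from below.
      have e : ∀ w : ℝ, 0 < w → 1 / w ^ 2 - (1 / w - 1 / (w + 1)) = 1 / (w ^ 2 * (w + 1)) := by
        intro w hw
        field_simp
        ring
      have h1 : 1 / (y ^ 2 * (y + 1)) ≤ 1 / (x ^ 2 * (x + 1)) := by gcongr
      have h2 := e x hx0
      have h3 := e y hy0
      linarith
    have hlim : Tendsto (fun N : ℕ => (1 / a - 1 / (a + N)) - (1 / b - 1 / (b + N))) atTop
        (𝓝 ((1 / a - 0) - (1 / b - 0))) := by
      have h0 : ∀ c : ℝ, Tendsto (fun N : ℕ => 1 / (c + N)) atTop (𝓝 0) := by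
        intro c
        have := (tendsto_atTop_add_const_left atTop c (tendsto_natCast_atTop_atTop (R := ℝ)))
        simpa only [one_div] using! this.inv_tendsto_atTop
      exact ((h0 a).const_sub _).sub ((h0 b).const_sub _)
    rw [sub_zero, sub_zero] at hlim
    exact le_of_tendsto_of_tendsto' hlim hS.hasSum.tendsto_sum_nat hlow
  · intro v hv
    obtain ⟨hca, hcale⟩ := summable_and_tsum_inv_cube ha
    -- The range `|v| ≤ a / 2` keeps all logarithms in the disc of radius `1/2`, where the Taylor
    -- remainder is cubic.
    have hz : ∀ c : ℝ, a ≤ c → ∀ j : ℕ, |v / (c + j)| ≤ 1 / 2 := by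
      intro c hc j
      have hj : (0 : ℝ) ≤ j := by positivity
      have hcj : 0 < c + j := by linarith
      rw [abs_div, abs_of_pos hcj, div_le_iff₀ hcj]
      linarith
    choose ra hra hra' using fun j : ℕ => exists_one_add_mul_I_eq_exp (hz a le_rfl j)
    choose rb hrb hrb' using fun j : ℕ => exists_one_add_mul_I_eq_exp (hz b hab j)
    have hbound : ∀ j, ‖rb j - ra j‖ ≤ 4 / 3 * |v| ^ 3 * (1 / (a + j) ^ 3) := by
      intro j
      have haj : 0 < a + j := by positivity
      have hbj : 0 < b + j := by positivity
      have e : ∀ w : ℝ, 0 < w → |v / w| ^ 3 = |v| ^ 3 * (1 / w ^ 3) := by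
        intro w hw
        rw [abs_div, abs_of_pos hw]
        ring
      have h1 := hra j
      have h2 := hrb j
      rw [e _ haj] at h1
      rw [e _ hbj] at h2
      have h3 : 1 / (b + j) ^ 3 ≤ 1 / (a + j) ^ 3 := by gcongr
      have h4 : |v| ^ 3 * (1 / (b + j) ^ 3) ≤ |v| ^ 3 * (1 / (a + j) ^ 3) := by gcongr
      refine (_root_.norm_sub_le _ _).trans ?_
      linarith
    have hsr : Summable fun j => rb j - ra j :=
      Summable.of_norm_bounded (hca.mul_left _) hbound
    refine ⟨∑' j, (rb j - ra j), ?_, ?_⟩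
    · refine (tsum_of_norm_bounded (hca.mul_left _).hasSum hbound).trans ?_
      rw [tsum_mul_left]
      calc 4 / 3 * |v| ^ 3 * ∑' j : ℕ, 1 / (a + j) ^ 3 ≤ 4 / 3 * |v| ^ 3 * (15 / 2 / a ^ 2) := by gcongr
        _ = _ := by ring
    · have hlim := tendsto_prod_gammaQuotient ha0 hb0 v
      have hprod : ∀ N : ℕ, ∏ j ∈ Finset.range (N + 1),
          ((1 + ((v / (b + j) : ℝ) : ℂ) * Complex.I) / (1 + ((v / (a + j) : ℝ) : ℂ) * Complex.I)) =
          Complex.exp (v * ((∑ j ∈ Finset.range (N + 1), (1 / (b + j) - 1 / (a + j)) : ℝ) : ℂ) * Complex.I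
            - ((∑ j ∈ Finset.range (N + 1), (1 / (a + j) ^ 2 - 1 / (b + j) ^ 2) : ℝ) : ℂ) * v ^ 2 / 2
            + ∑ j ∈ Finset.range (N + 1), (rb j - ra j)) := by
        intro N
        simp_rw [hra', hrb', ← Complex.exp_sub, ← Complex.exp_sum]
        congr 1
        rw [Complex.ofReal_sum, Complex.ofReal_sum, Finset.mul_sum, Finset.sum_mul, Finset.sum_mul,
          Finset.sum_div, ← Finset.sum_sub_distrib, ← Finset.sum_add_distrib]
        refine Finset.sum_congr rfl fun j _ => ?_
        push_cast
        simp only [div_eq_mul_inv, mul_pow, inv_pow]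
        ring
      simp_rw [hprod] at hlim
      have hlim2 : ∀ {f : ℕ → ℝ}, Summable f → Tendsto (fun N : ℕ =>
          ((∑ j ∈ Finset.range (N + 1), f j : ℝ) : ℂ)) atTop (𝓝 ((∑' j, f j : ℝ) : ℂ)) := by
        intro f hf
        exact ((Complex.continuous_ofReal.tendsto _).comp hf.hasSum.tendsto_sum_nat).comp
          (tendsto_add_atTop_nat 1)
      have hlim3 := hsr.hasSum.tendsto_sum_nat.comp (tendsto_add_atTop_nat 1)
      refine tendsto_nhds_unique hlim ?_
      refine (Complex.continuous_exp.tendsto _).comp ?_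
      refine Tendsto.add (Tendsto.sub ?_ ?_) hlim3
      · exact ((hlim2 hM).const_mul _).mul_const _
      · exact ((hlim2 hS).mul_const _).div_const _

end GammaQuotient

/-! ### Densities close to the Gaussian density -/

lemma norm_exp_mul_I_sub_taylor_le (y : ℝ) :
    ‖Complex.exp (y * Complex.I) - (1 + y * Complex.I - y ^ 2 / 2)‖ ≤ 4 * |y| ^ 3 := by
  have hn : ‖(y * Complex.I : ℂ)‖ = |y| := by simp
  rcases le_total |y| 1 with h | h
  · have := Complex.norm_exp_sub_sum_le_norm_mul_exp (y * Complex.I) 3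
    simp only [Finset.sum_range_succ, Finset.sum_range_zero, hn] at this
    have h2 : (0 + (y * Complex.I : ℂ) ^ 0 / (Nat.factorial 0 : ℕ) + (y * Complex.I) ^ 1 / (Nat.factorial 1 : ℕ) +
      (y * Complex.I) ^ 2 / (Nat.factorial 2 : ℕ)) = 1 + y * Complex.I - y ^ 2 / 2 := by
      simp [mul_pow, Nat.factorial]
      ring
    rw [h2] at this
    have h3 : Real.exp |y| ≤ 4 := by
      calc Real.exp |y| ≤ Real.exp 1 := by gcongr
        _ ≤ 4 := by linarith [Real.exp_one_lt_d9]
    refine this.trans ?_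
    rw [mul_comm]
    gcongr
  · refine (norm_sub_le _ _).trans ?_
    rw [Complex.norm_exp_ofReal_mul_I]
    have h1 : ‖(1 + y * Complex.I - y ^ 2 / 2 : ℂ)‖ ≤ 1 + |y| + |y| ^ 2 / 2 := by
      refine (norm_sub_le _ _).trans (add_le_add ((norm_add_le _ _).trans ?_) ?_)
      · simp
      · simp
    have h2 : |y| ≤ |y| ^ 3 := le_self_pow₀ h (by norm_num)
    have h3 : |y| ^ 2 ≤ |y| ^ 3 := pow_le_pow_right₀ h (by norm_num)
    have h4 : 1 ≤ |y| ^ 3 := one_le_pow₀ h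
    linarith

lemma abs_pow_le_sq_one_add_sq {k : ℕ} (hk : k ≤ 3) (x : ℝ) : |x| ^ k ≤ (1 + x ^ 2) ^ 2 := by
  have h0 := abs_nonneg x
  have hs : x ^ 2 = |x| ^ 2 := (sq_abs x).symm
  rw [hs]
  set y := |x|
  have h1 : 1 ≤ (1 + y ^ 2) ^ 2 := one_le_pow₀ (by nlinarith)
  interval_cases k
  · simpa using h1
  · nlinarith [sq_nonneg (y - 1), sq_nonneg y]
  · nlinarith [sq_nonneg (y ^ 2)]
  · nlinarith [sq_nonneg (y ^ 2 - y), sq_nonneg y]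

section Perturbation

variable {w : ℝ → ℝ} {ε : ℝ}

/-- The weight `(1 + x²)⁻³` is chosen so that moments up to order three, all that a cubic remainder
needs, still leave the integrable `(1 + x²)⁻¹`. -/
lemma integrable_pow_mul_of_le (hw : AEStronglyMeasurable w)
    (hb : ∀ x, |w x| ≤ ε * ((1 + x ^ 2) ^ 3)⁻¹) {k : ℕ} (hk : k ≤ 3) :
    Integrable (fun x => |x| ^ k * |w x|) ∧ ∫ x, |x| ^ k * |w x| ≤ ε * Real.pi := by
  have hle : ∀ x, |x| ^ k * |w x| ≤ ε * (1 + x ^ 2)⁻¹ := by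
    intro x
    calc |x| ^ k * |w x| ≤ (1 + x ^ 2) ^ 2 * (ε * ((1 + x ^ 2) ^ 3)⁻¹) := by
          gcongr
          · exact abs_pow_le_sq_one_add_sq hk x
          · exact hb x
      _ = ε * (1 + x ^ 2)⁻¹ := by
          have : (1 + x ^ 2) ≠ 0 := by positivity
          field_simp
  have hi : Integrable (fun x => |x| ^ k * |w x|) := by
    refine (integrable_inv_one_add_sq.const_mul ε).mono' ?_ (.of_forall fun x => ?_)
    · exact (by fun_prop : AEStronglyMeasurable (fun x : ℝ => |x| ^ k)).mul hw.norm
    · rw [Real.norm_of_nonneg (by positivity)]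
      exact hle x
  refine ⟨hi, (integral_mono hi (integrable_inv_one_add_sq.const_mul ε) hle).trans ?_⟩
  rw [integral_const_mul, integral_univ_inv_one_add_sq]

lemma integrable_pow_mul_of_le' (hw : AEStronglyMeasurable w)
    (hb : ∀ x, |w x| ≤ ε * ((1 + x ^ 2) ^ 3)⁻¹) {k : ℕ} (hk : k ≤ 3) :
    Integrable (fun x => x ^ k * w x) := by
  refine ((integrable_pow_mul_of_le hw hb hk).1).mono' ?_ (.of_forall fun x => ?_)
  · exact (by fun_prop : AEStronglyMeasurable (fun x : ℝ => x ^ k)).mul hw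
  · simp

lemma abs_integral_pow_mul_le (hw : AEStronglyMeasurable w)
    (hb : ∀ x, |w x| ≤ ε * ((1 + x ^ 2) ^ 3)⁻¹) {k : ℕ} (hk : k ≤ 3) :
    |∫ x, x ^ k * w x| ≤ ε * Real.pi := by
  refine (abs_integral_le_integral_abs).trans ?_
  simp_rw [abs_mul, abs_pow]
  exact (integrable_pow_mul_of_le hw hb hk).2

/-- Taylor's formula for the exponential under the integral; total mass zero removes the constant
term. The error keeps the factor `ε`, so that it is of size `ε |v|³` and not just `|v|³`. -/
lemma norm_integral_exp_mul_sub_le (hw : AEStronglyMeasurable w)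
    (hb : ∀ x, |w x| ≤ ε * ((1 + x ^ 2) ^ 3)⁻¹) (h0 : ∫ x, w x = 0) (v : ℝ) :
    ‖(∫ x : ℝ, Complex.exp (v * x * Complex.I) * w x) -
      (v * (∫ x, x * w x : ℝ) * Complex.I - v ^ 2 * (∫ x, x ^ 2 * w x : ℝ) / 2)‖ ≤
      4 * (ε * Real.pi) * |v| ^ 3 := by
  have hi0 : Integrable w := by simpa using integrable_pow_mul_of_le' hw hb (k := 0) (by norm_num)
  have hi1 : Integrable fun x => x * w x := by
    simpa using integrable_pow_mul_of_le' hw hb (k := 1) (by norm_num)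
  have hi2 := integrable_pow_mul_of_le' hw hb (k := 2) (by norm_num)
  obtain ⟨hi3, hi3'⟩ := integrable_pow_mul_of_le hw hb (k := 3) le_rfl
  have hE : Integrable fun x : ℝ => Complex.exp (v * x * Complex.I) * w x := by
    refine hi0.ofReal.bdd_mul (c := 1) (by fun_prop) (.of_forall fun x => ?_)
    have : (v * x * Complex.I : ℂ) = ((v * x : ℝ) : ℂ) * Complex.I := by push_cast; ring
    rw [this, Complex.norm_exp_ofReal_mul_I]
  have hT : (v * (∫ x, x * w x : ℝ) * Complex.I - v ^ 2 * (∫ x, x ^ 2 * w x : ℝ) / 2 : ℂ) =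
      ∫ x : ℝ, (1 + (v * x : ℝ) * Complex.I - ((v * x : ℝ) : ℂ) ^ 2 / 2) * w x := by
    have e : ∀ x : ℝ, (1 + (v * x : ℝ) * Complex.I - ((v * x : ℝ) : ℂ) ^ 2 / 2) * (w x : ℂ) =
        (w x : ℂ) + (v * Complex.I) * ((x * w x : ℝ) : ℂ) - (v ^ 2 / 2) * ((x ^ 2 * w x : ℝ) : ℂ) := by
      intro x; push_cast; ring
    simp_rw [e]
    rw [integral_sub, integral_add, integral_const_mul, integral_const_mul, integral_complex_ofReal,
      integral_complex_ofReal, integral_complex_ofReal, h0]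
    · push_cast; ring
    · exact hi0.ofReal
    · exact hi1.ofReal.const_mul _
    · exact hi0.ofReal.add (hi1.ofReal.const_mul _)
    · exact hi2.ofReal.const_mul _
  have hTi : Integrable fun x : ℝ =>
      (1 + (v * x : ℝ) * Complex.I - ((v * x : ℝ) : ℂ) ^ 2 / 2) * (w x : ℂ) := by
    have e : ∀ x : ℝ, (1 + (v * x : ℝ) * Complex.I - ((v * x : ℝ) : ℂ) ^ 2 / 2) * (w x : ℂ) =
        (w x : ℂ) + (v * Complex.I) * ((x * w x : ℝ) : ℂ) - (v ^ 2 / 2) * ((x ^ 2 * w x : ℝ) : ℂ) := by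
      intro x; push_cast; ring
    simp_rw [e]
    exact (hi0.ofReal.add (hi1.ofReal.const_mul _)).sub (hi2.ofReal.const_mul _)
  rw [hT, ← integral_sub hE hTi]
  refine (norm_integral_le_of_norm_le (hi3.const_mul (4 * |v| ^ 3)) (.of_forall fun x => ?_)).trans ?_
  · have : (v * x * Complex.I : ℂ) = ((v * x : ℝ) : ℂ) * Complex.I := by push_cast; ring
    rw [← sub_mul, norm_mul, this, Complex.norm_real, Real.norm_eq_abs]
    calc _ ≤ 4 * |v * x| ^ 3 * |w x| := by
          gcongr
          exact norm_exp_mul_I_sub_taylor_le _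
      _ = _ := by rw [abs_mul]; ring
  · rw [integral_const_mul]
    calc _ ≤ 4 * |v| ^ 3 * (ε * Real.pi) := by gcongr
      _ = _ := by ring

end Perturbation

lemma integral_exp_mul_gaussianPDFReal (v : ℝ) :
    ∫ x : ℝ, Complex.exp (v * x * Complex.I) * gaussianPDFReal 0 1 x = Complex.exp (-(v ^ 2 / 2)) := by
  have h := charFun_gaussianReal (μ := 0) (v := 1) v
  rw [charFun_apply_real, integral_gaussianReal_eq_integral_smul one_ne_zero] at h
  simp only [Complex.real_smul] at h
  simp_rw [mul_comm _ ((gaussianPDFReal _ _ _ : ℝ) : ℂ)]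
  rw [h]
  simp

/-- A logarithmic expansion of `exp (v ^ 2 / 2) * (exp (-v ^ 2 / 2) + D)` when `D` is close to a
polynomial of degree two in `v`. -/
lemma exists_exp_eq_of_quadratic {v d₁ d₂ η : ℝ} {D : ℂ} (hη : 0 ≤ η) (hη1 : η ≤ 1 / 24)
    (hv : |v| ≤ 1) (hd₁ : |d₁| ≤ η) (hd₂ : |d₂| ≤ η)
    (hD : ‖D - (v * d₁ * Complex.I - v ^ 2 * d₂ / 2)‖ ≤ 4 * η * |v| ^ 3) :
    ∃ ρ : ℂ, ‖ρ‖ ≤ 2000 * η * |v| ^ 3 ∧ Complex.exp (-(v ^ 2 / 2)) + D =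
      Complex.exp (v * d₁ * Complex.I - (1 + d₂ - d₁ ^ 2 : ℝ) * v ^ 2 / 2 + ρ) := by
  set G : ℂ := Complex.exp ((v ^ 2 / 2 : ℝ) : ℂ) with hG
  set q : ℂ := v * d₁ * Complex.I - v ^ 2 * d₂ / 2 with hq
  set z : ℂ := D * G with hz
  set t := |v| with ht
  have ht0 : 0 ≤ t := abs_nonneg v
  have hv2 : v ^ 2 = t ^ 2 := (sq_abs v).symm
  have hv2le : v ^ 2 / 2 ≤ 1 / 2 := by rw [hv2]; nlinarith
  have hGn : ‖G‖ ≤ 2 := by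
    rw [hG, Complex.norm_exp, Complex.ofReal_re]
    calc Real.exp (v ^ 2 / 2) ≤ Real.exp (1 / 2) := by gcongr
      _ ≤ 2 := by
        have : Real.exp (1 / 2) ^ 2 ≤ 2 ^ 2 := by
          rw [← Real.exp_nat_mul]
          norm_num
          linarith [Real.exp_one_lt_d9]
        exact le_of_sq_le_sq this (by norm_num)
  have hG1 : ‖G - 1‖ ≤ t ^ 2 := by
    have h1 : ‖((v ^ 2 / 2 : ℝ) : ℂ)‖ = v ^ 2 / 2 := by
      rw [Complex.norm_real, Real.norm_of_nonneg (by positivity)]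
    have := Complex.norm_exp_sub_one_le (x := ((v ^ 2 / 2 : ℝ) : ℂ)) (by rw [h1]; linarith)
    rw [h1] at this
    linarith
  have hqd : ‖(v * d₁ * Complex.I : ℂ)‖ ≤ η * t := by
    simp only [norm_mul, Complex.norm_real, Complex.norm_I, Real.norm_eq_abs, mul_one]
    rw [mul_comm]
    gcongr
  have hqd2 : ‖(v ^ 2 * d₂ / 2 : ℂ)‖ ≤ η * t ^ 2 := by
    simp only [norm_mul, norm_div, norm_pow, Complex.norm_real, Real.norm_eq_abs, Complex.norm_ofNat]
    have : |v| ^ 2 * |d₂| ≤ t ^ 2 * η := by gcongr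
    have : 0 ≤ |v| ^ 2 * |d₂| := by positivity
    linarith
  have ht2 : t ^ 2 ≤ t := by nlinarith
  have ht3 : t ^ 3 ≤ t ^ 2 := pow_le_pow_of_le_one ht0 hv (by norm_num)
  have hqn : ‖q‖ ≤ 2 * η * t := by
    refine (norm_sub_le _ _).trans ?_
    have : η * t ^ 2 ≤ η * t := by gcongr
    linarith
  have hE1 : ‖z - q‖ ≤ 10 * η * t ^ 3 := by
    have h1 : z - q = (D - q) * G + q * (G - 1) := by rw [hz]; ring
    rw [h1]
    refine (norm_add_le _ _).trans ?_
    rw [norm_mul, norm_mul]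
    calc _ ≤ 4 * η * t ^ 3 * 2 + 2 * η * t * t ^ 2 := by gcongr
      _ = _ := by ring
  have hηt3 : η * t ^ 3 ≤ η * t ^ 2 := by gcongr
  have hηt2 : η * t ^ 2 ≤ η * t := by gcongr
  have hzn : ‖z‖ ≤ 12 * η * t := by
    have : z = (z - q) + q := by ring
    rw [this]
    refine (norm_add_le _ _).trans ?_
    linarith
  have hzhalf : ‖z‖ ≤ 1 / 2 := by
    refine hzn.trans ?_
    have : η * t ≤ 1 / 24 * 1 := by gcongr
    linarith
  have hne : 1 + z ≠ 0 := by
    intro h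
    have : z = -1 := by linear_combination h
    rw [this, norm_neg, norm_one] at hzhalf
    norm_num at hzhalf
  have hlog := Complex.norm_log_sub_logTaylor_le 2 (z := z) (by linarith)
  have hT : Complex.logTaylor (2 + 1) z = z - z ^ 2 / 2 := by
    simp [Complex.logTaylor, Finset.sum_range_succ]
    ring
  rw [hT] at hlog
  have hE2 : ‖Complex.log (1 + z) - (z - z ^ 2 / 2)‖ ≤ 1728 * η * t ^ 3 := by
    refine hlog.trans ?_
    have h0 : 0 ≤ (1 - ‖z‖)⁻¹ := inv_nonneg.2 (by linarith)
    have h2 : (1 - ‖z‖)⁻¹ ≤ 2 := by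
      rw [inv_le_comm₀ (by linarith) (by norm_num)]
      linarith
    calc ‖z‖ ^ (2 + 1) * (1 - ‖z‖)⁻¹ / ((2 : ℕ) + 1)
        ≤ (12 * η * t) ^ (2 + 1) * 2 / ((2 : ℕ) + 1) := by gcongr
      _ = 1152 * (η ^ 2) * (η * t ^ 3) := by push_cast; ring
      _ ≤ 1152 * 1 * (η * t ^ 3) := by
          gcongr
          nlinarith
      _ ≤ _ := by nlinarith [mul_nonneg hη (pow_nonneg ht0 3)]
  have hE3 : ‖z ^ 2 - (v * d₁ * Complex.I) ^ 2‖ ≤ 143 * η * t ^ 3 := by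
    have h1 : z ^ 2 - (v * d₁ * Complex.I) ^ 2 =
        ((z - q) - v ^ 2 * d₂ / 2) * (z + v * d₁ * Complex.I) := by rw [hq]; ring
    rw [h1, norm_mul]
    have h2 : ‖(z - q) - v ^ 2 * d₂ / 2‖ ≤ 11 * η * t ^ 2 :=
      (norm_sub_le _ _).trans (by linarith)
    have h3 : ‖z + v * d₁ * Complex.I‖ ≤ 13 * η * t := (norm_add_le _ _).trans (by linarith)
    calc _ ≤ 11 * η * t ^ 2 * (13 * η * t) := by gcongr
      _ = 143 * η * (η * t ^ 3) := by ring
      _ ≤ 143 * 1 * (η * t ^ 3) := by gcongr; linarith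
      _ = _ := by ring
  -- Three errors, of sizes 10, 143/2 and 1728 times `η |v|³`: replacing `z` by its quadratic part,
  -- `z²` by the square of its linear part, and the logarithm by its Taylor polynomial. The square
  -- of the linear part produces the `d₁²` in the variance.
  refine ⟨(z - q) - (z ^ 2 - (v * d₁ * Complex.I) ^ 2) / 2 + (Complex.log (1 + z) - (z - z ^ 2 / 2)),
    ?_, ?_⟩
  · refine (norm_add_le _ _).trans ((add_le_add (norm_sub_le _ _) le_rfl).trans ?_)
    rw [norm_div, Complex.norm_ofNat]
    have : 0 ≤ η * t ^ 3 := by positivity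
    linarith
  · have e1 : (v * d₁ * Complex.I - (1 + d₂ - d₁ ^ 2 : ℝ) * v ^ 2 / 2 +
        ((z - q) - (z ^ 2 - (v * d₁ * Complex.I) ^ 2) / 2 + (Complex.log (1 + z) - (z - z ^ 2 / 2))) : ℂ)
        = -(v ^ 2 / 2) + Complex.log (1 + z) := by
      have hI : Complex.I ^ 2 = -1 := Complex.I_sq
      rw [hq]
      push_cast
      linear_combination (v * d₁ : ℂ) ^ 2 / 2 * hI
    rw [e1, Complex.exp_add, Complex.exp_log hne, mul_add, mul_one]
    congr 1
    rw [hz, hG, mul_left_comm, ← Complex.exp_add]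
    push_cast
    simp

/-- The characteristic function of a probability density close to the standard Gaussian density. -/
theorem exists_hasCumulantExpansion_of_near_gaussian {f : ℝ → ℝ} {ε : ℝ}
    (hf : AEStronglyMeasurable f) (hε : 0 ≤ ε) (hε1 : ε ≤ 1 / 80000)
    (hb : ∀ x, |f x - gaussianPDFReal 0 1 x| ≤ ε * ((1 + x ^ 2) ^ 3)⁻¹) (h1 : ∫ x, f x = 1) :
    ∃ M S : ℝ, 1 / 2 ≤ S ∧
      HasCumulantExpansion (fun v => ∫ x : ℝ, Complex.exp (v * x * Complex.I) * f x) M S (8000 * ε) 1 ∧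
      ∀ v : ℝ, ‖∫ x : ℝ, Complex.exp (v * x * Complex.I) * f x‖ ≤ Real.exp (-(min (v ^ 2) 1 / 8)) := by
  set w : ℝ → ℝ := fun x => f x - gaussianPDFReal 0 1 x with hwdef
  have hw : AEStronglyMeasurable w := hf.sub (measurable_gaussianPDFReal 0 1).aestronglyMeasurable
  have hwi : Integrable w := by simpa using integrable_pow_mul_of_le' hw hb (k := 0) (by norm_num)
  have hfi : Integrable f := by
    have := hwi.add (integrable_gaussianPDFReal 0 1)
    refine this.congr (.of_forall fun x => ?_)
    simp [hwdef]
  have hw0 : ∫ x, w x = 0 := by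
    rw [hwdef, integral_sub hfi (integrable_gaussianPDFReal 0 1), h1,
      integral_gaussianPDFReal_eq_one 0 one_ne_zero, sub_self]
  have hexpi : ∀ (v : ℝ) {k : ℝ → ℝ}, Integrable k →
      Integrable fun x : ℝ => Complex.exp (v * x * Complex.I) * k x := by
    intro v k hk
    refine hk.ofReal.bdd_mul (c := 1) (by fun_prop) (.of_forall fun x => ?_)
    have : (v * x * Complex.I : ℂ) = ((v * x : ℝ) : ℂ) * Complex.I := by push_cast; ring
    rw [this, Complex.norm_exp_ofReal_mul_I]
  have hsplit : ∀ v : ℝ, ∫ x : ℝ, Complex.exp (v * x * Complex.I) * f x =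
      Complex.exp (-(v ^ 2 / 2)) + ∫ x : ℝ, Complex.exp (v * x * Complex.I) * w x := by
    intro v
    rw [← integral_exp_mul_gaussianPDFReal, ← integral_add (hexpi v (integrable_gaussianPDFReal 0 1))
      (hexpi v hwi)]
    congr with x
    simp only [hwdef]
    push_cast
    ring
  set d₁ := ∫ x, x * w x with hd₁
  set d₂ := ∫ x, x ^ 2 * w x with hd₂
  set η := ε * Real.pi with hη
  have hη0 : 0 ≤ η := by positivity
  have hη4 : η ≤ 4 * ε := by rw [hη, mul_comm]; gcongr; exact Real.pi_le_four
  have hd₁le : |d₁| ≤ η := by simpa using abs_integral_pow_mul_le hw hb (k := 1) (by norm_num)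
  have hd₂le : |d₂| ≤ η := abs_integral_pow_mul_le hw hb (k := 2) (by norm_num)
  have hS : 1 / 2 ≤ 1 + d₂ - d₁ ^ 2 := by
    have h1 := (abs_le.1 hd₂le).1
    have h2 : d₁ ^ 2 ≤ η ^ 2 := by rw [← sq_abs d₁]; gcongr
    nlinarith
  have hcum : HasCumulantExpansion (fun v => ∫ x : ℝ, Complex.exp (v * x * Complex.I) * f x) d₁
      (1 + d₂ - d₁ ^ 2) (8000 * ε) 1 := by
    intro v hv
    obtain ⟨ρ, hρ, he⟩ := exists_exp_eq_of_quadratic hη0 (by linarith) hv hd₁le hd₂le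
      (norm_integral_exp_mul_sub_le hw hb hw0 v)
    refine ⟨ρ, hρ.trans ?_, ?_⟩
    · gcongr ?_ * _
      linarith
    · simp only [hsplit]
      exact he
  refine ⟨d₁, _, hS, hcum, fun v => ?_⟩
  -- For `|v| ≤ 1` the decay follows from the expansion. For `|v| ≥ 1` the Gaussian part is at most
  -- `2/3` and the perturbation is tiny, which stays below `7/8 ≤ e^{-1/8}`.
  rcases le_total |v| 1 with hv | hv
  · refine (hcum.norm_eq hv).trans ?_
    have hv1 : v ^ 2 ≤ 1 := by rw [← sq_abs]; exact pow_le_one₀ (abs_nonneg v) hv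
    rw [min_eq_left hv1]
    refine Real.exp_le_exp.2 ?_
    have h1 : |v| ^ 3 ≤ v ^ 2 := by
      rw [← sq_abs v]
      exact pow_le_pow_of_le_one (abs_nonneg v) hv (by norm_num)
    have h2 : 8000 * ε * |v| ^ 3 ≤ 1 / 10 * v ^ 2 := by
      refine mul_le_mul (by linarith) h1 (by positivity) (by norm_num)
    nlinarith [sq_nonneg v]
  · have hv1 : 1 ≤ v ^ 2 := by
      rw [← sq_abs]
      exact one_le_pow₀ hv
    rw [min_eq_right hv1, hsplit]
    refine (norm_add_le _ _).trans ?_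
    have h1 : ‖∫ x : ℝ, Complex.exp (v * x * Complex.I) * w x‖ ≤ η := by
      have hi := integrable_pow_mul_of_le hw hb (k := 0) (by norm_num)
      simp only [pow_zero, one_mul] at hi
      refine (norm_integral_le_of_norm_le hi.1 (.of_forall fun x => ?_)).trans hi.2
      have : (v * x * Complex.I : ℂ) = ((v * x : ℝ) : ℂ) * Complex.I := by push_cast; ring
      rw [norm_mul, this, Complex.norm_exp_ofReal_mul_I]
      simp
    have h2 : ‖Complex.exp (-(v ^ 2 / 2) : ℂ)‖ ≤ 2 / 3 := by
      have : (-(v ^ 2 / 2) : ℂ) = ((-(v ^ 2 / 2) : ℝ) : ℂ) := by push_cast; rfl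
      rw [this, Complex.norm_exp, Complex.ofReal_re, Real.exp_neg]
      rw [inv_le_comm₀ (Real.exp_pos _) (by norm_num)]
      have := Real.add_one_le_exp (v ^ 2 / 2)
      linarith
    have h3 : 7 / 8 ≤ Real.exp (-(1 / 8)) := by
      have := Real.add_one_le_exp (-(1 / 8))
      linarith
    linarith

/-! ### Laplace's method -/

lemma measurable_of_monotoneOn_Iic_antitoneOn_Ici {f : ℝ → ℝ} {x₀ : ℝ}
    (h₁ : MonotoneOn f (Iic x₀)) (h₂ : AntitoneOn f (Ici x₀)) : Measurable f := by
  have hm : Monotone fun x => f (min x x₀) := fun x y hxy =>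
    h₁ (mem_Iic.2 (min_le_right x x₀)) (mem_Iic.2 (min_le_right y x₀)) (min_le_min_right _ hxy)
  have ha : Antitone fun x => f (max x x₀) := fun x y hxy =>
    h₂ (mem_Ici.2 (le_max_right x x₀)) (mem_Ici.2 (le_max_right y x₀)) (max_le_max_right _ hxy)
  have : f = fun x => if x ≤ x₀ then f (min x x₀) else f (max x x₀) := by
    ext x
    split_ifs with h
    · rw [min_eq_left h]
    · rw [max_eq_left (not_le.1 h).le]
  rw [this]
  exact Measurable.ite measurableSet_Iic hm.measurable ha.measurable

/-- Half of the Gaussian exponent, the part left after absorbing the cubic remainder, still beats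
every polynomial. -/
lemma one_add_sq_pow_mul_exp_le (x : ℝ) :
    (|x| + |x| ^ 3) * Real.exp (-(x ^ 2 / 4)) ≤ 737280 * ((1 + x ^ 2) ^ 3)⁻¹ := by
  have h := Real.pow_div_factorial_le_exp (1 + x ^ 2 / 4) (by positivity) 5
  rw [Real.exp_add] at h
  have h1 : Real.exp 1 ≤ 3 := by linarith [Real.exp_one_lt_d9]
  have h2 : (1 + x ^ 2 / 4) ^ 5 ≤ 360 * Real.exp (x ^ 2 / 4) := by
    have : ((5).factorial : ℝ) = 120 := by norm_num [Nat.factorial]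
    rw [this, div_le_iff₀ (by norm_num)] at h
    have : Real.exp 1 * Real.exp (x ^ 2 / 4) ≤ 3 * Real.exp (x ^ 2 / 4) := by gcongr
    linarith
  have h3 : (1 + x ^ 2) ^ 5 ≤ 1024 * (1 + x ^ 2 / 4) ^ 5 := by
    have : (1 + x ^ 2) ^ 5 ≤ (4 * (1 + x ^ 2 / 4)) ^ 5 := by gcongr; linarith
    refine this.trans (le_of_eq ?_)
    ring
  have h4 : |x| + |x| ^ 3 ≤ 2 * (1 + x ^ 2) ^ 2 := by
    have e1 := abs_pow_le_sq_one_add_sq (k := 1) (by norm_num) x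
    have e3 := abs_pow_le_sq_one_add_sq (k := 3) (by norm_num) x
    rw [pow_one] at e1
    linarith
  rw [Real.exp_neg, ← div_eq_mul_inv, ← div_eq_mul_inv,
    div_le_div_iff₀ (Real.exp_pos _) (by positivity)]
  calc (|x| + |x| ^ 3) * (1 + x ^ 2) ^ 3 ≤ 2 * (1 + x ^ 2) ^ 2 * (1 + x ^ 2) ^ 3 := by gcongr
    _ = 2 * (1 + x ^ 2) ^ 5 := by ring
    _ ≤ 737280 * Real.exp (x ^ 2 / 4) := by linarith

lemma abs_perturbed_exp_sub_le (q W : ℝ) :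
    |(1 + q) * Real.exp (-W) - 1| ≤ (|q| + |W|) * Real.exp |W| := by
  have h1 : (1 + q) * Real.exp (-W) - 1 = q * Real.exp (-W) + (Real.exp (-W) - 1) := by ring
  have h2 : |Real.exp (-W) - 1| ≤ |W| * Real.exp |W| := by
    have := Complex.norm_exp_sub_sum_le_norm_mul_exp ((-W : ℝ) : ℂ) 1
    simp only [Finset.range_one, Finset.sum_singleton, pow_zero, Nat.factorial_zero, Nat.cast_one,
      div_one, pow_one, Complex.norm_real, Real.norm_eq_abs, abs_neg] at this
    rw [← Complex.ofReal_exp, ← Complex.ofReal_one, ← Complex.ofReal_sub, Complex.norm_real] at this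
    exact this
  have h3 : Real.exp (-W) ≤ Real.exp |W| := Real.exp_le_exp.2 (neg_le_abs W)
  rw [h1]
  refine (abs_add_le _ _).trans ?_
  rw [abs_mul, abs_of_pos (Real.exp_pos _), add_mul]
  gcongr

lemma exp_mul_abs_perturbed_le {x t q W : ℝ} (ht : 0 < t) (hx : |x| ≤ t)
    (hq : |q| ≤ |x| / (4 * t)) (hW : |W| ≤ |x| ^ 3 / (4 * t)) :
    Real.exp (-(x ^ 2 / 2)) * |(1 + q) * Real.exp (-W) - 1| ≤
      737280 * ((1 + x ^ 2) ^ 3)⁻¹ / t := by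
  have hW2 : |W| ≤ x ^ 2 / 4 := by
    refine hW.trans ?_
    rw [← sq_abs x, div_le_div_iff₀ (by positivity) (by norm_num)]
    calc |x| ^ 3 * 4 = |x| ^ 2 * |x| * 4 := by ring
      _ ≤ |x| ^ 2 * t * 4 := by gcongr
      _ = _ := by ring
  have hgauss := one_add_sq_pow_mul_exp_le x
  calc Real.exp (-(x ^ 2 / 2)) * |(1 + q) * Real.exp (-W) - 1|
      ≤ Real.exp (-(x ^ 2 / 2)) * ((|x| / (4 * t) + |x| ^ 3 / (4 * t)) *
        Real.exp (x ^ 2 / 4)) := by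
        gcongr
        refine (abs_perturbed_exp_sub_le _ _).trans ?_
        gcongr
    _ = (|x| + |x| ^ 3) * Real.exp (-(x ^ 2 / 4)) / (4 * t) := by
        have : Real.exp (-(x ^ 2 / 4)) = Real.exp (-(x ^ 2 / 2)) * Real.exp (x ^ 2 / 4) := by
          rw [← Real.exp_add]; ring_nf
        rw [this]
        ring
    _ ≤ 737280 * ((1 + x ^ 2) ^ 3)⁻¹ / t := by
        gcongr
        linarith

/-- Tail estimate. Six powers of `1 + |y|` pay for `(1 + x²)³`; the exponent left over is
nonpositive, so the base may be lowered to `1 + δ`. The factor `n⁴` consists of `n³` from rescaling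
`x` and one `n` bounding `√n`; the geometric decay in `n` swallows it. -/
lemma rpow_mul_one_add_sq_le {α c δ a B x y n : ℝ} (hn : 1 ≤ n) (ha : 0 < a)
    (hδ : 0 < δ) (hy : δ < |y|) (hxy : x ^ 2 = a * n * y ^ 2) (hα : α + 6 ≤ n * c)
    (hB : n ^ 4 * (1 + δ) ^ (-(c * n)) ≤ B) :
    (1 + |y|) ^ α * (1 + |y|) ^ (-(c * n)) ≤
      (1 + a) ^ 3 * ((1 + δ) ^ (α + 6) * B) / √n * ((1 + x ^ 2) ^ 3)⁻¹ := by
  have hn0 : 0 < n := by linarith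
  set Y := 1 + |y| with hY
  have hY1 : 1 ≤ Y := by linarith [abs_nonneg y]
  have hY0 : 0 < Y := by linarith
  have hYw : Y ^ (α + 6 - c * n) ≤ (1 + δ) ^ (α + 6 - c * n) :=
    Real.rpow_le_rpow_of_nonpos (by linarith) (by linarith) (by linarith)
  have hx6 : (1 + x ^ 2) ^ 3 ≤ ((1 + a) * n) ^ 3 * Y ^ 6 := by
    have h1 : 1 + x ^ 2 ≤ (1 + a) * n * Y ^ 2 := by
      have h2 : x ^ 2 = a * n * |y| ^ 2 := by rw [hxy, sq_abs]
      have h3 : |y| ^ 2 ≤ Y ^ 2 := by gcongr; linarith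
      have h4 : 1 ≤ n * Y ^ 2 := by
        calc (1 : ℝ) = 1 * 1 := by norm_num
          _ ≤ n * Y ^ 2 := by
            gcongr
            exact one_le_pow₀ hY1
      have h5 : a * n * |y| ^ 2 ≤ a * n * Y ^ 2 := by gcongr
      rw [h2]
      linarith
    calc (1 + x ^ 2) ^ 3 ≤ ((1 + a) * n * Y ^ 2) ^ 3 := by gcongr
      _ = _ := by ring
  have hsqrt : √n ≤ n := by
    rw [Real.sqrt_le_left hn0.le]
    nlinarith
  have hpow : Y ^ α * Y ^ (-(c * n)) * Y ^ 6 = Y ^ (α + 6 - c * n) := by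
    rw [← Real.rpow_natCast Y 6, ← Real.rpow_add hY0, ← Real.rpow_add hY0]
    congr 1
    push_cast
    ring
  have hδpow : (1 + δ) ^ (α + 6 - c * n) = (1 + δ) ^ (α + 6) * (1 + δ) ^ (-(c * n)) := by
    rw [← Real.rpow_add (by linarith)]
    congr 1
  rw [← div_eq_mul_inv, div_div, le_div_iff₀ (by positivity)]
  calc Y ^ α * Y ^ (-(c * n)) * (√n * (1 + x ^ 2) ^ 3)
      ≤ Y ^ α * Y ^ (-(c * n)) * (n * (((1 + a) * n) ^ 3 * Y ^ 6)) := by gcongr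
    _ = (1 + a) ^ 3 * n ^ 4 * (Y ^ α * Y ^ (-(c * n)) * Y ^ 6) := by ring
    _ ≤ (1 + a) ^ 3 * n ^ 4 * ((1 + δ) ^ (α + 6) * (1 + δ) ^ (-(c * n))) := by
        rw [hpow, ← hδpow]
        gcongr
    _ = (1 + a) ^ 3 * ((1 + δ) ^ (α + 6) * (n ^ 4 * (1 + δ) ^ (-(c * n)))) := by ring
    _ ≤ _ := by gcongr

section Laplace

variable {g h : ℝ → ℝ} {x₀ δ : ℝ}

/-- Where `g` is positive, an exponent `h` whose weights `g e^{-nh}` all decrease away from `x₀`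
stays above its boundary values. -/
lemma le_of_forall_mul_exp_le {A B u v : ℝ} (hA : 0 < A)
    (hle : ∀ n : ℕ, 1 ≤ n → A * Real.exp (-(n * u)) ≤ B * Real.exp (-(n * v))) : v ≤ u := by
  by_contra hlt
  push Not at hlt
  have h1 : ∀ n : ℕ, 1 ≤ n → A * (1 + n * (v - u)) ≤ B := by
    intro n hn
    have h2 := hle n hn
    have h3 : A * Real.exp (n * (v - u)) ≤ B := by
      have e : Real.exp (n * (v - u)) = Real.exp (-(n * u)) * Real.exp (n * v) := by
        rw [← Real.exp_add]; ring_nf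
      have e2 : Real.exp (-(n * v)) * Real.exp (n * v) = 1 := by
        rw [← Real.exp_add]; simp
      calc A * Real.exp (n * (v - u)) = A * Real.exp (-(n * u)) * Real.exp (n * v) := by rw [e]; ring
        _ ≤ B * Real.exp (-(n * v)) * Real.exp (n * v) := by gcongr
        _ = B := by rw [mul_assoc, e2, mul_one]
    have h4 := Real.add_one_le_exp (n * (v - u))
    calc A * (1 + n * (v - u)) ≤ A * Real.exp (n * (v - u)) := by gcongr; linarith
      _ ≤ B := h3
  obtain ⟨n, hn⟩ := exists_nat_gt (max 1 (B / A / (v - u)))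
  have hn1 : 1 ≤ n := by
    have : (1 : ℝ) < n := (le_max_left _ _).trans_lt hn
    exact_mod_cast this.le
  have hn2 : B / A / (v - u) < n := (le_max_right _ _).trans_lt hn
  have hvu : 0 < v - u := by linarith
  rw [div_lt_iff₀ hvu, div_lt_iff₀ hA] at hn2
  have := h1 n hn1
  nlinarith

lemma exists_pow_mul_rpow_le {δ c : ℝ} (hδ : 0 < δ) (hc : 0 < c) :
    ∃ B : ℝ, 0 < B ∧ ∀ n : ℕ, (n : ℝ) ^ 4 * (1 + δ) ^ (-(c * n)) ≤ B := by
  set r : ℝ := (1 + δ) ^ (-c) with hr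
  have hr0 : 0 < r := Real.rpow_pos_of_pos (by linarith) _
  have hr1 : r < 1 := Real.rpow_lt_one_of_one_lt_of_neg (by linarith) (by linarith)
  have hlim := tendsto_pow_const_mul_const_pow_of_abs_lt_one 4 (r := r) (by rwa [abs_of_pos hr0])
  obtain ⟨B, hB⟩ := hlim.bddAbove_range
  refine ⟨max B 1, by positivity, fun n => ?_⟩
  have : (1 + δ) ^ (-(c * n)) = r ^ n := by
    rw [hr, ← Real.rpow_natCast, ← Real.rpow_mul (by linarith)]
    ring_nf
  rw [this]
  exact (hB ⟨n, rfl⟩).trans (le_max_left _ _)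

set_option maxHeartbeats 1600000 in
/-- Laplace's method: after rescaling, the weight `g e^{-nh}` is uniformly close to the Gaussian
weight. -/
theorem Admissible.exists_laplace (hgh : Admissible g h) :
    ∃ x₀ a C : ℝ, ∃ n₁ : ℕ, 0 < a ∧ 0 < C ∧ 0 < g x₀ ∧ 1 ≤ n₁ ∧
      (∀ n : ℕ, 1 ≤ n → Measurable fun x => g x * Real.exp (-(n * h x))) ∧
      ∀ n : ℕ, n₁ ≤ n → ∀ x : ℝ,
        |g (x₀ + x / √(a * n)) * Real.exp (-(n * h (x₀ + x / √(a * n)))) /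
          (g x₀ * Real.exp (-(n * h x₀))) - Real.exp (-(x ^ 2 / 2))| ≤
          C / √n * ((1 + x ^ 2) ^ 3)⁻¹ := by
  obtain ⟨hg0, hh0, x₀, δ, hδ, hmin, ha, -, ha0, ⟨r, q, hrq⟩, α, c, D, hα, hc, hD, hout⟩ := hgh
  set a := deriv (deriv h) x₀ with hadef
  have hgx : 0 < g x₀ := by
    have h1 := (ha 1 le_rfl).2.1 (x₀ + 1) (by linarith)
    have h2 : 0 ≤ g (x₀ + 1) * Real.exp (-((1 : ℕ) * h (x₀ + 1))) :=
      mul_nonneg (hg0 _) (Real.exp_pos _).le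
    exact pos_of_mul_pos_left (h2.trans_lt h1) (Real.exp_pos _).le
  set η := a * δ ^ 2 / 4 with hη
  have hη0 : 0 < η := by positivity
  have hbd : ∀ y : ℝ, |y| ≤ δ → h x₀ + a * y ^ 2 / 4 ≤ h (x₀ + y) := by
    intro y hy
    obtain ⟨e1, -, e3, -⟩ := hrq (x₀ + y) ⟨by linarith [(abs_le.1 hy).1], by linarith [(abs_le.1 hy).2]⟩
    rw [e1]
    rw [add_sub_cancel_left] at e3 ⊢
    have h1 : 1 / (4 * δ) * |y| ^ 3 ≤ y ^ 2 / 4 := by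
      rw [← sq_abs y, div_mul_eq_mul_div, div_le_div_iff₀ (by positivity) (by norm_num)]
      nlinarith [mul_le_mul_of_nonneg_left hy (sq_nonneg |y|)]
    have h2 := (abs_le.1 e3).1
    have h3 : a * (y ^ 2 / 4) ≤ a * (1 / 2 * y ^ 2 + r (x₀ + y)) := by
      gcongr
      linarith
    linarith
  -- Unimodality of all the weights at once lets the exponent dominate as `n → ∞`, so `h` is at
  -- least its value at `x₀ ± δ`. Where `g` vanishes nothing is needed, as the weight is zero.
  have hfar : ∀ y : ℝ, δ < |y| → 0 < g (x₀ + y) → h x₀ + η ≤ h (x₀ + y) := by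
    intro y hy hgy
    rcases le_or_gt 0 y with h0 | h0
    · rw [abs_of_nonneg h0] at hy
      have h1 : h (x₀ + δ) ≤ h (x₀ + y) := by
        refine le_of_forall_mul_exp_le hgy (B := g (x₀ + δ)) fun n hn => ?_
        exact (ha n hn).2.2.2 (by simp [hδ.le]) (by simp [h0]) (by linarith)
      have h2 := hbd δ (abs_of_pos hδ).le
      linarith
    · rw [abs_of_neg h0] at hy
      have h1 : h (x₀ + -δ) ≤ h (x₀ + y) := by
        refine le_of_forall_mul_exp_le hgy (B := g (x₀ + -δ)) fun n hn => ?_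
        exact (ha n hn).2.2.1 (by simp [h0.le]) (by simp [hδ.le]) (by linarith)
      have h2 := hbd (-δ) (by rw [abs_neg, abs_of_pos hδ])
      rw [neg_sq] at h2
      linarith
  -- Admissibility bounds `h`, not `h - h x₀`, by a logarithm. Combined with the gap `η`, the bound
  -- passes to the difference, because `h ↦ (h - h x₀) / h` is smallest at `h = h x₀ + η`.
  set c' := η * c / (h x₀ + η) with hc'
  have hhη : 0 < h x₀ + η := by linarith [hh0 x₀]
  have hc'0 : 0 < c' := by positivity
  have hfar' : ∀ y : ℝ, δ < |y| → 0 < g (x₀ + y) → c' * Real.log (1 + |y|) ≤ h (x₀ + y) - h x₀ := by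
    intro y hy hgy
    have h1 := hfar y hy hgy
    have hmem : x₀ + y ∉ Icc (x₀ - δ) (x₀ + δ) := by
      intro hm
      have : |y| ≤ δ := abs_le.2 ⟨by linarith [hm.1], by linarith [hm.2]⟩
      linarith
    have h2 := (hout _ hmem).1
    rw [add_sub_cancel_left] at h2
    set b := Real.log (1 + |y|)
    rw [hc', div_mul_eq_mul_div, div_le_iff₀ hhη]
    nlinarith [hh0 x₀]
  obtain ⟨B, hB0, hB⟩ := exists_pow_mul_rpow_le hδ hc'0
  set C₁ := 737280 / (δ * √a) with hC₁
  set C₂ := 2 * D / g x₀ * ((1 + a) ^ 3 * ((1 + δ) ^ (α + 6) * B)) with hC₂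
  have hC₁0 : 0 < C₁ := by positivity
  have hC₂0 : 0 < C₂ := by positivity
  -- From here on `n c' ≥ α + 6`, as the tail estimate requires.
  obtain ⟨n₁, hn₁⟩ := exists_nat_ge (max 1 ((α + 6) / c'))
  have hn₁1 : 1 ≤ n₁ := by exact_mod_cast (le_max_left _ _).trans hn₁
  refine ⟨x₀, a, C₁ + C₂, n₁, ha0, by positivity, hgx, hn₁1, fun n hn =>
    measurable_of_monotoneOn_Iic_antitoneOn_Ici (ha n hn).2.2.1 (ha n hn).2.2.2, fun n hn x => ?_⟩
  have hn1 : (1 : ℝ) ≤ n := by exact_mod_cast hn₁1.trans hn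
  have hn0 : (0 : ℝ) < n := by linarith
  have hnα : (α + 6) / c' ≤ n := ((le_max_right _ _).trans hn₁).trans (by exact_mod_cast hn)
  rw [div_le_iff₀ hc'0] at hnα
  set s := √(a * n) with hs
  have hs0 : 0 < s := by positivity
  have hs2 : s ^ 2 = a * n := Real.sq_sqrt (by positivity)
  have hsn : s = √a * √n := Real.sqrt_mul ha0.le _
  have hsn0 : 0 < √(n : ℝ) := by positivity
  set y := x / s with hy
  have hxy : x = s * y := by rw [hy]; field_simp
  set w := ((1 + x ^ 2) ^ 3)⁻¹ with hw
  have hw0 : 0 < w := by positivity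
  have hgauss := one_add_sq_pow_mul_exp_le x
  rw [← hw] at hgauss
  have hquot : g (x₀ + y) * Real.exp (-(n * h (x₀ + y))) / (g x₀ * Real.exp (-(n * h x₀))) =
      g (x₀ + y) / g x₀ * Real.exp (-(n * (h (x₀ + y) - h x₀))) := by
    have : Real.exp (-(n * (h (x₀ + y) - h x₀))) =
        Real.exp (-(n * h (x₀ + y))) / Real.exp (-(n * h x₀)) := by
      rw [← Real.exp_sub]; ring_nf
    rw [this]
    field_simp
  rw [hquot]
  have hC₁s : 737280 * w / (δ * s) = C₁ / √n * w := by
    rw [hC₁, hsn]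
    field_simp
  have hadd : C₁ / √n * w + C₂ / √n * w = (C₁ + C₂) / √n * w := by ring
  have hC₂pos : 0 < C₂ / √n * w := by positivity
  have hC₁pos : 0 < C₁ / √n * w := by positivity
  by_cases hyδ : |y| ≤ δ
  · obtain ⟨e1, e2, e3, e4⟩ := hrq (x₀ + y)
      ⟨by linarith [(abs_le.1 hyδ).1], by linarith [(abs_le.1 hyδ).2]⟩
    rw [add_sub_cancel_left] at e1 e3 e4
    set W := n * a * r (x₀ + y) with hW
    have hWle : |W| ≤ |x| ^ 3 / (4 * (δ * s)) := by
      rw [hW, abs_mul, abs_of_pos (by positivity : 0 < n * a)]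
      calc n * a * |r (x₀ + y)| ≤ n * a * (1 / (4 * δ) * |y| ^ 3) := by gcongr
        _ = |x| ^ 3 / (4 * (δ * s)) := by
          rw [hxy, abs_mul, abs_of_pos hs0, mul_comm (n : ℝ) a, ← hs2]
          field_simp
    have hqle : |q (x₀ + y)| ≤ |x| / (4 * (δ * s)) := by
      refine e4.trans (le_of_eq ?_)
      rw [hxy, abs_mul, abs_of_pos hs0]
      field_simp
    have hF : g (x₀ + y) / g x₀ * Real.exp (-(n * (h (x₀ + y) - h x₀))) - Real.exp (-(x ^ 2 / 2)) =
        Real.exp (-(x ^ 2 / 2)) * ((1 + q (x₀ + y)) * Real.exp (-W) - 1) := by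
      have h1 : Real.exp (-(n * (h (x₀ + y) - h x₀))) = Real.exp (-(x ^ 2 / 2)) * Real.exp (-W) := by
        rw [← Real.exp_add]
        congr 1
        rw [e1, hW]
        have : x ^ 2 = a * n * y ^ 2 := by rw [hxy, mul_pow, hs2]
        rw [this]
        ring
      rw [h1, e2]
      field_simp
    rw [hF, abs_mul, abs_of_pos (Real.exp_pos _)]
    have hxs : |x| ≤ δ * s := by
      rw [hxy, abs_mul, abs_of_pos hs0, mul_comm]
      gcongr
    refine (exp_mul_abs_perturbed_le (mul_pos hδ hs0) hxs hqle hWle).trans ?_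
    rw [← hw, hC₁s, ← hadd]
    exact le_add_of_nonneg_right hC₂pos.le
  · push Not at hyδ
    have hE : Real.exp (-(x ^ 2 / 2)) ≤ C₁ / √n * w := by
      rw [← hC₁s, le_div_iff₀ (by positivity)]
      refine le_trans ?_ hgauss
      have h1 : δ * s ≤ |x| + |x| ^ 3 := by
        have : δ * s ≤ |x| := by
          rw [hxy, abs_mul, abs_of_pos hs0, mul_comm]
          gcongr
        have : 0 ≤ |x| ^ 3 := by positivity
        linarith
      rw [mul_comm]
      have h2 : Real.exp (-(x ^ 2 / 2)) ≤ Real.exp (-(x ^ 2 / 4)) := by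
        apply Real.exp_le_exp.2
        nlinarith [sq_nonneg x]
      gcongr
    have hFle : g (x₀ + y) / g x₀ * Real.exp (-(n * (h (x₀ + y) - h x₀))) ≤ C₂ / √n * w := by
      rcases (hg0 (x₀ + y)).eq_or_lt with hz | hgy
      · rw [← hz]
        simpa using hC₂pos.le
      · have hmem : x₀ + y ∉ Icc (x₀ - δ) (x₀ + δ) := by
          intro hm
          have : |y| ≤ δ := abs_le.2 ⟨by linarith [hm.1], by linarith [hm.2]⟩
          linarith
        have hgle := (hout _ hmem).2
        rw [add_sub_cancel_left] at hgle
        set Y := 1 + |y| with hY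
        have hY1 : 1 ≤ Y := by linarith [abs_nonneg y]
        have hY0 : 0 < Y := by linarith
        have hgle2 : g (x₀ + y) ≤ 2 * D * Y ^ α := by
          have h1 : |y| ^ α ≤ Y ^ α := Real.rpow_le_rpow (abs_nonneg y) (by linarith) hα.le
          have h2 : 1 ≤ Y ^ α := Real.one_le_rpow hY1 hα.le
          nlinarith
        have hexp : Real.exp (-(n * (h (x₀ + y) - h x₀))) ≤ Y ^ (-(c' * n)) := by
          rw [Real.rpow_def_of_pos hY0]
          apply Real.exp_le_exp.2
          have := mul_le_mul_of_nonneg_left (hfar' y hyδ hgy) hn0.le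
          linarith
        have hfin2 : Y ^ α * Y ^ (-(c' * n)) ≤
            (1 + a) ^ 3 * ((1 + δ) ^ (α + 6) * B) / √n * w :=
          rpow_mul_one_add_sq_le hn1 ha0 hδ hyδ (by rw [hxy, mul_pow, hs2]) hnα (hB n)
        calc g (x₀ + y) / g x₀ * Real.exp (-(n * (h (x₀ + y) - h x₀)))
            ≤ 2 * D * Y ^ α / g x₀ * Y ^ (-(c' * n)) := by gcongr
          _ = 2 * D / g x₀ * (Y ^ α * Y ^ (-(c' * n))) := by ring
          _ ≤ 2 * D / g x₀ * ((1 + a) ^ 3 * ((1 + δ) ^ (α + 6) * B) / √n * w) := by gcongr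
          _ = C₂ / √n * w := by rw [hC₂]; ring
    have hF0 : 0 ≤ g (x₀ + y) / g x₀ * Real.exp (-(n * (h (x₀ + y) - h x₀))) := by
      have := hg0 (x₀ + y)
      positivity
    rw [abs_le]
    have := Real.exp_pos (-(x ^ 2 / 2))
    constructor <;> linarith

end Laplace

lemma exp_neg_sq_le_inv_one_add_sq_pow (x : ℝ) :
    Real.exp (-(x ^ 2 / 2)) ≤ 144 * ((1 + x ^ 2) ^ 3)⁻¹ := by
  have h := Real.pow_div_factorial_le_exp (1 + x ^ 2 / 2) (by positivity) 3
  rw [Real.exp_add] at h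
  have h1 : Real.exp 1 ≤ 3 := by linarith [Real.exp_one_lt_d9]
  have h2 : (1 + x ^ 2 / 2) ^ 3 ≤ 18 * Real.exp (x ^ 2 / 2) := by
    have : ((3).factorial : ℝ) = 6 := by norm_num [Nat.factorial]
    rw [this, div_le_iff₀ (by norm_num)] at h
    have : Real.exp 1 * Real.exp (x ^ 2 / 2) ≤ 3 * Real.exp (x ^ 2 / 2) := by gcongr
    linarith
  have h3 : (1 + x ^ 2) ^ 3 ≤ 8 * (1 + x ^ 2 / 2) ^ 3 := by
    have : (1 + x ^ 2) ^ 3 ≤ (2 * (1 + x ^ 2 / 2)) ^ 3 := by gcongr; linarith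
    refine this.trans (le_of_eq ?_)
    ring
  rw [Real.exp_neg, ← div_eq_mul_inv, le_div_iff₀ (by positivity), inv_mul_le_iff₀ (Real.exp_pos _)]
  linarith

/-- Normalization of a function close to the Gaussian weight. -/
lemma normalize_near_gaussian {F : ℝ → ℝ} {ε : ℝ} (hF : AEStronglyMeasurable F)
    (hε1 : ε ≤ 1 / 4)
    (hb : ∀ x, |F x - Real.exp (-(x ^ 2 / 2))| ≤ ε * ((1 + x ^ 2) ^ 3)⁻¹) :
    Integrable F ∧ 1 ≤ ∫ x, F x ∧
      ∀ x, |F x / (∫ x, F x) - gaussianPDFReal 0 1 x| ≤ 1000 * ε * ((1 + x ^ 2) ^ 3)⁻¹ := by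
  set c := √(2 * Real.pi) with hc
  have hc2 : 2 ≤ c := by
    apply Real.le_sqrt_of_sq_le
    nlinarith [Real.pi_gt_three]
  have hγ : ∀ x, Real.exp (-(x ^ 2 / 2)) = c * gaussianPDFReal 0 1 x := by
    intro x
    rw [gaussianPDFReal]
    simp only [NNReal.coe_one, mul_one, sub_zero]
    rw [← hc, mul_inv_cancel_left₀ (by positivity)]
    ring_nf
  have hγi : Integrable fun x : ℝ => Real.exp (-(x ^ 2 / 2)) := by
    simp_rw [hγ]
    exact (integrable_gaussianPDFReal 0 1).const_mul c
  have hγI : ∫ x : ℝ, Real.exp (-(x ^ 2 / 2)) = c := by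
    simp_rw [hγ]
    rw [integral_const_mul, integral_gaussianPDFReal_eq_one 0 one_ne_zero, mul_one]
  have hε0 : 0 ≤ ε := by
    have := (abs_nonneg _).trans (hb 0)
    simpa using this
  set w : ℝ → ℝ := fun x => F x - Real.exp (-(x ^ 2 / 2)) with hw
  have hwm : AEStronglyMeasurable w := hF.sub hγi.aestronglyMeasurable
  obtain ⟨hwi, hwI⟩ := integrable_pow_mul_of_le hwm hb (k := 0) (by norm_num)
  simp only [pow_zero, one_mul] at hwi hwI
  have hwi' : Integrable w := (integrable_norm_iff hwm).1 hwi
  have hFi : Integrable F := by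
    refine (hwi'.add hγi).congr (.of_forall fun x => ?_)
    simp [hw]
  set Z := ∫ x, F x with hZ
  have hZw : |Z - c| ≤ 4 * ε := by
    rw [hZ, ← hγI, ← integral_sub hFi hγi]
    refine abs_integral_le_integral_abs.trans (hwI.trans ?_)
    rw [mul_comm]
    gcongr
    exact Real.pi_le_four
  have hZ1 : 1 ≤ Z := by
    have := (abs_le.1 hZw).1
    linarith
  refine ⟨hFi, hZ1, fun x => ?_⟩
  have hsplit : F x / Z - gaussianPDFReal 0 1 x =
      (w x + gaussianPDFReal 0 1 x * (c - Z)) / Z := by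
    rw [hw]
    simp only
    rw [hγ]
    field_simp
    ring
  have hg0 := gaussianPDFReal_nonneg 0 1 x
  have hgle : gaussianPDFReal 0 1 x ≤ 144 * ((1 + x ^ 2) ^ 3)⁻¹ := by
    refine le_trans ?_ (exp_neg_sq_le_inv_one_add_sq_pow x)
    rw [hγ]
    nlinarith
  rw [hsplit, abs_div, abs_of_pos (by linarith : 0 < Z)]
  have hnum : |w x + gaussianPDFReal 0 1 x * (c - Z)| ≤ 1000 * ε * ((1 + x ^ 2) ^ 3)⁻¹ := by
    refine (abs_add_le _ _).trans ?_
    rw [abs_mul, abs_of_nonneg hg0, abs_sub_comm c Z]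
    calc _ ≤ ε * ((1 + x ^ 2) ^ 3)⁻¹ + 144 * ((1 + x ^ 2) ^ 3)⁻¹ * (4 * ε) := by
          gcongr
          exact hb x
      _ = 577 * ε * ((1 + x ^ 2) ^ 3)⁻¹ := by ring
      _ ≤ _ := by gcongr; norm_num
  exact (div_le_self (abs_nonneg _) hZ1).trans hnum

/-- The characteristic function of the probability density proportional to `ρ`. -/
noncomputable def densityCharFun (ρ : ℝ → ℝ) (u : ℝ) : ℂ :=
  (∫ x : ℝ, Complex.exp (u * x * Complex.I) * ρ x) / ((∫ x, ρ x : ℝ) : ℂ)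

lemma integral_eq_inv_mul_integral_comp {E : Type*} [NormedAddCommGroup E] [NormedSpace ℝ E]
    (k : ℝ → E) (x₀ : ℝ) {s : ℝ} (hs : 0 < s) : ∫ x, k x = s⁻¹ • ∫ y, k (x₀ + y / s) := by
  rw [Measure.integral_comp_div (fun z => k (x₀ + z)) s, integral_add_left_eq_self, abs_of_pos hs,
    inv_smul_smul₀ hs.ne']

/-- In the variable `√(a n) (x - x₀)` the density is within `O(1/√n)` of the Gaussian one. Undoing
the scaling divides the variance by `a n` and the cubic constant, of order `1/√n`, by `(a n)^{3/2}`;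
hence the orders `1/n` and `1/n²`. -/
theorem Admissible.exists_hasCumulantExpansion {g h : ℝ → ℝ} (hgh : Admissible g h) :
    ∃ C c : ℝ, ∃ n₁ : ℕ, 0 < C ∧ 0 < c ∧ 1 ≤ n₁ ∧
      (∀ n : ℕ, 1 ≤ n → Measurable fun x => g x * Real.exp (-(n * h x))) ∧
      ∀ n : ℕ, n₁ ≤ n → Integrable (fun x => g x * Real.exp (-(n * h x))) ∧
        0 < ∫ x, g x * Real.exp (-(n * h x)) ∧
        ∃ M S : ℝ, c / n ≤ S ∧
          HasCumulantExpansion (densityCharFun fun x => g x * Real.exp (-(n * h x))) M S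
            (C / n ^ 2) (c * √n) ∧
          ∀ u : ℝ, ‖densityCharFun (fun x => g x * Real.exp (-(n * h x))) u‖ ≤
            Real.exp (-(c * min (u ^ 2 / n) 1)) := by
  obtain ⟨x₀, a, C, n₁, ha, hC, hg0, hn₁, hmeas, hlap⟩ := hgh.exists_laplace
  -- Normalization multiplies the error `C / √n` by 1000, and the result must be at most `1 /
  -- 80000`.
  obtain ⟨n₂, hn₂⟩ := exists_nat_ge ((80000000 * C) ^ 2)
  set c := min (1 / (8 * a)) (min (√a) (1 / 8)) with hc
  have hc1 : c ≤ 1 / (8 * a) := min_le_left _ _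
  have hc2 : c ≤ √a := (min_le_right _ _).trans (min_le_left _ _)
  have hc3 : c ≤ 1 / 8 := (min_le_right _ _).trans (min_le_right _ _)
  have hc0 : 0 < c := by positivity
  refine ⟨8000000 * C / √a ^ 3, c, max n₁ n₂, by positivity, hc0, hn₁.trans (le_max_left _ _),
    hmeas, fun n hn => ?_⟩
  have hn1 : 1 ≤ n := hn₁.trans ((le_max_left _ _).trans hn)
  have hnn₂ : (n₂ : ℝ) ≤ n := by exact_mod_cast (le_max_right _ _).trans hn
  have hn0 : (0 : ℝ) < n := by exact_mod_cast hn1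
  have hsqn : 0 < √(n : ℝ) := by positivity
  have hCn : C / √n ≤ 1 / 80000000 := by
    have : 80000000 * C ≤ √n := Real.le_sqrt_of_sq_le (hn₂.trans hnn₂)
    rw [div_le_div_iff₀ hsqn (by norm_num)]
    linarith
  set ρ : ℝ → ℝ := fun x => g x * Real.exp (-(n * h x)) with hρ
  set ρ₀ := g x₀ * Real.exp (-(n * h x₀)) with hρ₀
  have hρ₀0 : 0 < ρ₀ := by positivity
  set s := √(a * n) with hs
  have hs0 : 0 < s := by positivity
  have hs2 : s ^ 2 = a * n := Real.sq_sqrt (by positivity)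
  have hsn : s = √a * √n := Real.sqrt_mul ha.le _
  set F : ℝ → ℝ := fun y => ρ (x₀ + y / s) / ρ₀ with hF
  have hFm : Measurable F := ((hmeas n hn1).comp (by fun_prop)).div_const _
  have hFb := hlap n ((le_max_left _ _).trans hn)
  obtain ⟨hFi, hZ1, hfb⟩ := normalize_near_gaussian hFm.aestronglyMeasurable
    (hCn.trans (by norm_num)) hFb
  set Z := ∫ y, F y with hZ
  have hZ0 : 0 < Z := by linarith
  have hρF : ∀ y, ρ (x₀ + y / s) = ρ₀ * F y := fun y => by
    simp only [hF]; field_simp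
  have hρI : ∫ x, ρ x = s⁻¹ * (ρ₀ * Z) := by
    rw [integral_eq_inv_mul_integral_comp ρ x₀ hs0]
    simp_rw [hρF]
    rw [integral_const_mul, smul_eq_mul]
  have hρi : Integrable ρ := by
    have h1 := ((hFi.const_mul ρ₀).comp_mul_left' hs0.ne').comp_sub_right x₀
    refine h1.congr (.of_forall fun x => ?_)
    simp only
    rw [← hρF]
    congr 1
    field_simp
    ring
  have hρ0 : 0 < ∫ x, ρ x := by rw [hρI]; positivity
  refine ⟨hρi, hρ0, ?_⟩
  set f : ℝ → ℝ := fun y => F y / Z with hf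
  have hf1 : ∫ y, f y = 1 := by
    simp only [hf]
    rw [integral_div, div_self hZ0.ne']
  have hC0 : 0 ≤ C / √n := by positivity
  obtain ⟨M, S, hS, hcum, hdec⟩ := exists_hasCumulantExpansion_of_near_gaussian (f := f)
    (ε := 1000 * (C / √n)) (hFm.div_const _).aestronglyMeasurable (by positivity) (by linarith) hfb hf1
  have hchar : ∀ u : ℝ, densityCharFun ρ u = Complex.exp (u * x₀ * Complex.I) *
      ∫ y : ℝ, Complex.exp ((u / s : ℝ) * y * Complex.I) * f y := by
    intro u
    rw [densityCharFun, hρI, integral_eq_inv_mul_integral_comp _ x₀ hs0]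
    simp_rw [hρF]
    have e : ∀ y : ℝ, Complex.exp (u * (x₀ + y / s : ℝ) * Complex.I) * ((ρ₀ * F y : ℝ) : ℂ) =
        (ρ₀ * Z * Complex.exp (u * x₀ * Complex.I)) *
          (Complex.exp ((u / s : ℝ) * y * Complex.I) * f y) := by
      intro y
      have h1 : Complex.exp (u * (x₀ + y / s : ℝ) * Complex.I) = Complex.exp (u * x₀ * Complex.I) *
          Complex.exp ((u / s : ℝ) * y * Complex.I) := by
        rw [← Complex.exp_add]
        congr 1
        push_cast
        ring
      have hZc : (Z : ℂ) ≠ 0 := by exact_mod_cast hZ0.ne'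
      rw [h1]
      simp only [hf]
      push_cast
      field_simp
    simp_rw [e]
    rw [integral_const_mul, Complex.real_smul]
    have hZc : (Z : ℂ) ≠ 0 := by exact_mod_cast hZ0.ne'
    have hρc : (ρ₀ : ℂ) ≠ 0 := by exact_mod_cast hρ₀0.ne'
    have hsc : (s : ℂ) ≠ 0 := by exact_mod_cast hs0.ne'
    push_cast
    field_simp
  refine ⟨x₀ + M / s, S / s ^ 2, ?_, ?_, ?_⟩
  · rw [hs2, div_le_div_iff₀ hn0 (by positivity)]
    have h1 : c * a ≤ 1 / 8 := by
      calc c * a ≤ 1 / (8 * a) * a := by gcongr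
        _ = 1 / 8 := by field_simp
    nlinarith
  · intro u hu
    have hus : |u / s| ≤ 1 := by
      rw [abs_div, abs_of_pos hs0, div_le_one hs0, hsn]
      exact hu.trans (by gcongr)
    obtain ⟨r, hr, he⟩ := hcum (u / s) hus
    refine ⟨r, hr.trans (le_of_eq ?_), ?_⟩
    · rw [abs_div, abs_of_pos hs0, hsn]
      have : (n : ℝ) ^ 2 = √n ^ 4 := by
        have := Real.sq_sqrt hn0.le
        nth_rw 1 [← this]
        ring
      rw [this]
      field_simp
      ring
    · simp only at he
      rw [hchar, he, ← Complex.exp_add]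
      congr 1
      have hsc : (s : ℂ) ≠ 0 := by exact_mod_cast hs0.ne'
      push_cast
      field_simp
      ring
  · intro u
    have h1 := hdec (u / s)
    rw [hchar, norm_mul]
    have h2 : (u * x₀ * Complex.I : ℂ) = ((u * x₀ : ℝ) : ℂ) * Complex.I := by push_cast; ring
    rw [h2, Complex.norm_exp_ofReal_mul_I, one_mul]
    refine h1.trans (Real.exp_le_exp.2 (neg_le_neg ?_))
    rw [div_pow, hs2, le_div_iff₀ (by norm_num)]
    rcases le_total (u ^ 2 / (a * n)) 1 with h3 | h3
    · rw [min_eq_left h3]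
      calc c * min (u ^ 2 / n) 1 * 8 ≤ 1 / (8 * a) * (u ^ 2 / n) * 8 := by
            gcongr
            exact min_le_left _ _
        _ = u ^ 2 / (a * n) := by field_simp
    · rw [min_eq_right h3]
      calc c * min (u ^ 2 / n) 1 * 8 ≤ 1 / 8 * 1 * 8 := by
            gcongr
            exact min_le_right _ _
        _ = 1 := by norm_num

/-! ### Volume of a simplex through Gram–Schmidt -/

section SimplexVolume

open InnerProductSpace

variable {n p : ℕ}

lemma image_originSimplex {m : ℕ} (f : EuclideanSpace ℝ (Fin m) →ₗ[ℝ] EuclideanSpace ℝ (Fin n))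
    (v : Fin p → EuclideanSpace ℝ (Fin m)) :
    f '' originSimplex v = originSimplex (fun i => f (v i)) := by
  ext x
  constructor
  · rintro ⟨_, ⟨s, h0, h1, rfl⟩, rfl⟩
    exact ⟨s, h0, h1, by simp [map_sum]⟩
  · rintro ⟨s, h0, h1, rfl⟩
    exact ⟨_, ⟨s, h0, h1, rfl⟩, by simp [map_sum]⟩

/-- The standard simplex in `ℝᵖ`. -/
noncomputable def cornerSimplex (p : ℕ) : Set (EuclideanSpace ℝ (Fin p)) :=
  originSimplex fun i => (EuclideanSpace.basisFun (Fin p) ℝ).toBasis i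

lemma volume_cornerSimplex_ne_top (p : ℕ) : volume (cornerSimplex p) ≠ ⊤ := by
  have hsub : cornerSimplex p ⊆ Metric.closedBall 0 1 := by
    rintro _ ⟨s, h0, h1, rfl⟩
    rw [mem_closedBall_zero_iff]
    refine (norm_sum_le _ _).trans (le_trans (le_of_eq ?_) h1)
    refine Finset.sum_congr rfl fun i _ => ?_
    rw [norm_smul, Real.norm_of_nonneg (h0 i)]
    simp
  exact measure_ne_top_of_subset hsub measure_closedBall_lt_top.ne

lemma volume_cornerSimplex_ne_zero (p : ℕ) : volume (cornerSimplex p) ≠ 0 := by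
  have hopen : IsOpen {x : EuclideanSpace ℝ (Fin p) | (∀ i, 0 < x i) ∧ ∑ i, x i < 1} := by
    apply IsOpen.and
    · simp only [Set.ofPred_forall]
      exact isOpen_iInter_of_finite fun i => isOpen_lt continuous_const (by fun_prop)
    · exact isOpen_lt (by fun_prop) continuous_const
  have hne : {x : EuclideanSpace ℝ (Fin p) | (∀ i, 0 < x i) ∧ ∑ i, x i < 1}.Nonempty := by
    refine ⟨WithLp.toLp 2 fun _ => 1 / (p + 1 : ℝ), fun i => ?_, ?_⟩
    · simp only
      positivity
    · simp only [Finset.sum_const, Finset.card_univ, Fintype.card_fin, nsmul_eq_mul, mul_one_div]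
      rw [div_lt_one (by positivity)]
      linarith
  have hsub : {x : EuclideanSpace ℝ (Fin p) | (∀ i, 0 < x i) ∧ ∑ i, x i < 1} ⊆ cornerSimplex p := by
    rintro x ⟨h0, h1⟩
    refine ⟨fun i => x i, fun i => (h0 i).le, h1.le, ?_⟩
    have := (EuclideanSpace.basisFun (Fin p) ℝ).sum_repr x
    simpa using this.symm
  exact ((hopen.measure_pos volume hne).trans_le (measure_mono hsub)).ne'

/-- The QR decomposition: an isometry sends the standard basis to the normalized Gram–Schmidt
vectors, and the triangular factor has their lengths on its diagonal. -/
lemma exists_linearMap_of_gramSchmidt {y : Fin p → EuclideanSpace ℝ (Fin n)}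
    (hy : LinearIndependent ℝ y) :
    ∃ (J : EuclideanSpace ℝ (Fin p) →ₗᵢ[ℝ] EuclideanSpace ℝ (Fin n))
      (T : EuclideanSpace ℝ (Fin p) →ₗ[ℝ] EuclideanSpace ℝ (Fin p)),
      LinearMap.det T = ∏ i, ‖gramSchmidt ℝ y i‖ ∧
      ∀ i, J (T ((EuclideanSpace.basisFun (Fin p) ℝ).toBasis i)) = y i := by
  set b := (EuclideanSpace.basisFun (Fin p) ℝ).toBasis with hb
  have hbo : Orthonormal ℝ b := by
    rw [hb, OrthonormalBasis.coe_toBasis]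
    exact (EuclideanSpace.basisFun (Fin p) ℝ).orthonormal
  set J₀ := b.constr ℝ (gramSchmidtNormed ℝ y) with hJ₀
  have hJb : ∀ i, J₀ (b i) = gramSchmidtNormed ℝ y i := fun i => b.constr_basis ℝ _ i
  have hJo : Orthonormal ℝ (J₀ ∘ b) := by
    have : J₀ ∘ b = gramSchmidtNormed ℝ y := funext hJb
    rw [this]
    exact gramSchmidtNormed_orthonormal hy
  set A : Matrix (Fin p) (Fin p) ℝ := fun i j =>
    if i = j then ‖gramSchmidt ℝ y j‖ else
      if i < j then inner ℝ (gramSchmidt ℝ y i) (y j) / ‖gramSchmidt ℝ y i‖ else 0 with hA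
  refine ⟨J₀.isometryOfOrthonormal hbo hJo, Matrix.toLin b b A, ?_, fun j => ?_⟩
  · rw [LinearMap.det_toLin, Matrix.det_of_isUpperTriangular]
    · simp [hA]
    · intro i j hij
      have h1 : j < i := hij
      simp [hA, h1.ne', h1.not_gt]
  · have hne : ∀ i, ‖gramSchmidt ℝ y i‖ ≠ 0 := fun i => norm_ne_zero_iff.2 (gramSchmidt_ne_zero i hy)
    rw [LinearMap.coe_isometryOfOrthonormal, Matrix.toLin_self, map_sum]
    simp_rw [map_smul, hJb]
    rw [gramSchmidt_def'' ℝ y j, ← Finset.add_sum_erase _ _ (Finset.mem_univ j)]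
    congr 1
    · simp only [hA, if_true, gramSchmidtNormed]
      rw [smul_smul]
      have := hne j
      simp [this]
    · rw [← Finset.sum_subset (s₁ := Finset.Iio j)]
      · refine Finset.sum_congr rfl fun i hi => ?_
        have hij : i < j := Finset.mem_Iio.1 hi
        simp only [hA, hij.ne, hij, if_false, if_true, gramSchmidtNormed]
        rw [smul_smul]
        congr 1
        have := hne i
        simp only [RCLike.ofReal_real_eq_id, id_eq]
        field_simp
      · intro i hi
        simp [(Finset.mem_Iio.1 hi).ne]
      · intro i hi hi'
        have h1 : i ≠ j := Finset.ne_of_mem_erase hi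
        simp only [Finset.mem_Iio] at hi'
        simp [hA, h1, hi']

/-- The volume of a simplex as the product of the norms of the Gram–Schmidt vectors. -/
theorem euclideanHausdorffMeasure_originSimplex {y : Fin p → EuclideanSpace ℝ (Fin n)}
    (hy : LinearIndependent ℝ y) :
    Measure.euclideanHausdorffMeasure p (originSimplex y) =
      ENNReal.ofReal (∏ i, ‖gramSchmidt ℝ y i‖) * volume (cornerSimplex p) := by
  obtain ⟨J, T, hdet, hJT⟩ := exists_linearMap_of_gramSchmidt hy
  have h1 : originSimplex y = J '' (T '' cornerSimplex p) := by
    rw [cornerSimplex, image_originSimplex T]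
    have := image_originSimplex J.toLinearMap
      (fun i => T ((EuclideanSpace.basisFun (Fin p) ℝ).toBasis i))
    simp only [LinearIsometry.coe_toLinearMap] at this
    rw [this]
    congr with i
    rw [hJT]
  rw [h1, J.isometry.euclideanHausdorffMeasure_image,
    EuclideanSpace.euclideanHausdorffMeasure_eq_volume, Measure.addHaar_image_linearMap, hdet,
    abs_of_nonneg (Finset.prod_nonneg fun _ _ => norm_nonneg _)]

theorem logVolSimplex_eq {y : Fin p → EuclideanSpace ℝ (Fin n)} (hy : LinearIndependent ℝ y) :
    logVolSimplex y = ∑ i, Real.log ‖gramSchmidt ℝ y i‖ +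
      Real.log (volume (cornerSimplex p)).toReal := by
  rw [logVolSimplex, euclideanHausdorffMeasure_originSimplex hy, ENNReal.toReal_mul,
    ENNReal.toReal_ofReal (Finset.prod_nonneg fun _ _ => norm_nonneg _), Real.log_mul, Real.log_prod]
  · exact fun i _ => norm_ne_zero_iff.2 (gramSchmidt_ne_zero i hy)
  · exact Finset.prod_ne_zero_iff.2 fun i _ => norm_ne_zero_iff.2 (gramSchmidt_ne_zero i hy)
  · exact ENNReal.toReal_ne_zero.2 ⟨volume_cornerSimplex_ne_zero p, volume_cornerSimplex_ne_top p⟩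

end SimplexVolume

/-! ### Polar coordinates and the distance to a subspace -/

section PolarCoordinates

open Metric Measure Module

variable {E : Type*} [NormedAddCommGroup E] [MeasurableSpace E] [BorelSpace E]

/-- Polar coordinates for the product of a radial function and a function that is homogeneous of
imaginary degree. -/
lemma integral_norm_mul_of_homogeneous [NormedSpace ℝ E] [FiniteDimensional ℝ E] [Nontrivial E]
    (μ : Measure E) [μ.IsAddHaarMeasure] (f : ℝ → ℂ) (F : E → ℂ) (u : ℝ)
    (hF : ∀ r : ℝ, 0 < r → ∀ x, F (r • x) = Complex.exp (u * Real.log r * Complex.I) * F x) :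
    ∫ x, f ‖x‖ * F x ∂μ = (∫ ω, F ω ∂μ.toSphere) *
      ∫ r in Ioi (0 : ℝ), (r : ℂ) ^ (finrank ℝ E - 1) *
        (f r * Complex.exp (u * Real.log r * Complex.I)) :=
  calc
    ∫ x, f ‖x‖ * F x ∂μ = ∫ x : ({(0)}ᶜ : Set E), f (‖x.1‖) * F x ∂(μ.comap (↑)) := by
      rw [integral_subtype_comap (measurableSet_singleton _).compl fun x ↦ f (‖x‖) * F x,
        restrict_compl_singleton]
    _ = ∫ z, F z.1 * (f z.2 * Complex.exp (u * Real.log z.2 * Complex.I))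
          ∂μ.toSphere.prod (.volumeIoiPow (finrank ℝ E - 1)) := by
      rw [← μ.measurePreserving_homeomorphUnitSphereProd.integral_comp
        (Homeomorph.measurableEmbedding _)]
      refine integral_congr_ae (.of_forall fun x => ?_)
      have hx : 0 < ‖(x : E)‖ := norm_pos_iff.2 x.2
      have h := hF _ hx (homeomorphUnitSphereProd E x).1
      simp only [homeomorphUnitSphereProd_apply_fst_coe, smul_inv_smul₀ hx.ne'] at h
      simp only [homeomorphUnitSphereProd_apply_fst_coe, homeomorphUnitSphereProd_apply_snd_coe]
      rw [h]
      ring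
    _ = (∫ ω, F ω ∂μ.toSphere) * ∫ r : Ioi (0 : ℝ),
          f r * Complex.exp (u * Real.log r * Complex.I) ∂.volumeIoiPow (finrank ℝ E - 1) :=
      integral_prod_mul (fun ω : sphere (0 : E) 1 => F ω)
        (fun r : Ioi (0 : ℝ) => f r * Complex.exp (u * Real.log r * Complex.I))
    _ = _ := by
      congr 1
      simp only [Measure.volumeIoiPow, ENNReal.ofReal]
      rw [integral_withDensity_eq_integral_smul,
        integral_subtype_comap measurableSet_Ioi fun a ↦ Real.toNNReal (a ^ (finrank ℝ E - 1)) •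
          (f a * Complex.exp (u * Real.log a * Complex.I)),
        setIntegral_congr_fun measurableSet_Ioi fun x hx ↦ ?_]
      · rw [NNReal.smul_def, Real.coe_toNNReal _ (pow_nonneg hx.out.le _), Complex.real_smul]
        push_cast
        rfl
      · exact (measurable_subtype_coe.pow_const _).real_toNNReal

/-- The Mellin transform of a Gaussian. -/
lemma integral_pow_mul_exp_neg_sq_mul_exp_log (d : ℕ) (hd : 1 ≤ d) (u : ℝ) :
    ∫ r in Ioi (0 : ℝ), (r : ℂ) ^ (d - 1) *
        (Complex.exp (-(r : ℂ) ^ 2) * Complex.exp (u * Real.log r * Complex.I)) =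
      1 / 2 * Complex.Gamma ((d / 2 : ℝ) + (u / 2 : ℝ) * Complex.I) := by
  have hre : 0 < (((d / 2 : ℝ) : ℂ) + (u / 2 : ℝ) * Complex.I).re := by
    simp
    omega
  rw [Complex.Gamma_eq_integral hre, Complex.GammaIntegral,
    ← integral_comp_rpow_Ioi (fun x : ℝ => (Real.exp (-x) : ℂ) *
      (x : ℂ) ^ (((d / 2 : ℝ) : ℂ) + (u / 2 : ℝ) * Complex.I - 1)) two_ne_zero, ← integral_const_mul]
  refine setIntegral_congr_fun measurableSet_Ioi fun r (hr : 0 < r) => ?_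
  have h1 : (r : ℂ) = Complex.exp (Real.log r) := by
    rw [← Complex.ofReal_exp, Real.exp_log hr]
  have h2 : ((r ^ (2 : ℝ) : ℝ) : ℂ) ≠ 0 := by
    exact Complex.ofReal_ne_zero.2 (Real.rpow_pos_of_pos hr _).ne'
  have h3 : ((r ^ (2 : ℝ) : ℝ) : ℂ) = (r : ℂ) ^ 2 := by simp
  have h4 : (|(2 : ℝ)| * r ^ ((2 : ℝ) - 1)) = 2 * r := by norm_num
  rw [h4, Complex.real_smul, Complex.cpow_def_of_ne_zero h2, ← Complex.ofReal_log (by positivity),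
    Real.log_rpow hr, Complex.ofReal_exp, Complex.ofReal_neg, h3]
  have h5 : ((2 * r : ℝ) : ℂ) = 2 * Complex.exp (Real.log r) := by rw [← h1]; push_cast; ring
  have h6 : (r : ℂ) ^ (d - 1) = Complex.exp ((d - 1) * Real.log r) := by
    rw [h1, ← Complex.exp_nat_mul, Nat.cast_sub hd, Nat.cast_one]
  rw [h5, h6]
  have h7 : Complex.exp ((d - 1) * Real.log r) * Complex.exp (u * Real.log r * Complex.I) =
      Complex.exp (Real.log r) * Complex.exp (((2 * Real.log r : ℝ) : ℂ) *
        (((d / 2 : ℝ) : ℂ) + (u / 2 : ℝ) * Complex.I - 1)) := by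
    rw [← Complex.exp_add, ← Complex.exp_add]
    congr 1
    push_cast
    ring
  linear_combination Complex.exp (-(r : ℂ) ^ 2) * h7

end PolarCoordinates

section DistanceToSubspace

open Metric Measure Module

variable {E : Type*} [NormedAddCommGroup E] [MeasurableSpace E] [BorelSpace E]
  [InnerProductSpace ℝ E] [FiniteDimensional ℝ E]

open Classical in
/-- The function `x ↦ d(x, V)^{iu}`, with the value `0` on `V`. -/
noncomputable def distPow {E : Type*} [NormedAddCommGroup E] [InnerProductSpace ℝ E]
    [FiniteDimensional ℝ E] (V : Submodule ℝ E) (u : ℝ) (x : E) : ℂ :=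
  if ‖Vᗮ.orthogonalProjectionOnto x‖ = 0 then 0 else
    Complex.exp (u * Real.log ‖Vᗮ.orthogonalProjectionOnto x‖ * Complex.I)

/-- The value 0 on `V` makes the homogeneity hold at every point; the bare exponential would be 1
there, as `Real.log 0 = 0`, and would not scale. -/
lemma distPow_smul {E : Type*} [NormedAddCommGroup E] [InnerProductSpace ℝ E]
    [FiniteDimensional ℝ E] (V : Submodule ℝ E) (u : ℝ) {r : ℝ} (hr : 0 < r) (x : E) :
    distPow V u (r • x) = Complex.exp (u * Real.log r * Complex.I) * distPow V u x := by
  rw [distPow, distPow, map_smul, norm_smul, Real.norm_of_nonneg hr.le]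
  by_cases h : ‖Vᗮ.orthogonalProjectionOnto x‖ = 0
  · simp [h]
  · rw [if_neg (mul_ne_zero hr.ne' h), if_neg h, Real.log_mul hr.ne' h, ← Complex.exp_add]
    congr 1
    push_cast
    ring

lemma distPow_ae_eq (V : Submodule ℝ E) (hV : V ≠ ⊤) (u : ℝ) :
    ∀ᵐ x : E, distPow V u x =
      Complex.exp (u * Real.log ‖Vᗮ.orthogonalProjectionOnto x‖ * Complex.I) := by
  have h : (volume : Measure E) V = 0 := addHaar_submodule _ V hV
  filter_upwards [compl_mem_ae_iff.2 h] with x hx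
  rw [distPow, if_neg]
  rw [norm_eq_zero, Submodule.orthogonalProjectionOnto_eq_zero_iff, Submodule.orthogonal_orthogonal]
  exact hx

/-- The integral of `e^{-‖x‖²} d(x, V)^{iu}` is computed in two ways: in polar coordinates of `E`,
and by splitting `E` into `V` and `Vᗮ` and using polar coordinates of `Vᗮ`. The constant is the same
for all `u`, so it may stay unknown and cancel against `u = 0`. -/
lemma exists_integral_sphere_distPow_mul_Gamma (V : Submodule ℝ E) (hV : V ≠ ⊤) :
    ∃ κ : ℂ, ∀ u : ℝ, (∫ ω, distPow V u ω ∂(volume : Measure E).toSphere) *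
      Complex.Gamma ((finrank ℝ E / 2 : ℝ) + (u / 2 : ℝ) * Complex.I) =
        κ * Complex.Gamma ((finrank ℝ Vᗮ / 2 : ℝ) + (u / 2 : ℝ) * Complex.I) := by
  have hpos : 0 < finrank ℝ Vᗮ := by
    have := V.finrank_add_finrank_orthogonal
    have h2 := Submodule.finrank_lt hV
    omega
  have : Nontrivial Vᗮ := finrank_pos_iff.1 hpos
  have : Nontrivial E := Subtype.val_injective (p := (· ∈ Vᗮ)).nontrivial
  refine ⟨(∫ a : V, Complex.exp (-(‖a‖ : ℂ) ^ 2)) *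
    (∫ _ω, (1 : ℂ) ∂(volume : Measure Vᗮ).toSphere), fun u => ?_⟩
  have h1 := integral_norm_mul_of_homogeneous (volume : Measure E)
    (fun r => Complex.exp (-(r : ℂ) ^ 2)) (distPow V u) u (fun r hr x => distPow_smul V u hr x)
  rw [integral_pow_mul_exp_neg_sq_mul_exp_log _ finrank_pos] at h1
  let F : Vᗮ → ℂ := fun b => if ‖b‖ = 0 then 0 else
    Complex.exp (u * Real.log ‖b‖ * Complex.I)
  let D : Vᗮ → ℂ := fun b => Complex.exp (u * Real.log ‖b‖ * Complex.I)
  have h2 : ∫ x : E, Complex.exp (-(‖x‖ : ℂ) ^ 2) * distPow V u x =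
      (∫ a : V, Complex.exp (-(‖a‖ : ℂ) ^ 2)) *
        ∫ b : Vᗮ, Complex.exp (-(‖b‖ : ℂ) ^ 2) * F b := by
    rw [← integral_prod_mul]
    have hmp := V.measurePreserving_measurableEquivProd (0 : E)
    rw [InnerProductSpace.euclideanHausdorffMeasure_eq_volume] at hmp
    rw [← Measure.volume_eq_prod, ← hmp.integral_comp (MeasurableEquiv.measurableEmbedding _)]
    refine integral_congr_ae (.of_forall fun x => ?_)
    simp only [Submodule.measurableEquivProd_apply, vsub_eq_sub, sub_zero, F, distPow]
    rw [← mul_assoc, ← Complex.exp_add]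
    congr 2
    have := V.norm_sq_eq_add_norm_sq_projection x
    simp only [Submodule.coe_norm] at *
    rw [← neg_add]
    congr 1
    exact_mod_cast this
  have h3 := integral_norm_mul_of_homogeneous (volume : Measure Vᗮ)
    (fun r => Complex.exp (-(r : ℂ) ^ 2) * Complex.exp (u * Real.log r * Complex.I))
    (fun _ => 1) 0 (by simp)
  have h4 : ∫ b : Vᗮ, Complex.exp (-(‖b‖ : ℂ) ^ 2) * F b =
      ∫ b : Vᗮ, Complex.exp (-(‖b‖ : ℂ) ^ 2) *
        Complex.exp (u * Real.log ‖b‖ * Complex.I) * 1 := by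
    have h0 : ∀ᵐ b : Vᗮ, b ≠ 0 := by
      simp [ae_iff]
    refine integral_congr_ae ?_
    filter_upwards [h0] with b hb
    simp [F, hb]
  simp only [Complex.ofReal_zero, zero_mul, Complex.exp_zero, mul_one] at h3 h4
  rw [integral_pow_mul_exp_neg_sq_mul_exp_log _ hpos] at h3
  rw [h2, h4, h3] at h1
  linear_combination -2 * h1

end DistanceToSubspace

/-! ### Radial laws and their log-distances -/

section RadialLaw

open Metric Measure Module

lemma integral_Ioi_eq_integral_exp_smul {F : Type*} [NormedAddCommGroup F] [NormedSpace ℝ F]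
    (φ : ℝ → F) : ∫ r in Ioi (0 : ℝ), φ r = ∫ x, Real.exp x • φ (Real.exp x) := by
  have h := integral_image_eq_integral_abs_deriv_smul MeasurableSet.univ
    (fun x _ => (Real.hasDerivAt_exp x).hasDerivWithinAt) Real.exp_injective.injOn φ
  rw [image_univ, Real.range_exp] at h
  simpa [abs_of_pos, Real.exp_pos] using h

lemma integrableOn_Ioi_iff_integrable_exp_smul {F : Type*} [NormedAddCommGroup F]
    [NormedSpace ℝ F] (φ : ℝ → F) :
    IntegrableOn φ (Ioi 0) ↔ Integrable fun x => Real.exp x • φ (Real.exp x) := by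
  have h := integrableOn_image_iff_integrableOn_abs_deriv_smul MeasurableSet.univ
    (fun x _ => (Real.hasDerivAt_exp x).hasDerivWithinAt) Real.exp_injective.injOn φ
  rw [image_univ, Real.range_exp] at h
  simpa [abs_of_pos, Real.exp_pos] using h

variable {G H : ℝ → ℝ} {n : ℕ}

/-- The density, up to normalization, of the logarithm of the norm under `radialLaw G H n`. -/
noncomputable def logRadialDensity (G H : ℝ → ℝ) (n : ℕ) (x : ℝ) : ℝ :=
  G (Real.exp x) * Real.exp (-(n * (H (Real.exp x) - x)))

/-- The Jacobians of polar coordinates and of `r = e^x` combine to `e^{nx}`, which turns `H` into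
`H(e^x) - x`: the reason for the shape of radial admissibility. -/
lemma exp_mul_exp_pow_mul (hn : 1 ≤ n) (x : ℝ) :
    Real.exp x * (Real.exp x ^ (n - 1) * (G (Real.exp x) * Real.exp (-(n * H (Real.exp x))))) =
      logRadialDensity G H n x := by
  have h : Real.exp x * Real.exp x ^ (n - 1) = Real.exp (n * x) := by
    rw [← pow_succ', Nat.sub_add_cancel hn, ← Real.exp_nat_mul]
  rw [logRadialDensity, mul_sub, neg_sub, sub_eq_add_neg, Real.exp_add, ← h]
  ring

lemma nontrivial_euclideanSpace (hn : 1 ≤ n) : Nontrivial (EuclideanSpace ℝ (Fin n)) :=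
  finrank_pos_iff (R := ℝ).1 (by rw [finrank_euclideanSpace_fin]; omega)

lemma integrable_radial (hn : 1 ≤ n) (hρ : Integrable (logRadialDensity G H n)) :
    Integrable fun s : EuclideanSpace ℝ (Fin n) => G ‖s‖ * Real.exp (-(n * H ‖s‖)) := by
  have := nontrivial_euclideanSpace hn
  rw [integrable_fun_norm_addHaar volume (f := fun r => G r * Real.exp (-(n * H r))),
    integrableOn_Ioi_iff_integrable_exp_smul, finrank_euclideanSpace_fin]
  refine hρ.congr (.of_forall fun x => ?_)
  simp only [smul_eq_mul]
  rw [exp_mul_exp_pow_mul hn]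

lemma lintegral_radialWeight (hn : 1 ≤ n) (hG : ∀ x, 0 ≤ G (Real.exp x))
    (hρ : Integrable (logRadialDensity G H n)) :
    ∫⁻ s, radialWeight G H n s =
      ENNReal.ofReal (n • volume.real (ball (0 : EuclideanSpace ℝ (Fin n)) 1) •
        ∫ x, logRadialDensity G H n x) := by
  have := nontrivial_euclideanSpace hn
  have hpos : 0 ≤ᵐ[volume] fun s : EuclideanSpace ℝ (Fin n) =>
      G ‖s‖ * Real.exp (-(n * H ‖s‖)) := by
    have h0 : ∀ᵐ s : EuclideanSpace ℝ (Fin n), s ≠ 0 := by simp [ae_iff]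
    filter_upwards [h0] with s hs
    have := hG (Real.log ‖s‖)
    rw [Real.exp_log (norm_pos_iff.2 hs)] at this
    simp only [Pi.zero_apply]
    positivity
  unfold radialWeight
  rw [← ofReal_integral_eq_lintegral_ofReal (integrable_radial hn hρ) hpos,
    integral_fun_norm_addHaar volume (fun r => G r * Real.exp (-(n * H r))),
    integral_Ioi_eq_integral_exp_smul, finrank_euclideanSpace_fin]
  congr 4
  ext x
  simp only [smul_eq_mul]
  rw [exp_mul_exp_pow_mul hn]

lemma lintegral_radialWeight_ne (hn : 1 ≤ n) (hG : ∀ x, 0 ≤ G (Real.exp x))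
    (hρ : Integrable (logRadialDensity G H n)) (hρ0 : 0 < ∫ x, logRadialDensity G H n x) :
    ∫⁻ s, radialWeight G H n s ≠ 0 ∧ ∫⁻ s, radialWeight G H n s ≠ ⊤ := by
  have := nontrivial_euclideanSpace hn
  rw [lintegral_radialWeight hn hG hρ]
  refine ⟨?_, ENNReal.ofReal_ne_top⟩
  rw [Ne, ENNReal.ofReal_eq_zero, not_le, nsmul_eq_mul, smul_eq_mul]
  have h1 : 0 < volume.real (ball (0 : EuclideanSpace ℝ (Fin n)) 1) :=
    ENNReal.toReal_pos (measure_ball_pos _ _ one_pos).ne' measure_ball_lt_top.ne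
  have h2 : (0 : ℝ) < n := by exact_mod_cast hn
  positivity

theorem isProbabilityMeasure_radialLaw (hn : 1 ≤ n) (hG : ∀ x, 0 ≤ G (Real.exp x))
    (hρ : Integrable (logRadialDensity G H n)) (hρ0 : 0 < ∫ x, logRadialDensity G H n x) :
    IsProbabilityMeasure (radialLaw G H n) := by
  obtain ⟨h0, h1⟩ := lintegral_radialWeight_ne hn hG hρ hρ0
  constructor
  rw [radialLaw, Measure.smul_apply, withDensity_apply _ MeasurableSet.univ, Measure.restrict_univ,
    smul_eq_mul, ENNReal.inv_mul_cancel h0 h1]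

lemma radialLaw_absolutelyContinuous : radialLaw G H n ≪ volume :=
  (withDensity_absolutelyContinuous _ _).smul_left _

/-- By homogeneity the integral separates into a spherical factor, free of `G` and `H`, and a radial
factor, free of `V`. -/
lemma integral_distPow_radialLaw_eq_mul (hn : 1 ≤ n) (hG : ∀ x, 0 ≤ G (Real.exp x))
    (hρ : Integrable (logRadialDensity G H n)) (V : Submodule ℝ (EuclideanSpace ℝ (Fin n)))
    (u : ℝ) :
    ∫ x, distPow V u x ∂(radialLaw G H n) =
      (∫⁻ s, radialWeight G H n s)⁻¹.toReal *
      ((∫ ω, distPow V u ω ∂(volume : Measure (EuclideanSpace ℝ (Fin n))).toSphere) *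
        ∫ x : ℝ, Complex.exp (u * x * Complex.I) * logRadialDensity G H n x) := by
  have := nontrivial_euclideanSpace hn
  have hm : AEMeasurable (radialWeight G H n) :=
    (integrable_radial hn hρ).aemeasurable.ennreal_ofReal
  rw [radialLaw, integral_smul_measure,
    integral_withDensity_eq_integral_toReal_smul₀ hm (.of_forall fun _ => ENNReal.ofReal_lt_top),
    Complex.real_smul]
  congr 1
  have h0 : ∀ᵐ s : EuclideanSpace ℝ (Fin n), s ≠ 0 := by simp [ae_iff]
  have h1 : ∫ x, (radialWeight G H n x).toReal • distPow V u x =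
      ∫ x : EuclideanSpace ℝ (Fin n),
        (fun r : ℝ => ((G r * Real.exp (-(n * H r)) : ℝ) : ℂ)) ‖x‖ * distPow V u x := by
    refine integral_congr_ae ?_
    filter_upwards [h0] with s hs
    have := hG (Real.log ‖s‖)
    rw [Real.exp_log (norm_pos_iff.2 hs)] at this
    rw [radialWeight, ENNReal.toReal_ofReal (by positivity), Complex.real_smul]
  rw [h1, integral_norm_mul_of_homogeneous volume
    (fun r : ℝ => ((G r * Real.exp (-(n * H r)) : ℝ) : ℂ)) (distPow V u) u
    (fun r hr x => distPow_smul V u hr x), integral_Ioi_eq_integral_exp_smul,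
    finrank_euclideanSpace_fin]
  congr 2
  ext x
  rw [← exp_mul_exp_pow_mul hn, Complex.real_smul, Real.log_exp]
  push_cast
  ring

/-- The characteristic function of the logarithm of the distance to a subspace. -/
theorem integral_distPow_radialLaw (hn : 1 ≤ n) (hG : ∀ x, 0 ≤ G (Real.exp x))
    (hρ : Integrable (logRadialDensity G H n)) (hρ0 : 0 < ∫ x, logRadialDensity G H n x)
    (V : Submodule ℝ (EuclideanSpace ℝ (Fin n))) (hV : V ≠ ⊤) (u : ℝ) :
    ∫ x, distPow V u x ∂(radialLaw G H n) =
      densityCharFun (logRadialDensity G H n) u *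
        gammaQuotient (finrank ℝ Vᗮ / 2) (n / 2) (u / 2) := by
  have hprob := isProbabilityMeasure_radialLaw hn hG hρ hρ0
  have hR0 : ((∫ x, logRadialDensity G H n x : ℝ) : ℂ) ≠ 0 := by exact_mod_cast hρ0.ne'
  have hmul := integral_distPow_radialLaw_eq_mul hn hG hρ V
  -- At `u = 0` the integral is the total mass 1, which determines the product of all normalizing
  -- constants.
  have h0 := hmul 0
  have h00 : ∫ x, distPow V 0 x ∂(radialLaw G H n) = 1 := by
    rw [integral_congr_ae (radialLaw_absolutelyContinuous.ae_le (distPow_ae_eq V hV 0))]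
    simp
  rw [h00] at h0
  simp only [Complex.ofReal_zero, zero_mul, Complex.exp_zero, one_mul] at h0
  rw [integral_complex_ofReal] at h0
  obtain ⟨κ, hκ⟩ := exists_integral_sphere_distPow_mul_Gamma V hV
  have hκ0 := hκ 0
  have hκu := hκ u
  have hd : 0 < finrank ℝ Vᗮ := by
    have := V.finrank_add_finrank_orthogonal
    have h2 := Submodule.finrank_lt hV
    omega
  have hΓ : ∀ k : ℕ, 0 < k → ∀ v : ℝ,
      Complex.Gamma (((k / 2 : ℝ) : ℂ) + (v : ℝ) * Complex.I) ≠ 0 := by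
    intro k hk v
    refine Complex.Gamma_ne_zero_of_re_pos ?_
    simpa using hk
  rw [finrank_euclideanSpace_fin] at hκ0 hκu
  have e1 := hΓ n hn (u / 2)
  have e2 := hΓ _ hd 0
  have e3 := hΓ n hn 0
  simp only [zero_div, Complex.ofReal_zero, zero_mul, add_zero] at hκ0 e2 e3
  rw [hmul u, densityCharFun, gammaQuotient]
  generalize (∫ ω, distPow V u ω ∂(volume : Measure (EuclideanSpace ℝ (Fin n))).toSphere) = Au at *
  generalize (∫ ω, distPow V 0 ω ∂(volume : Measure (EuclideanSpace ℝ (Fin n))).toSphere) = A0 at *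
  generalize ((∫⁻ s, radialWeight G H n s)⁻¹.toReal : ℂ) = z at *
  generalize (∫ x : ℝ, Complex.exp (u * x * Complex.I) * logRadialDensity G H n x) = Ru at *
  generalize ((∫ x, logRadialDensity G H n x : ℝ) : ℂ) = R0 at *
  generalize Complex.Gamma (((n / 2 : ℝ) : ℂ) + ((u / 2 : ℝ) : ℂ) * Complex.I) = Γnu at *
  generalize Complex.Gamma (((finrank ℝ Vᗮ / 2 : ℝ) : ℂ) + ((u / 2 : ℝ) : ℂ) * Complex.I) = Γdu at *
  generalize Complex.Gamma ((n / 2 : ℝ) : ℂ) = Γn at *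
  generalize Complex.Gamma ((finrank ℝ Vᗮ / 2 : ℝ) : ℂ) = Γd at *
  rw [div_mul_div_comm, eq_div_iff (mul_ne_zero hR0 (mul_ne_zero e2 e1))]
  linear_combination z * R0 * Ru * Γd * hκu - z * R0 * Ru * Γdu * hκ0 - Ru * Γdu * Γn * h0

end RadialLaw

/-! ### Gram–Schmidt norms of independent vectors -/

section GramSchmidt

open InnerProductSpace Module

variable {E : Type*} [NormedAddCommGroup E] [InnerProductSpace ℝ E] {p : ℕ}

lemma gramSchmidt_snoc_castSucc (w : Fin p → E) (x : E) (i : Fin p) :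
    gramSchmidt ℝ (Fin.snoc w x : Fin (p + 1) → E) i.castSucc = gramSchmidt ℝ w i := by
  induction i using WellFoundedLT.induction with
  | ind i ih =>
    rw [gramSchmidt_def, gramSchmidt_def ℝ w, ← Fin.map_castSuccEmb_Iio, Finset.sum_map,
      Fin.snoc_castSucc]
    congr 1
    refine Finset.sum_congr rfl fun j hj => ?_
    rw [Fin.coe_castSuccEmb, ih j (Finset.mem_Iio.1 hj)]

/-- The last Gram–Schmidt vector is the component of `x` orthogonal to the span of the earlier
vectors, so its norm is a distance to that span. -/
lemma norm_gramSchmidt_snoc_last [FiniteDimensional ℝ E] (w : Fin p → E) (x : E) :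
    ‖gramSchmidt ℝ (Fin.snoc w x : Fin (p + 1) → E) (Fin.last p)‖ =
      ‖(Submodule.span ℝ (range w))ᗮ.orthogonalProjectionOnto x‖ := by
  set y : Fin (p + 1) → E := Fin.snoc w x with hy
  have himg : y '' Iio (Fin.last p) = range w := by
    ext z
    constructor
    · rintro ⟨i, hi, rfl⟩
      obtain ⟨j, rfl⟩ := Fin.exists_castSucc_eq.2 (ne_of_lt hi)
      exact ⟨j, by simp [hy]⟩
    · rintro ⟨j, rfl⟩
      exact ⟨j.castSucc, Fin.castSucc_lt_last j, by simp [hy]⟩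
  have hspan := span_gramSchmidt_Iio ℝ y (Fin.last p)
  rw [himg] at hspan
  have hx : y (Fin.last p) = x := by simp [hy]
  have h : (Submodule.span ℝ (range w)).starProjection x =
      x - gramSchmidt ℝ y (Fin.last p) := by
    apply Submodule.eq_starProjection_of_mem_of_inner_eq_zero
    · have h1 := gramSchmidt_def' ℝ y (Fin.last p)
      rw [hx] at h1
      nth_rewrite 1 [h1]
      rw [add_sub_cancel_left, ← hspan]
      refine Submodule.sum_mem _ fun i hi => ?_
      refine Submodule.span_mono ?_ (Submodule.starProjection_apply_mem _ x)
      rintro _ rfl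
      exact ⟨i, Finset.mem_Iio.1 hi, rfl⟩
    · rw [← hspan]
      intro z hz
      rw [sub_sub_cancel]
      induction hz using Submodule.span_induction with
      | mem z hz =>
        obtain ⟨i, hi, rfl⟩ := hz
        exact gramSchmidt_orthogonal ℝ y (ne_of_gt hi)
      | zero => simp
      | add a b _ _ ha hb => rw [inner_add_right, ha, hb, add_zero]
      | smul c a _ ha => rw [inner_smul_right, ha, mul_zero]
  have h2 : ((Submodule.span ℝ (range w))ᗮ.orthogonalProjectionOnto x : E) =
      gramSchmidt ℝ y (Fin.last p) := by
    rw [Submodule.coe_orthogonalProjectionOnto_apply, Submodule.starProjection_orthogonal_val, h,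
      sub_sub_cancel]
  rw [← h2, Submodule.coe_norm]

lemma measurable_gramSchmidt [FiniteDimensional ℝ E] [MeasurableSpace E] [BorelSpace E]
    (i : Fin p) : Measurable fun y : Fin p → E => gramSchmidt ℝ y i := by
  induction i using WellFoundedLT.induction with
  | ind i ih =>
    simp_rw [gramSchmidt_def ℝ _ i, Submodule.starProjection_singleton]
    refine (measurable_pi_apply i).sub (Finset.measurable_sum _ fun j hj => ?_)
    have := ih j (Finset.mem_Iio.1 hj)
    have h2 : Measurable fun y : Fin p → E => y i := measurable_pi_apply i
    exact ((this.inner h2).div (this.norm.pow_const 2)).smul this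

lemma measurable_prod_exp_log_gramSchmidt [FiniteDimensional ℝ E] [MeasurableSpace E]
    [BorelSpace E] (u : ℝ) : Measurable fun y : Fin p → E =>
      ∏ i, Complex.exp (u * Real.log ‖gramSchmidt ℝ y i‖ * Complex.I) := by
  refine Finset.measurable_prod _ fun i _ => ?_
  have := (measurable_gramSchmidt (E := E) i).norm.log.complex_ofReal
  fun_prop

lemma norm_prod_exp_log_gramSchmidt [FiniteDimensional ℝ E] (u : ℝ) (y : Fin p → E) :
    ‖∏ i, Complex.exp (u * Real.log ‖gramSchmidt ℝ y i‖ * Complex.I)‖ = 1 := by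
  rw [norm_prod]
  refine Finset.prod_eq_one fun i _ => ?_
  rw [← Complex.ofReal_mul, Complex.norm_exp_ofReal_mul_I]

variable [FiniteDimensional ℝ E] [MeasurableSpace E] [BorelSpace E]

/-- Under a product measure, the logarithms of the norms of the Gram–Schmidt vectors behave like
independent random variables if the law of the distance to a subspace depends on its dimension
only. -/
theorem ae_linearIndependent_and_integral_prod_gramSchmidt (μ : Measure E) [IsProbabilityMeasure μ]
    (hμ : μ ≪ volume) (u : ℝ) (Φ : ℕ → ℂ)
    (hΦ : ∀ V : Submodule ℝ E, V ≠ ⊤ → ∫ x, distPow V u x ∂μ = Φ (finrank ℝ V))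
    (hp : p ≤ finrank ℝ E) :
    (∀ᵐ y ∂(Measure.pi fun _ : Fin p => μ), LinearIndependent ℝ y) ∧
      ∫ y, ∏ i, Complex.exp (u * Real.log ‖gramSchmidt ℝ y i‖ * Complex.I)
        ∂(Measure.pi fun _ : Fin p => μ) = ∏ i : Fin p, Φ i := by
  induction p with
  | zero =>
    constructor
    · exact .of_forall fun y => linearIndependent_empty_type
    · simp
  | succ p ih =>
    obtain ⟨ih1, ih2⟩ := ih (by omega)
    have hmp := (measurePreserving_piFinSuccAbove (fun _ : Fin (p + 1) => μ) (Fin.last p)).symm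
    have hsymm : ∀ z : E × (Fin p → E),
        (MeasurableEquiv.piFinSuccAbove (fun _ : Fin (p + 1) => E) (Fin.last p)).symm z =
          Fin.snoc z.2 z.1 := by
      intro z
      simp [MeasurableEquiv.piFinSuccAbove, Fin.insertNthEquiv, Fin.insertNth_last']
    have htop : ∀ w : Fin p → E, Submodule.span ℝ (range w) ≠ ⊤ := by
      intro w h
      have h1 := finrank_range_le_card (R := ℝ) w
      rw [Set.finrank, h, finrank_top, Fintype.card_fin] at h1
      omega
    have hmeas : Measurable fun z : E × (Fin p → E) => (Fin.snoc z.2 z.1 : Fin (p + 1) → E) := by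
      have := hmp.measurable
      rwa [show _ = _ from funext hsymm] at this
    constructor
    · rw [← hmp.map_eq, (MeasurableEquiv.measurableEmbedding _).ae_map_iff]
      simp_rw [hsymm, linearIndependent_finSnoc]
      have h1 : ∀ᵐ z ∂(μ.prod (Measure.pi fun _ : Fin p => μ)), LinearIndependent ℝ z.2 :=
        Measure.quasiMeasurePreserving_snd.ae ih1
      have h2 : ∀ᵐ z ∂(μ.prod (Measure.pi fun _ : Fin p => μ)),
          gramSchmidt ℝ (Fin.snoc z.2 z.1 : Fin (p + 1) → E) (Fin.last p) ≠ 0 := by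
        have hset : MeasurableSet {z : E × (Fin p → E) |
            ¬gramSchmidt ℝ (Fin.snoc z.2 z.1 : Fin (p + 1) → E) (Fin.last p) ≠ 0} := by
          simp only [ne_eq, not_not]
          exact ((measurable_gramSchmidt _).comp hmeas) (measurableSet_singleton 0)
        rw [ae_iff, Measure.prod_apply_symm hset,
          lintegral_eq_zero_iff (measurable_measure_prodMk_right hset)]
        refine .of_forall fun w => measure_mono_null (t := (Submodule.span ℝ (range w) : Set E))
          (fun x hx => ?_) (hμ (Measure.addHaar_submodule _ _ (htop w)))
        simp only [ne_eq, not_not, mem_preimage, mem_ofPred_eq] at hx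
        rwa [← norm_eq_zero, norm_gramSchmidt_snoc_last, norm_eq_zero,
          Submodule.orthogonalProjectionOnto_eq_zero_iff, Submodule.orthogonal_orthogonal] at hx
      filter_upwards [h1, h2] with z hz1 hz2
      refine ⟨hz1, fun hz => hz2 ?_⟩
      rw [← norm_eq_zero, norm_gramSchmidt_snoc_last, norm_eq_zero,
        Submodule.orthogonalProjectionOnto_eq_zero_iff, Submodule.orthogonal_orthogonal]
      exact hz
    -- The last vector is integrated first, the others being fixed. Almost surely they are
    -- independent, so their span has dimension `p` and the inner integral is the constant `Φ p`.
    · rw [← hmp.integral_comp (MeasurableEquiv.measurableEmbedding _), integral_prod_symm]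
      · simp_rw [hsymm, Fin.prod_univ_castSucc, gramSchmidt_snoc_castSucc,
          norm_gramSchmidt_snoc_last, integral_const_mul]
        simp only [Fin.val_castSucc, Fin.val_last]
        rw [← ih2, ← integral_mul_const]
        refine integral_congr_ae ?_
        filter_upwards [ih1] with w hw
        have h1 := hΦ _ (htop w)
        rw [finrank_span_eq_card hw, Fintype.card_fin] at h1
        rw [← h1]
        congr 1
        exact (integral_congr_ae (hμ.ae_le (distPow_ae_eq _ (htop w) u))).symm
      · refine Integrable.of_bound (C := 1) ?_ (.of_forall fun z => ?_)
        · exact ((measurable_prod_exp_log_gramSchmidt u).comp hmp.measurable).aestronglyMeasurable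
        · exact (norm_prod_exp_log_gramSchmidt u _).le

end GramSchmidt

/-! ### The characteristic function of the log-volume -/

section LogVolume

open InnerProductSpace Module

variable {G H : ℝ → ℝ} {n p : ℕ}

lemma ae_logVolSimplex_eq (hn : 1 ≤ n) (hG : ∀ x, 0 ≤ G (Real.exp x))
    (hρ : Integrable (logRadialDensity G H n)) (hρ0 : 0 < ∫ x, logRadialDensity G H n x)
    (hp : p ≤ n) (u : ℝ) :
    (∀ᵐ y ∂(Measure.pi fun _ : Fin p => radialLaw G H n), logVolSimplex y =
      ∑ i, Real.log ‖gramSchmidt ℝ y i‖ + Real.log (volume (cornerSimplex p)).toReal) ∧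
    ∫ y, ∏ i, Complex.exp (u * Real.log ‖gramSchmidt ℝ y i‖ * Complex.I)
        ∂(Measure.pi fun _ : Fin p => radialLaw G H n) =
      ∏ k : Fin p, (densityCharFun (logRadialDensity G H n) u *
        gammaQuotient (((n : ℝ) - (k : ℕ)) / 2) (n / 2) (u / 2)) := by
  have := isProbabilityMeasure_radialLaw hn hG hρ hρ0
  obtain ⟨h1, h2⟩ := ae_linearIndependent_and_integral_prod_gramSchmidt (p := p) (radialLaw G H n)
    radialLaw_absolutelyContinuous u
    (fun k => densityCharFun (logRadialDensity G H n) u *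
        gammaQuotient (((n : ℝ) - k) / 2) (n / 2) (u / 2))
    (fun V hV => by
      rw [integral_distPow_radialLaw hn hG hρ hρ0 V hV u]
      congr 3
      have := V.finrank_add_finrank_orthogonal
      rw [finrank_euclideanSpace_fin] at this
      rw [eq_sub_iff_add_eq', ← Nat.cast_add, this])
    (by rwa [finrank_euclideanSpace_fin])
  refine ⟨?_, h2⟩
  filter_upwards [h1] with y hy using logVolSimplex_eq hy

/-- The characteristic function of the logarithmic volume of a random simplex. -/
theorem charFun_map_logVolSimplex (hn : 1 ≤ n) (hG : ∀ x, 0 ≤ G (Real.exp x))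
    (hρ : Integrable (logRadialDensity G H n)) (hρ0 : 0 < ∫ x, logRadialDensity G H n x)
    (hp : p ≤ n) {Ω : Type*} [MeasurableSpace Ω] (P : Measure Ω) [IsProbabilityMeasure P]
    (Y : Fin p → Ω → EuclideanSpace ℝ (Fin n)) (hY : iIndepFun Y P)
    (hlaw : ∀ i, HasLaw (Y i) (radialLaw G H n) P) :
    AEMeasurable (fun ω => logVolSimplex fun i => Y i ω) P ∧
      ∀ u : ℝ, charFun (P.map fun ω => logVolSimplex fun i => Y i ω) u =
        Complex.exp (u * Real.log (volume (cornerSimplex p)).toReal * Complex.I) *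
          (densityCharFun (logRadialDensity G H n) u ^ p *
          ∏ k ∈ Finset.range p, gammaQuotient (((n : ℝ) - k) / 2) (n / 2) (u / 2)) := by
  have := isProbabilityMeasure_radialLaw hn hG hρ hρ0
  have hYm : ∀ i, AEMeasurable (Y i) P := fun i => (hlaw i).aemeasurable
  have hmap : P.map (fun ω i => Y i ω) = Measure.pi fun _ : Fin p => radialLaw G H n := by
    rw [(iIndepFun_iff_map_fun_eq_pi_map hYm).1 hY]
    congr
    ext1 i
    exact (hlaw i).map_eq
  have hX : AEMeasurable (fun ω i => Y i ω) P := aemeasurable_pi_lambda _ hYm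
  -- Measurability is only needed almost everywhere, and there the log-volume is the measurable
  -- Gram–Schmidt expression.
  have hlog : AEMeasurable (logVolSimplex (n := n) (p := p))
      (Measure.pi fun _ : Fin p => radialLaw G H n) := by
    refine AEMeasurable.congr (Measurable.aemeasurable ?_)
      ((ae_logVolSimplex_eq hn hG hρ hρ0 hp 0).1.mono fun _ h => h.symm)
    refine Measurable.add_const (Finset.measurable_sum _ fun i _ => ?_) _
    exact (measurable_gramSchmidt i).norm.log
  rw [← hmap] at hlog
  refine ⟨hlog.comp_aemeasurable hX, fun u => ?_⟩
  obtain ⟨h1, h2⟩ := ae_logVolSimplex_eq hn hG hρ hρ0 hp u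
  have h3 : (P.map fun ω => logVolSimplex fun i => Y i ω) =
      (P.map fun ω i => Y i ω).map logVolSimplex :=
    (AEMeasurable.map_map_of_aemeasurable hlog hX).symm
  rw [h3, charFun_apply_real, integral_map hlog (by fun_prop), hmap]
  have h4 : ∀ᵐ y ∂(Measure.pi fun _ : Fin p => radialLaw G H n),
      Complex.exp (u * logVolSimplex y * Complex.I) =
        Complex.exp (u * Real.log (volume (cornerSimplex p)).toReal * Complex.I) *
        ∏ i, Complex.exp (u * Real.log ‖gramSchmidt ℝ y i‖ * Complex.I) := by
    filter_upwards [h1] with y hy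
    rw [hy, ← Complex.exp_sum, ← Complex.exp_add]
    congr 1
    push_cast
    rw [← Finset.sum_mul, ← Finset.mul_sum]
    ring
  rw [integral_congr_ae h4, integral_const_mul, h2, Finset.prod_mul_distrib, Finset.prod_const,
    Finset.card_univ, Fintype.card_fin,
    Finset.prod_range fun k : ℕ => gammaQuotient (((n : ℝ) - k) / 2) (n / 2) (u / 2)]

end LogVolume

/-! ### Summing the expansions over the dimensions -/

lemma HasCumulantExpansion.comp_div_two {φ : ℝ → ℂ} {M S K u₀ : ℝ}
    (h : HasCumulantExpansion φ M S K u₀) :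
    HasCumulantExpansion (fun u => φ (u / 2)) (M / 2) (S / 4) (K / 8) (2 * u₀) := fun u hu => by
  obtain ⟨ρ, hρ, he⟩ := h (u / 2) (by rw [abs_div, abs_two]; linarith)
  refine ⟨ρ, ?_, ?_⟩
  · rw [abs_div, abs_two] at hρ
    exact hρ.trans_eq (by ring)
  · simp only
    rw [he]
    congr 1
    push_cast
    ring

lemma hasCumulantExpansion_exp_mul_I (b u₀ : ℝ) :
    HasCumulantExpansion (fun u => Complex.exp (u * b * Complex.I)) b 0 0 u₀ :=
  fun u _ => ⟨0, by simp, by simp⟩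

section HarmonicSums

variable {n : ℕ}

/-- Comparison of a harmonic sum with the logarithm. The term `k = 0` is kept exactly: in the
variance it cancels the surplus `1 / n`, as the `j + 1` subtracted terms add up to `j / n + 1 / n`.
-/
lemma log_add_inv_le_sum_inv_sub {j : ℕ} (hj : j < n) :
    Real.log (n / (n - j)) + 1 / n ≤ ∑ k ∈ Finset.range (j + 1), 1 / ((n : ℝ) - k) := by
  induction j with
  | zero =>
    have : (n : ℝ) ≠ 0 := by exact_mod_cast (by omega : n ≠ 0)
    simp [this]
  | succ j ih =>
    rw [Finset.sum_range_succ]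
    have h1 : (j : ℝ) + 1 < n := by exact_mod_cast hj
    have h0 : (0 : ℝ) < n := by linarith [(Nat.cast_nonneg j : (0 : ℝ) ≤ j)]
    have h2 : (0 : ℝ) < n - (j + 1) := by linarith
    have h3 : (0 : ℝ) < n - j := by linarith
    have h4 : Real.log (n / (n - (j + 1))) =
        Real.log (n / (n - j)) + Real.log ((n - j) / (n - (j + 1))) := by
      rw [← Real.log_mul (by positivity) (by positivity)]
      congr 1
      field_simp
    have h5 := Real.log_le_sub_one_of_pos (x := ((n : ℝ) - j) / (n - (j + 1))) (by positivity)
    have h6 : ((n : ℝ) - j) / (n - (j + 1)) - 1 = 1 / (n - (j + 1)) := by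
      field_simp
      ring
    have := ih (by omega)
    push_cast
    rw [h4]
    linarith

lemma sum_inv_sub_sq_le {j : ℕ} (hj : j < n) :
    ∑ k ∈ Finset.range (j + 1), 1 / ((n : ℝ) - k) ^ 2 ≤
      1 / (n : ℝ) ^ 2 + 2 * (1 / (n - j) - 1 / n) := by
  induction j with
  | zero => simp
  | succ j ih =>
    rw [Finset.sum_range_succ]
    have h1 : (j : ℝ) + 1 + 1 ≤ n := by exact_mod_cast hj
    have h2 : (0 : ℝ) < n - (j + 1) := by linarith
    have h3 : (0 : ℝ) < n - j := by linarith
    have h4 : 1 / ((n : ℝ) - (j + 1)) ^ 2 ≤ 2 * (1 / (n - (j + 1)) - 1 / (n - j)) := by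
      have : 1 / ((n : ℝ) - (j + 1)) - 1 / (n - j) = 1 / ((n - (j + 1)) * (n - j)) := by
        field_simp
        ring
      rw [this, ← mul_one_div, ← mul_div_assoc, mul_one, mul_one_div,
        div_le_div_iff₀ (by positivity) (by positivity)]
      nlinarith
    have := ih (by omega)
    push_cast
    linarith

end HarmonicSums

section GammaQuotientProduct

variable {n j : ℕ}

lemma exists_hasCumulantExpansion_prod_gammaQuotient (hj : 1 ≤ j) (hjn : j < n) :
    ∃ M S : ℝ, (Real.log (n / (n - j)) - j / n) / 2 ≤ S ∧
      HasCumulantExpansion (fun u => ∏ k ∈ Finset.range (j + 1),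
        gammaQuotient (((n : ℝ) - k) / 2) (n / 2) (u / 2)) M S (15 * (j / n / (n - j)))
          ((n - j) / 2) := by
  have hj0 : (1 : ℝ) ≤ j := by exact_mod_cast hj
  have hjn' : (j : ℝ) + 1 ≤ n := by exact_mod_cast hjn
  have hn0 : (0 : ℝ) < n := by linarith
  have hm0 : (0 : ℝ) < n - j := by linarith
  have hk : ∀ k ∈ Finset.range (j + 1), ((n : ℝ) - j) ≤ n - k := by
    intro k hk
    have : (k : ℝ) ≤ j := by exact_mod_cast Nat.lt_succ_iff.1 (Finset.mem_range.1 hk)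
    linarith
  have hQ : ∀ k : ℕ, ∃ M S : ℝ, k ∈ Finset.range (j + 1) →
      (1 / ((n : ℝ) - k) - 1 / n) / 2 ≤ S ∧
      HasCumulantExpansion (fun u => gammaQuotient (((n : ℝ) - k) / 2) (n / 2) (u / 2)) M S
        (5 * (1 / ((n : ℝ) - k) ^ 2)) ((n - j) / 2) := by
    intro k
    by_cases hkj : k ∈ Finset.range (j + 1)
    swap
    · exact ⟨0, 0, fun h => absurd h hkj⟩
    have h1 := hk k hkj
    have h2 : (0 : ℝ) < n - k := by linarith
    have h3 : (0 : ℝ) ≤ k := Nat.cast_nonneg k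
    obtain ⟨M, S, hS, h⟩ := exists_hasCumulantExpansion_gammaQuotient
      (a := ((n : ℝ) - k) / 2) (b := n / 2) (by linarith) (by linarith)
    refine ⟨M / 2, S / 4, fun _ => ⟨?_, h.comp_div_two.mono (le_of_eq ?_) (by linarith)⟩⟩
    · have : 1 / (((n : ℝ) - k) / 2) - 1 / (n / 2 : ℝ) = 2 * (1 / ((n : ℝ) - k) - 1 / n) := by
        field_simp
      linarith
    · field_simp
      norm_num
  choose M S hMS using hQ
  -- The 15 is five times three: the sum of `1 / (n - k)²` is at most `1 / n² + 2 θ / m`, and `1 /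
  -- n² ≤ θ / m`, where `θ = j / n` and `m = n - j`.
  refine ⟨_, _, ?_, (HasCumulantExpansion.prod _ fun k hk => (hMS k hk).2).mono ?_ le_rfl⟩
  · have h1 := log_add_inv_le_sum_inv_sub hjn
    refine le_trans ?_ (Finset.sum_le_sum fun k hk => (hMS k hk).1)
    rw [← Finset.sum_div, Finset.sum_sub_distrib, Finset.sum_const, Finset.card_range,
      nsmul_eq_mul]
    have : ((j + 1 : ℕ) : ℝ) * (1 / n) = j / n + 1 / n := by
      push_cast
      ring
    rw [this]
    linarith
  · rw [← Finset.mul_sum]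
    have h1 := sum_inv_sub_sq_le hjn
    have h2 : 1 / ((n : ℝ) - j) - 1 / n = j / n / (n - j) := by
      field_simp
      ring
    have h3 : 1 / (n : ℝ) ^ 2 ≤ j / n / (n - j) := by
      rw [div_div, div_le_div_iff₀ (by positivity) (by positivity)]
      nlinarith
    rw [h2] at h1
    linarith

lemma norm_prod_gammaQuotient_antitone (hjn : j < n) {v w : ℝ} (hv : 0 ≤ v) (hvw : v ≤ w) :
    ‖∏ k ∈ Finset.range (j + 1), gammaQuotient (((n : ℝ) - k) / 2) (n / 2) (w / 2)‖ ≤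
      ‖∏ k ∈ Finset.range (j + 1), gammaQuotient (((n : ℝ) - k) / 2) (n / 2) (v / 2)‖ := by
  rw [norm_prod, norm_prod]
  refine Finset.prod_le_prod (fun _ _ => norm_nonneg _) fun k hk => ?_
  have h1 : (k : ℝ) < n := by exact_mod_cast (Finset.mem_range.1 hk).trans_le hjn
  have h2 : (0 : ℝ) ≤ k := Nat.cast_nonneg k
  exact norm_gammaQuotient_antitone (by linarith) (by linarith) (by linarith) (by linarith)

end GammaQuotientProduct

/-! ### Error terms and conclusion -/

lemma exists_pow_five_mul_exp_neg_sq_le {c : ℝ} (hc : 0 < c) :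
    ∃ B : ℝ, 0 < B ∧ ∀ x : ℝ, 0 ≤ x → x ^ 5 * Real.exp (-(c * x ^ 2)) ≤ B := by
  refine ⟨1 + 6 / c ^ 3, by positivity, fun x hx => ?_⟩
  have h1 : x ^ 5 ≤ 1 + x ^ 6 := by
    rcases le_total x 1 with h | h
    · have : x ^ 5 ≤ 1 := pow_le_one₀ hx h
      have : 0 ≤ x ^ 6 := by positivity
      linarith
    · have : x ^ 5 ≤ x ^ 6 := pow_le_pow_right₀ h (by norm_num)
      linarith
  have h2 : (c * x ^ 2) ^ 3 / 6 ≤ Real.exp (c * x ^ 2) := by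
    have := Real.pow_div_factorial_le_exp (c * x ^ 2) (by positivity) 3
    simpa [Nat.factorial] using this
  have h3 : Real.exp (-(c * x ^ 2)) ≤ 1 := Real.exp_le_one_iff.2 (by
    have : 0 ≤ c * x ^ 2 := by positivity
    linarith)
  have h4 : x ^ 6 * Real.exp (-(c * x ^ 2)) ≤ 6 / c ^ 3 := by
    rw [Real.exp_neg, ← div_eq_mul_inv, div_le_div_iff₀ (Real.exp_pos _) (by positivity)]
    nlinarith
  calc x ^ 5 * Real.exp (-(c * x ^ 2)) ≤ (1 + x ^ 6) * Real.exp (-(c * x ^ 2)) := by gcongr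
    _ ≤ 1 + 6 / c ^ 3 := by linarith

/-- For the middle Esseen term: the exponential must beat the factor `T / u₀` and still yield a
factor `θ`, which may be as small as `1 / n`. -/
lemma exists_exp_neg_mul_le {c : ℝ} (hc : 0 < c) :
    ∃ B : ℝ, 0 < B ∧ ∀ n m θ Λ : ℝ, 4 ≤ n → 1 ≤ m → m + 1 ≤ n → θ = 1 - m / n → θ ≤ Λ →
      Λ ≤ θ + θ * Λ → Real.exp (-(c * (Λ * min m √n ^ 2))) * (m ^ 2 * √Λ ^ 5) ≤
        B * (θ * min m √n) := by
  obtain ⟨B, hB, hexp⟩ := exists_pow_five_mul_exp_neg_sq_le hc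
  refine ⟨2 * B, by positivity, ?_⟩
  intro n m θ Λ hn hm hmn hθ hθΛ hΛ
  have hn0 : 0 < n := by linarith
  have hθn : θ * n = n - m := by
    rw [hθ]
    field_simp
  have hθ0 : 0 < θ := by
    by_contra h
    nlinarith
  have hΛ0 : 0 < Λ := hθ0.trans_le hθΛ
  set s := √n with hs
  have hs2 : s ^ 2 = n := Real.sq_sqrt hn0.le
  have hs_two : 2 ≤ s := Real.le_sqrt_of_sq_le (by linarith)
  set l := √Λ with hl
  have hl2 : l ^ 2 = Λ := Real.sq_sqrt hΛ0.le
  have hl0 : 0 < l := Real.sqrt_pos.2 hΛ0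
  rcases le_total m s with h | h
  · rw [min_eq_left h]
    have h1 := hexp (m * l) (by positivity)
    rw [mul_pow m l 2, hl2, mul_comm (m ^ 2) Λ] at h1
    -- As `m ≤ √n` and `n ≥ 4`, `m / n ≤ 1/2`; so the factor `θ` costs nothing in this case.
    have hθ2 : 1 ≤ 2 * θ := by nlinarith
    have hm3 : m ^ 2 ≤ m ^ 6 := pow_le_pow_right₀ hm (by norm_num)
    have h2 : Real.exp (-(c * (Λ * m ^ 2))) * (m ^ 2 * l ^ 5) ≤ m * B := by
      calc Real.exp (-(c * (Λ * m ^ 2))) * (m ^ 2 * l ^ 5)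
          ≤ Real.exp (-(c * (Λ * m ^ 2))) * (m ^ 6 * l ^ 5) := by gcongr
        _ = m * ((m * l) ^ 5 * Real.exp (-(c * (Λ * m ^ 2)))) := by ring
        _ ≤ m * B := by gcongr
    have h3 : m * B ≤ (2 * θ) * (m * B) := le_mul_of_one_le_left (by positivity) hθ2
    linarith
  · rw [min_eq_right h]
    have h1 := hexp (s * l) (by positivity)
    rw [mul_pow s l 2, hl2, mul_comm (s ^ 2) Λ] at h1
    have h2 : Λ ≤ θ * (1 + Λ) := by linarith
    -- Here `n Λ ≥ n θ = n - m ≥ 1`. Together with `Λ ≤ θ (1 + Λ)` this trades one factor `Λ` for `2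
    -- θ n Λ`.
    have h3 : 1 + Λ ≤ 2 * (s ^ 2 * l ^ 2) := by
      rw [hs2, hl2]
      nlinarith
    have h4 : l ^ 2 ≤ θ * (2 * (s ^ 2 * l ^ 2)) := by
      rw [hl2] at *
      exact h2.trans (by gcongr)
    have hms : m ^ 2 ≤ s ^ 4 := by
      have : s ^ 4 = n ^ 2 := by rw [← hs2]; ring
      rw [this]
      gcongr
      linarith
    calc Real.exp (-(c * (Λ * s ^ 2))) * (m ^ 2 * l ^ 5)
        ≤ Real.exp (-(c * (Λ * s ^ 2))) * (s ^ 4 * l ^ 5) := by gcongr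
      _ = Real.exp (-(c * (Λ * s ^ 2))) * (s ^ 4 * l ^ 3 * l ^ 2) := by ring
      _ ≤ Real.exp (-(c * (Λ * s ^ 2))) * (s ^ 4 * l ^ 3 * (θ * (2 * (s ^ 2 * l ^ 2)))) := by gcongr
      _ = 2 * (θ * s) * ((s * l) ^ 5 * Real.exp (-(c * (Λ * s ^ 2)))) := by ring
      _ ≤ 2 * (θ * s) * B := by gcongr
      _ = _ := by ring

/-- The sum of the error terms from Esseen's inequality, for a cut-off `T = mΛ / √θ`. -/
lemma exists_esseen_error_le {c₂ c₃ C₁ : ℝ} (hc₂ : 0 < c₂) (hc₃ : 0 < c₃) (hC₁ : 0 < C₁) :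
    ∃ C : ℝ, 0 < C ∧ ∀ n m θ Λ S : ℝ, 4 ≤ n → 1 ≤ m → m + 1 ≤ n → θ = 1 - m / n → θ < Λ →
      Λ ≤ θ + θ * Λ → c₂ * Λ ≤ S →
      C₁ * (θ / m) / √S ^ 3 +
        (Real.exp (-(c₂ / 2 * (Λ * (c₃ * min m √n) ^ 2))) +
          Real.exp (-(S * (c₃ * min m √n) ^ 2 / 2))) * (m * Λ / √θ) / (c₃ * min m √n) +
        1 / (√S * (m * Λ / √θ)) ≤ C * (θ ^ 2 / (m * (Λ - θ) ^ (3 / 2 : ℝ))) := by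
  obtain ⟨B, hB, hexp⟩ := exists_exp_neg_mul_le (c := c₂ / 2 * c₃ ^ 2) (by positivity)
  refine ⟨C₁ / √c₂ ^ 3 + 2 * B / c₃ + 1 / √c₂, by positivity, ?_⟩
  intro n m θ Λ S hn hm hmn hθ hθΛ hΛ hS
  have hn0 : 0 < n := by linarith
  have hm0 : 0 < m := by linarith
  have hθn : θ * n = n - m := by
    rw [hθ]
    field_simp
  have hθ0 : 0 < θ := by
    by_contra h
    nlinarith
  have hθ1 : θ ≤ 1 := by
    by_contra h
    nlinarith
  have hΛ0 : 0 < Λ := hθ0.trans hθΛ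
  have hmain := hexp n m θ Λ hn hm hmn hθ hθΛ.le hΛ
  have hsn : 0 < √n := Real.sqrt_pos.2 hn0
  set w := min m √n with hw
  have hw0 : 0 < w := lt_min hm0 hsn
  set l := √Λ with hl
  have hl2 : Λ = l ^ 2 := (Real.sq_sqrt hΛ0.le).symm
  have hl0 : 0 < l := Real.sqrt_pos.2 hΛ0
  set a := √θ with ha
  have ha2 : θ = a ^ 2 := (Real.sq_sqrt hθ0.le).symm
  have ha0 : 0 < a := Real.sqrt_pos.2 hθ0
  have ha1 : a ≤ 1 := Real.sqrt_le_one.2 hθ1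
  set d := √c₂ with hd
  have hd2 : c₂ = d ^ 2 := (Real.sq_sqrt hc₂.le).symm
  have hd0 : 0 < d := Real.sqrt_pos.2 hc₂
  have hSd : d * l ≤ √S := by
    rw [hd, hl, ← Real.sqrt_mul hc₂.le]
    exact Real.sqrt_le_sqrt hS
  have hdl : 0 < d * l := by positivity
  have hS0 : 0 < √S := hdl.trans_le hSd
  -- The common target of all three terms is `√θ / (m Λ^{3/2})`; the inequality `Λ - θ ≤ θ Λ`
  -- converts it into the stated bound.
  have hY : a / (m * l ^ 3) ≤ θ ^ 2 / (m * (Λ - θ) ^ (3 / 2 : ℝ)) := by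
    have h1 : (Λ - θ) ^ (3 / 2 : ℝ) ≤ (a * l) ^ 3 := by
      calc (Λ - θ) ^ (3 / 2 : ℝ) ≤ ((a * l) ^ 2) ^ (3 / 2 : ℝ) := by
            refine Real.rpow_le_rpow (by linarith) ?_ (by norm_num)
            rw [mul_pow, ← ha2, ← hl2]
            linarith
        _ = (a * l) ^ 3 := by
            rw [← Real.rpow_natCast, ← Real.rpow_mul (by positivity), ← Real.rpow_natCast]
            norm_num
    have h2 : 0 < (Λ - θ) ^ (3 / 2 : ℝ) := Real.rpow_pos_of_pos (by linarith) _
    calc a / (m * l ^ 3) = θ ^ 2 / (m * (a * l) ^ 3) := by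
          rw [ha2]
          field_simp
      _ ≤ _ := by gcongr
  refine le_trans ?_ (mul_le_mul_of_nonneg_left hY (by positivity))
  have t1 : C₁ * (θ / m) / √S ^ 3 ≤ C₁ / d ^ 3 * (a / (m * l ^ 3)) := by
    calc C₁ * (θ / m) / √S ^ 3 ≤ C₁ * (a / m) / (d * l) ^ 3 := by
          gcongr
          rw [ha2]
          nlinarith
      _ = _ := by
          field_simp
  have t3 : 1 / (√S * (m * Λ / a)) ≤ 1 / d * (a / (m * l ^ 3)) := by
    calc 1 / (√S * (m * Λ / a)) ≤ 1 / (d * l * (m * Λ / a)) := by gcongr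
      _ = _ := by
          rw [hl2]
          field_simp
  have t2 : (Real.exp (-(c₂ / 2 * (Λ * (c₃ * w) ^ 2))) + Real.exp (-(S * (c₃ * w) ^ 2 / 2))) *
      (m * Λ / a) / (c₃ * w) ≤ 2 * B / c₃ * (a / (m * l ^ 3)) := by
    have h1 : Real.exp (-(S * (c₃ * w) ^ 2 / 2)) ≤
        Real.exp (-(c₂ / 2 * (Λ * (c₃ * w) ^ 2))) := by
      refine Real.exp_le_exp.2 (neg_le_neg ?_)
      have : c₂ * Λ * (c₃ * w) ^ 2 ≤ S * (c₃ * w) ^ 2 := by gcongr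
      linarith
    have h2 : c₂ / 2 * (Λ * (c₃ * w) ^ 2) = c₂ / 2 * c₃ ^ 2 * (Λ * w ^ 2) := by ring
    rw [h2] at h1 ⊢
    set e := Real.exp (-(c₂ / 2 * c₃ ^ 2 * (Λ * w ^ 2))) with he
    calc (e + Real.exp (-(S * (c₃ * w) ^ 2 / 2))) * (m * Λ / a) / (c₃ * w)
        ≤ (e + e) * (m * Λ / a) / (c₃ * w) := by gcongr
      _ = 2 * (e * (m ^ 2 * l ^ 5)) / (c₃ * w * (a * m * l ^ 3)) := by
          rw [hl2]
          field_simp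
          ring
      _ ≤ 2 * (B * (θ * w)) / (c₃ * w * (a * m * l ^ 3)) := by gcongr
      _ = _ := by
          rw [ha2]
          field_simp
  linarith

lemma log_one_div_one_sub_bounds {θ : ℝ} (h0 : 0 < θ) (h1 : θ < 1) :
    θ < Real.log (1 / (1 - θ)) ∧
      Real.log (1 / (1 - θ)) ≤ θ + θ * Real.log (1 / (1 - θ)) := by
  have h2 : 0 < 1 - θ := by linarith
  constructor
  · have := Real.log_lt_sub_one_of_pos h2 (by linarith)
    rw [one_div, Real.log_inv]
    linarith
  · have h3 := Real.log_le_sub_one_of_pos (x := 1 / (1 - θ)) (by positivity)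
    have h4 : (1 / (1 - θ) - 1) * (1 - θ) = θ := by
      field_simp
      ring
    nlinarith

/-- The cumulant expansion and the decay of the characteristic function of the logarithmic volume
of a random simplex. -/
lemma exists_hasCumulantExpansion_mul_prod_gammaQuotient {n j : ℕ} (hj : 1 ≤ j) (hjn : j < n)
    {φ : ℝ → ℂ} {M S C c c₂ c₃ : ℝ} (b : ℝ) (hC : 0 < C) (hc : 0 < c) (hc₂ : c₂ ≤ c)
    (hc₂' : c₂ ≤ 1 / 2) (hc₃ : 0 < c₃) (hc₃c : c₃ ≤ c) (hc₃' : c₃ ≤ 1 / 2) (hc₃c' : 30 * c₃ ≤ c)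
    (hS : c / n ≤ S) (hφ : HasCumulantExpansion φ M S (C / n ^ 2) (c * √n))
    (hdecay : ∀ u, ‖φ u‖ ≤ Real.exp (-(c * min (u ^ 2 / n) 1))) :
    ∃ M' S' : ℝ, c₂ * Real.log (n / (n - j)) ≤ S' ∧
      HasCumulantExpansion (fun u => Complex.exp (u * b * Complex.I) * (φ u ^ (j + 1) *
          ∏ k ∈ Finset.range (j + 1), gammaQuotient (((n : ℝ) - k) / 2) (n / 2) (u / 2)))
        M' S' ((15 + 2 * C) * (j / n / (n - j))) (c₃ * min ((n : ℝ) - j) √n) ∧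
      ∀ u, c₃ * min ((n : ℝ) - j) √n ≤ u →
        ‖Complex.exp (u * b * Complex.I) * (φ u ^ (j + 1) *
          ∏ k ∈ Finset.range (j + 1), gammaQuotient (((n : ℝ) - k) / 2) (n / 2) (u / 2))‖ ≤
        Real.exp (-(c₂ / 2 * (Real.log (n / (n - j)) * (c₃ * min ((n : ℝ) - j) √n) ^ 2))) := by
  have hj0 : (1 : ℝ) ≤ j := by exact_mod_cast hj
  have hjn' : (j : ℝ) + 1 ≤ n := by exact_mod_cast hjn
  have hn0 : (0 : ℝ) < n := by linarith
  have hm0 : (0 : ℝ) < n - j := by linarith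
  have hsn : 0 < √(n : ℝ) := Real.sqrt_pos.2 hn0
  set θ : ℝ := j / n with hθ
  have hθ0 : 0 < θ := by positivity
  have hθ1 : θ < 1 := by
    rw [hθ, div_lt_one hn0]
    linarith
  have hnm : (n : ℝ) / (n - j) = 1 / (1 - θ) := by
    rw [hθ]
    field_simp
  obtain ⟨hΛ1, -⟩ := log_one_div_one_sub_bounds hθ0 hθ1
  rw [← hnm] at hΛ1
  set m : ℝ := n - j with hm
  set Λ := Real.log (n / m) with hΛ
  obtain ⟨Mβ, Sβ, hSβ, hβ⟩ := exists_hasCumulantExpansion_prod_gammaQuotient hj hjn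
  rw [← hm, ← hθ, ← hΛ] at hSβ
  rw [← hm, ← hθ] at hβ
  set w := min m √(n : ℝ) with hw
  have hw0 : 0 < w := lt_min hm0 hsn
  have hwm : w ≤ m := min_le_left _ _
  have hws : w ≤ √(n : ℝ) := min_le_right _ _
  -- The norms contribute variance of order `θ`, the directions at least `(Λ - θ) / 2`; only
  -- together do they reach a multiple of `Λ`.
  have hSR : c * θ ≤ ((j + 1 : ℕ) : ℝ) * S := by
    have h1 : (j : ℝ) * (c / n) ≤ ((j + 1 : ℕ) : ℝ) * S := by
      push_cast
      have : 0 ≤ c / n := by positivity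
      nlinarith
    refine le_trans (le_of_eq ?_) h1
    rw [hθ]
    ring
  refine ⟨b + (((j + 1 : ℕ) : ℝ) * M + Mβ), 0 + (((j + 1 : ℕ) : ℝ) * S + Sβ), ?_, ?_, ?_⟩
  · nlinarith
  · refine HasCumulantExpansion.mono (K := 0 + (((j + 1 : ℕ) : ℝ) * (C / n ^ 2) + 15 * (θ / m)))
      ((hasCumulantExpansion_exp_mul_I b _).mul
      (((hφ.mono le_rfl ?_).pow (j + 1)).mul (hβ.mono le_rfl ?_))) ?_ le_rfl
    · gcongr
    · nlinarith
    · have h1 : ((j + 1 : ℕ) : ℝ) * (C / n ^ 2) ≤ 2 * C * (θ / m) := by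
        calc ((j + 1 : ℕ) : ℝ) * (C / n ^ 2) ≤ (2 * j) * (C / n ^ 2) := by
              gcongr
              push_cast
              linarith
          _ = 2 * C * (θ / n) := by
              rw [hθ]
              field_simp
          _ ≤ 2 * C * (θ / m) := by
              gcongr
              linarith
      linarith
  · intro u hu
    have hu0 : 0 < c₃ * w := by positivity
    set v := c₃ * w with hv
    have hb : ‖Complex.exp (u * b * Complex.I)‖ = 1 := by
      rw [← Complex.ofReal_mul, Complex.norm_exp_ofReal_mul_I]
    rw [norm_mul, hb, one_mul, norm_mul, norm_pow]
    -- Beyond `v` both parts are bounded by their size at `v`: here by the decay estimate, whose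
    -- minimum is at least `v² / n` because `v ≤ √n`; for the Gamma factors by monotonicity.
    have hR : ‖φ u‖ ^ (j + 1) ≤ Real.exp (-(c * θ * v ^ 2)) := by
      have hv1 : v ^ 2 / n ≤ min (u ^ 2 / n) 1 := by
        refine le_min (by gcongr) ?_
        rw [div_le_one hn0]
        have : v ≤ √(n : ℝ) := by nlinarith
        calc v ^ 2 ≤ √(n : ℝ) ^ 2 := by gcongr
          _ = (n : ℝ) := Real.sq_sqrt hn0.le
      calc ‖φ u‖ ^ (j + 1) ≤ Real.exp (-(c * (v ^ 2 / n))) ^ (j + 1) := by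
            gcongr
            refine (hdecay u).trans (Real.exp_le_exp.2 (neg_le_neg ?_))
            gcongr
        _ = Real.exp (-((j + 1) * (c * (v ^ 2 / n)))) := by
            rw [← Real.exp_nat_mul]
            congr 1
            push_cast
            ring
        _ ≤ _ := by
            refine Real.exp_le_exp.2 (neg_le_neg ?_)
            have h1 : c * θ * v ^ 2 = j * (c * (v ^ 2 / n)) := by
              rw [hθ]
              ring
            have h2 : 0 ≤ c * (v ^ 2 / n) := by positivity
            rw [h1]
            linarith
    have hB := (norm_prod_gammaQuotient_antitone hjn hu0.le hu).trans
      (hβ.norm_eq (u := v) (by rw [abs_of_pos hu0]; nlinarith))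
    rw [abs_of_pos hu0] at hB
    refine (mul_le_mul hR hB (norm_nonneg _) (Real.exp_nonneg _)).trans ?_
    rw [← Real.exp_add]
    refine Real.exp_le_exp.2 ?_
    -- The cubic remainder of the Gamma factors is absorbed by half of the decay of the norms; this
    -- is what `30 * c₃ ≤ c` is for.
    have h1 : 15 * (θ / m) * v ^ 3 ≤ 15 * c₃ * θ * v ^ 2 := by
      have : v / m ≤ c₃ := by
        rw [div_le_iff₀ hm0]
        exact mul_le_mul_of_nonneg_left hwm hc₃.le
      calc 15 * (θ / m) * v ^ 3 = 15 * θ * v ^ 2 * (v / m) := by ring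
        _ ≤ 15 * θ * v ^ 2 * c₃ := by gcongr
        _ = _ := by ring
    have h2 : 15 * c₃ * θ * v ^ 2 ≤ c / 2 * θ * v ^ 2 := by
      gcongr
      linarith
    have h3 : (Λ - θ) / 2 * v ^ 2 ≤ Sβ * v ^ 2 := by gcongr
    have h4 : c₂ / 2 * θ ≤ c / 2 * θ := by gcongr
    have h5 : c₂ / 2 * (Λ - θ) ≤ 1 / 2 / 2 * (Λ - θ) := by
      have : 0 ≤ Λ - θ := by linarith
      gcongr
    have h6 : c₂ / 2 * Λ * v ^ 2 ≤ (c / 2 * θ + 1 / 2 / 2 * (Λ - θ)) * v ^ 2 := by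
      gcongr
      linarith
    linarith

theorem theoremC (G H : ℝ → ℝ) (hGH : RadiallyAdmissible G H) :
    ∃ C : ℝ, 0 < C ∧ ∃ n₀ : ℕ, ∀ n : ℕ, n₀ ≤ n →
      IsProbabilityMeasure (radialLaw G H n) ∧
      ∀ p : ℕ, 2 ≤ p → p ≤ n →
        ∀ (Ω : Type u) [MeasurableSpace Ω] (P : Measure Ω) [IsProbabilityMeasure P]
          (Y : Fin p → Ω → EuclideanSpace ℝ (Fin n)),
          iIndepFun Y P → (∀ i, HasLaw (Y i) (radialLaw G H n) P) →
          ∀ W : Ω → ℝ, W = (fun ω => logVolSimplex (fun i => Y i ω)) →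
          ∀ θ : ℝ, θ = ((p : ℝ) - 1) / n →
            MemLp W 2 P ∧ 0 < variance W P ∧
            kolmogorovDist (standardizedLaw P W) (gaussianReal 0 1) ≤
              C * (θ ^ 2 /
                (n * (1 - θ) * (Real.log (1 / (1 - θ)) - θ) ^ (3 / 2 : ℝ))) := by
  have hG : ∀ x, 0 ≤ G (Real.exp x) := hGH.1
  obtain ⟨C, c, n₁, hC, hc, hn₁, -, hexp⟩ := Admissible.exists_hasCumulantExpansion hGH
  have hrad : ∀ n : ℕ, n₁ ≤ n → Integrable (logRadialDensity G H n) ∧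
      0 < ∫ x, logRadialDensity G H n x ∧ ∃ M S, c / n ≤ S ∧
        HasCumulantExpansion (densityCharFun (logRadialDensity G H n)) M S (C / n ^ 2) (c * √n) ∧
        ∀ u, ‖densityCharFun (logRadialDensity G H n) u‖ ≤
          Real.exp (-(c * min (u ^ 2 / n) 1)) := hexp
  obtain ⟨Cₛ, hCₛ, hsmooth⟩ := exists_kolmogorovDist_le_of_cumulantExpansion.{u}
  set C₁ := 15 + 2 * C with hC₁
  set c₂ := min c (1 / 2) with hc₂
  have hc₂0 : 0 < c₂ := lt_min hc (by norm_num)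
  have hC₁0 : 0 < C₁ := by positivity
  obtain ⟨c₃, hc₃0, hc₃1, hc₃2, hc₃3, hc₃4⟩ : ∃ c₃ : ℝ, 0 < c₃ ∧ c₃ ≤ c ∧ c₃ ≤ 1 / 2 ∧
      30 * c₃ ≤ c ∧ C₁ * c₃ ≤ c₂ / 4 := by
    refine ⟨min (min (c / 30) (1 / 2)) (c₂ / 4 / C₁), by positivity, ?_, ?_, ?_, ?_⟩
    · refine (min_le_left _ _).trans ((min_le_left _ _).trans ?_)
      linarith
    · exact (min_le_left _ _).trans (min_le_right _ _)
    · have := (min_le_left (min (c / 30) (1 / 2)) (c₂ / 4 / C₁)).trans (min_le_left _ _)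
      linarith
    · rw [mul_comm, ← le_div_iff₀ hC₁0]
      exact min_le_right _ _
  obtain ⟨D, hD, herr⟩ := exists_esseen_error_le hc₂0 hc₃0 hC₁0
  refine ⟨Cₛ * D, by positivity, max n₁ 4, fun n hn => ?_⟩
  have hnn₁ : n₁ ≤ n := (le_max_left _ _).trans hn
  have hn4 : 4 ≤ n := (le_max_right _ _).trans hn
  have hn1 : 1 ≤ n := by omega
  obtain ⟨hρ, hρ0, M, S, hS, hφ, hdecay⟩ := hrad n hnn₁
  refine ⟨isProbabilityMeasure_radialLaw hn1 hG hρ hρ0, ?_⟩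
  intro p hp2 hpn Ω _ P _ Y hY hlaw W hW θ hθ
  -- In terms of `j` one has `θ = j / n`, and `p ≥ 2` means `θ > 0`.
  obtain ⟨j, rfl⟩ : ∃ j, p = j + 1 := ⟨p - 1, by omega⟩
  have hj : 1 ≤ j := by omega
  have hjn : j < n := by omega
  obtain ⟨hWm, hchar⟩ := charFun_map_logVolSimplex hn1 hG hρ hρ0 hpn P Y hY hlaw
  rw [← hW] at hWm hchar
  obtain ⟨M', S', hS', hexpW, hdecW⟩ := exists_hasCumulantExpansion_mul_prod_gammaQuotient hj hjn
    (Real.log (volume (cornerSimplex (j + 1))).toReal) hC hc (min_le_left _ _) (min_le_right _ _)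
    hc₃0 hc₃1 hc₃2 hc₃3 hS hφ hdecay
  have hj0 : (1 : ℝ) ≤ j := by exact_mod_cast hj
  have hjn' : (j : ℝ) + 1 ≤ n := by exact_mod_cast hjn
  have hn4' : (4 : ℝ) ≤ n := by exact_mod_cast hn4
  have hn0 : (0 : ℝ) < n := by linarith
  have hθj : θ = j / n := by
    rw [hθ]
    push_cast
    ring
  have hθ0 : 0 < θ := by
    rw [hθj]
    positivity
  have hθ1 : θ < 1 := by
    rw [hθj, div_lt_one hn0]
    linarith
  have hm0 : (0 : ℝ) < n - j := by linarith
  have hmθ : (n : ℝ) * (1 - θ) = n - j := by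
    rw [hθj]
    field_simp
  have hnm : (n : ℝ) / (n - j) = 1 / (1 - θ) := by
    rw [hθj]
    field_simp
  obtain ⟨hΛ1, hΛ2⟩ := log_one_div_one_sub_bounds hθ0 hθ1
  rw [hmθ]
  rw [hnm, ← hc₂] at hS' hdecW
  rw [← hθj, ← hC₁] at hexpW
  set Λ := Real.log (1 / (1 - θ)) with hΛ
  set m : ℝ := n - j with hm
  have hw0 : 0 < min m √(n : ℝ) := lt_min hm0 (Real.sqrt_pos.2 hn0)
  have hΛ0 : 0 < Λ := hθ0.trans hΛ1
  have hS0 : 0 < S' := lt_of_lt_of_le (by positivity) hS'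
  obtain ⟨hmem, hvar, hK⟩ := hsmooth Ω P W M' S' (C₁ * (θ / m)) (c₃ * min m √(n : ℝ)) _ hWm hS0
    (by positivity) (by positivity) (Real.exp_nonneg _)
    (by
      calc C₁ * (θ / m) * (c₃ * min m √(n : ℝ)) ≤ C₁ * (θ / m) * (c₃ * m) := by
            gcongr
            exact min_le_left _ _
        _ = C₁ * c₃ * θ := by field_simp
        _ ≤ c₂ / 4 * Λ := by gcongr
        _ ≤ S' / 4 := by linarith)
    (by
      rw [funext hchar]
      exact hexpW)
    (fun u hu => by
      rw [hchar]
      exact hdecW u hu)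
  -- This cut-off gives the last Esseen term `1 / (√S' T)` exactly the order `√θ / (m Λ^{3/2})` when
  -- `S'` is of order `Λ`.
  refine ⟨hmem, hvar, (hK (m * Λ / √θ) (by positivity)).trans ?_⟩
  rw [mul_assoc]
  refine mul_le_mul_of_nonneg_left ?_ hCₛ.le
  exact herr n m θ Λ S' hn4' (by linarith) (by linarith)
    (by rw [hθj, hm]; field_simp; ring) hΛ1 hΛ2 hS'
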